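/- **Model.** A major agent $0$ and minor agents $i\in N=\{1,\dots,n\}$ evolve over times $1,\dots,T$ ($T\ge 1$), with states $x_i(t)$ and controls $u_i(t)$ in Euclidean spaces: $$x_0(t+1)=A_{00}x_0(t)+B_{00}u_0(t)+w_0(t),$$ $$x_i(t+1)=A_{ii}x_i(t)+A_{i0}x_0(t)+B_{ii}u_i(t)+B_{i0}u_0(t)+w_i(t),\qquad y_i(t)=C_{ii}x_i(t)+v_i(t),\qquad i\in N.$$ The primitive random variables $x_0(1),x_i(1)$ and $w_0(t),w_i(t),v_i(t)$ ($i\in N$, $1\le t\le T$) are independent, have zero mean and finite variance, and need not be Gaussian; for $i\in N$, $\Sigma^x_i,\Sigma^w_i,\Sigma^v_i$ are the covariance matrices of $x_i(1),w_i(t),v_i(t)$ (the latter two not depending on $t$). Write $x(t),u(t)$ for the stacked state and control, and $x(t+1)=Ax(t)+Bu(t)+w(t)$ for the stacked dynamics. The agents know $$I_0(t)=\{x_0(1{:}t),u_0(1{:}t-1)\},\qquad I_i(t)=\{x_0(1{:}t),y_i(1{:}t),u_0(1{:}t-1),u_i(1{:}t-1)\},$$ and an affine strategy $g$ consists of affine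 maps $g_{i,t}$ with $u_i(t)=g_{i,t}(I_i(t))$, $i\in\{0,\dots,n\}$. Its cost is $$J(g)=\mathbb E\Big[\sum_{t=1}^{T-1}\big(x(t)^\top Qx(t)+u(t)^\top Ru(t)\big)+x(T)^\top Q_Tx(T)\Big],$$ with $Q,Q_T$ symmetric positive semidefinite and $R$ symmetric positive definite. **Notation.** Put $$\mathcal R(P,A,B,Q,R)=Q+A^\top PA-A^\top PB(R+B^\top PB)^{-1}B^\top PA,\qquad \mathcal G(P,A,B,R)=(R+B^\top PB)^{-1}B^\top PA,$$ $$\mathcal M(P,A,C,\Sigma,\Sigma')=CAPA^\top C^\top+C\Sigma C^\top+\Sigma',\qquad \mathcal K(P,A,C,\Sigma,\Sigma')=(APA^\top C^\top+\Sigma C^\top)\,\mathcal M(P,A,C,\Sigma,\Sigma')^{-1},$$ $$\mathcal F(P,A,C,\Sigma,\Sigma')=APA^\top+\Sigma-\mathcal K\mathcal M\mathcal K^\top .$$ Let $S^c(T)=Q_T$, $S^\ell_i(T)=[Q_T]_{ii}$, and for $t<T$ let $S^c(t)=\mathcal R(S^c(t+1),A,B,Q,R)$, $S^\ell_i(t)=\mathcal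 R(S^\ell_i(t+1),A_{ii},B_{ii},Q_{ii},R_{ii})$, $L^c(t)=\mathcal G(S^c(t+1),A,B,R)$, $L^\ell_i(t)=\mathcal G(S^\ell_i(t+1),A_{ii},B_{ii},R_{ii})$; $L^c_i(t)$ is the $i$-th block row of $L^c(t)$. The LLMS estimate of a random vector given data is the estimate of least mean square error among the affine functions of the data (among the linear ones, when everything is centred). Given a strategy, let $\hat x(t|c)$ and $\hat x(t|i)$ be the LLMS estimates of $x(t)$ given $I_0(t)$ and given $I_i(t)$, with $i$-th components $\hat x_i(t|c)$ and $\hat x_i(t|i)$, and let $u^c(t)=\mathbb E[u(t)\mid I_0(t)]$. **Theorem.** 1. An affine strategy minimizing $J$ among all affine strategies exists, and it is unique in the sense that any two minimizers produce almost surely the same controls at the times $1,\dots,T-1$. An affine strategy is a minimizer if and only if, almost surely, for all $1\le t\le T-1$ and $i\in N$, $$u_0(t)=-L^c_0(t)\,\hat x(t|c),\qquad u_i(t)=-L^c_i(t)\,\hat x(t|c)-L^\ell_i(t)\big(\hat x_i(t|i)-\hat x_i(t|c)\big).$$ Under a minimizer the LLMS estimates are given by linear functions of the data (no constant terms). 2.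 Under every affine strategy the LLMS estimates exist, the major agent's LLMS estimate coincides almost surely with its MMSE estimate, $\hat x(t|c)=\mathbb E[x(t)\mid I_0(t)]$ for $1\le t\le T$, and $\hat x(1|c)=\mathrm{vec}(x_0(1),0,\dots,0)$, $$\hat x(t+1|c)=A\,\mathrm{vec}\big(x_0(t),\hat x_1(t|c),\dots,\hat x_n(t|c)\big)+B\,\mathrm{vec}\big(u_0(t),u^c_1(t),\dots,u^c_n(t)\big)+\mathrm{vec}\big(w_0(t),0,\dots,0\big),\qquad t<T,$$ where $w_0(t)=x_0(t+1)-A_{00}x_0(t)-B_{00}u_0(t)$. 3. Define, independently of the strategy, $K_i(1)=\mathcal K(0,A_{ii},C_{ii},\Sigma^x_i,\Sigma^v_i)$, $P_i(1)=\mathcal F(0,A_{ii},C_{ii},\Sigma^x_i,\Sigma^v_i)$ and, for $t>1$, $$K_i(t)=\mathcal K(P_i(t-1),A_{ii},C_{ii},\Sigma^w_i,\Sigma^v_i),\qquad P_i(t)=\mathcal F(P_i(t-1),A_{ii},C_{ii},\Sigma^w_i,\Sigma^v_i).$$ Under every affine strategy, for $i\in N$ and $t\le T$ such that the matrices inverted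 in $K_i(1),\dots,K_i(t)$ are invertible, $P_i(t)=\mathrm{var}(x_i(t)-\hat x_i(t|i))$ and, almost surely, $\hat x_i(1|i)=K_i(1)y_i(1)$ and, if $t>1$, $\hat x_i(t|i)=m_i(t)+K_i(t)\big(y_i(t)-C_{ii}m_i(t)\big)$, where $$m_i(t)=A_{ii}\hat x_i(t-1|i)+A_{i0}x_0(t-1)+B_{ii}u_i(t-1)+B_{i0}u_0(t-1).$$ -/

import Mathlib

open MeasureTheory ProbabilityTheory Matrix

noncomputable section

namespace MajorMinor

/-! Time is counted from `0`: the Lean time `t` is the time `t + 1` of the informal statement.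
With `N = T - 1`, the times `1, …, T` become `0, …, N`; controls act at `0, …, N - 1` and the
terminal cost is paid at `N`. -/

/-- The data of the control problem: one major agent (subscript `₀`) and `n` minor agents.
`A₁₀ i`, `A₁₁ i` are the blocks `A_{i0}`, `A_{ii}`, and likewise for `B`. `Q`, `QT`, `R` act on
the stacked state and on the stacked control. -/
structure Model (n : ℕ) where
  dx₀ : ℕ
  du₀ : ℕ
  dx : Fin n → ℕ
  du : Fin n → ℕ
  dy : Fin n → ℕ
  A₀₀ : Matrix (Fin dx₀) (Fin dx₀) ℝ
  A₁₀ : ∀ i, Matrix (Fin (dx i)) (Fin dx₀) ℝ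
  A₁₁ : ∀ i, Matrix (Fin (dx i)) (Fin (dx i)) ℝ
  B₀₀ : Matrix (Fin dx₀) (Fin du₀) ℝ
  B₁₀ : ∀ i, Matrix (Fin (dx i)) (Fin du₀) ℝ
  B₁₁ : ∀ i, Matrix (Fin (dx i)) (Fin (du i)) ℝ
  C : ∀ i, Matrix (Fin (dy i)) (Fin (dx i)) ℝ
  Q : Matrix (Fin dx₀ ⊕ (Σ i, Fin (dx i))) (Fin dx₀ ⊕ (Σ i, Fin (dx i))) ℝ
  QT : Matrix (Fin dx₀ ⊕ (Σ i, Fin (dx i))) (Fin dx₀ ⊕ (Σ i, Fin (dx i))) ℝ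
  R : Matrix (Fin du₀ ⊕ (Σ i, Fin (du i))) (Fin du₀ ⊕ (Σ i, Fin (du i))) ℝ

/-! ### Riccati and Kalman operators -/

section Operators

variable {l m p : Type*} [Fintype l] [Fintype m] [Fintype p] [DecidableEq m] [DecidableEq p]

/-- `ℛ(P, A, B, Q, R)` -/
def riccati (P A : Matrix l l ℝ) (B : Matrix l m ℝ) (Q : Matrix l l ℝ) (R : Matrix m m ℝ) :
    Matrix l l ℝ :=
  Q + Aᵀ * P * A - Aᵀ * P * B * (R + Bᵀ * P * B)⁻¹ * Bᵀ * P * A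

/-- `𝒢(P, A, B, R)` -/
def riccatiGain (P A : Matrix l l ℝ) (B : Matrix l m ℝ) (R : Matrix m m ℝ) : Matrix m l ℝ :=
  (R + Bᵀ * P * B)⁻¹ * Bᵀ * P * A

/-- The matrix inverted in `𝒦(P, A, C, S, S')`. -/
def innovationCov (P A : Matrix l l ℝ) (C : Matrix p l ℝ) (S : Matrix l l ℝ)
    (S' : Matrix p p ℝ) : Matrix p p ℝ :=
  C * A * P * Aᵀ * Cᵀ + C * S * Cᵀ + S'

/-- `𝒦(P, A, C, S, S')` -/
def kalmanGain (P A : Matrix l l ℝ) (C : Matrix p l ℝ) (S : Matrix l l ℝ)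
    (S' : Matrix p p ℝ) : Matrix l p ℝ :=
  (A * P * Aᵀ * Cᵀ + S * Cᵀ) * (innovationCov P A C S S')⁻¹

/-- `ℱ(P, A, C, S, S')` -/
def kalmanCov (P A : Matrix l l ℝ) (C : Matrix p l ℝ) (S : Matrix l l ℝ)
    (S' : Matrix p p ℝ) : Matrix l l ℝ :=
  A * P * Aᵀ + S -
    kalmanGain P A C S S' * innovationCov P A C S S' * (kalmanGain P A C S S')ᵀ

end Operators

/-! ### Matrices of the model, Riccati recursions, filter recursions -/

namespace Model

variable {n : ℕ} (M : Model n)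

/-- Coordinates of the stacked state `vec(x₀, …, xₙ)`. -/
abbrev StateIdx : Type := Fin M.dx₀ ⊕ (Σ i, Fin (M.dx i))

/-- Coordinates of the stacked control `vec(u₀, …, uₙ)`. -/
abbrev ControlIdx : Type := Fin M.du₀ ⊕ (Σ i, Fin (M.du i))

/-- The block lower triangular matrix `A`. -/
def A : Matrix M.StateIdx M.StateIdx ℝ :=
  Matrix.fromBlocks M.A₀₀ 0 (Matrix.of fun p b => M.A₁₀ p.1 p.2 b) (Matrix.blockDiagonal' M.A₁₁)

/-- The block lower triangular matrix `B`. -/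
def B : Matrix M.StateIdx M.ControlIdx ℝ :=
  Matrix.fromBlocks M.B₀₀ 0 (Matrix.of fun p b => M.B₁₀ p.1 p.2 b) (Matrix.blockDiagonal' M.B₁₁)

/-- `Q_{ii}` -/
def Qblock (i : Fin n) : Matrix (Fin (M.dx i)) (Fin (M.dx i)) ℝ :=
  M.Q.submatrix (fun a => Sum.inr ⟨i, a⟩) (fun a => Sum.inr ⟨i, a⟩)

/-- `[Q_T]_{ii}` -/
def QTblock (i : Fin n) : Matrix (Fin (M.dx i)) (Fin (M.dx i)) ℝ :=
  M.QT.submatrix (fun a => Sum.inr ⟨i, a⟩) (fun a => Sum.inr ⟨i, a⟩)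

/-- `R_{ii}` -/
def Rblock (i : Fin n) : Matrix (Fin (M.du i)) (Fin (M.du i)) ℝ :=
  M.R.submatrix (fun a => Sum.inr ⟨i, a⟩) (fun a => Sum.inr ⟨i, a⟩)

/-- Common Riccati matrix with `k` steps to go, so that `S^c(t) = riccatiCom (N - t)`. -/
def riccatiCom : ℕ → Matrix M.StateIdx M.StateIdx ℝ
  | 0 => M.QT
  | k + 1 => riccati (riccatiCom k) M.A M.B M.Q M.R

/-- Local Riccati matrix with `k` steps to go, so that `S^ℓ_i(t) = riccatiLoc i (N - t)`. -/
def riccatiLoc (i : Fin n) : ℕ → Matrix (Fin (M.dx i)) (Fin (M.dx i)) ℝ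
  | 0 => M.QTblock i
  | k + 1 => riccati (riccatiLoc i k) (M.A₁₁ i) (M.B₁₁ i) (M.Qblock i) (M.Rblock i)

/-- `L^c(t)`, for `t < N`. -/
def gainCom (N t : ℕ) : Matrix M.ControlIdx M.StateIdx ℝ :=
  riccatiGain (M.riccatiCom (N - (t + 1))) M.A M.B M.R

/-- `L^c_0(t)`, the block row of `L^c(t)` of the major agent. -/
def gainCom₀ (N t : ℕ) : Matrix (Fin M.du₀) M.StateIdx ℝ :=
  (M.gainCom N t).submatrix Sum.inl id

/-- `L^c_i(t)`, the block row of `L^c(t)` of the minor agent `i`. -/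
def gainComMinor (N : ℕ) (i : Fin n) (t : ℕ) : Matrix (Fin (M.du i)) M.StateIdx ℝ :=
  (M.gainCom N t).submatrix (fun a => Sum.inr ⟨i, a⟩) id

/-- `L^ℓ_i(t)`, for `t < N`. -/
def gainLoc (N : ℕ) (i : Fin n) (t : ℕ) : Matrix (Fin (M.du i)) (Fin (M.dx i)) ℝ :=
  riccatiGain (M.riccatiLoc i (N - (t + 1))) (M.A₁₁ i) (M.B₁₁ i) (M.Rblock i)

/-- Covariances of the initial states, process noises and observation noises of the minor
agents. -/
structure Covariances where
  x : ∀ i, Matrix (Fin (M.dx i)) (Fin (M.dx i)) ℝ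
  w : ∀ i, Matrix (Fin (M.dx i)) (Fin (M.dx i)) ℝ
  v : ∀ i, Matrix (Fin (M.dy i)) (Fin (M.dy i)) ℝ

variable {M} (S : M.Covariances)

/-- `P_i(t)`: before the first observation the error covariance is that of the initial state. -/
def errorCov (i : Fin n) : ℕ → Matrix (Fin (M.dx i)) (Fin (M.dx i)) ℝ
  | 0 => kalmanCov 0 (M.A₁₁ i) (M.C i) (S.x i) (S.v i)
  | t + 1 => kalmanCov (errorCov i t) (M.A₁₁ i) (M.C i) (S.w i) (S.v i)

/-- `K_i(t)` -/
def filterGain (i : Fin n) : ℕ → Matrix (Fin (M.dx i)) (Fin (M.dy i)) ℝ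
  | 0 => kalmanGain 0 (M.A₁₁ i) (M.C i) (S.x i) (S.v i)
  | t + 1 => kalmanGain (errorCov S i t) (M.A₁₁ i) (M.C i) (S.w i) (S.v i)

/-- The matrix whose inverse enters `K_i(t)`. -/
def filterInnovationCov (i : Fin n) : ℕ → Matrix (Fin (M.dy i)) (Fin (M.dy i)) ℝ
  | 0 => innovationCov 0 (M.A₁₁ i) (M.C i) (S.x i) (S.v i)
  | t + 1 => innovationCov (errorCov S i t) (M.A₁₁ i) (M.C i) (S.w i) (S.v i)

/-! ### Affine strategies -/

variable (M)

/-- Values of `I₀(t) = {x₀(0:t), u₀(0:t-1)}`. -/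
abbrev Info₀ (t : ℕ) : Type :=
  (Fin (t + 1) → Fin M.dx₀ → ℝ) × (Fin t → Fin M.du₀ → ℝ)

/-- Values of `I_i(t) = {x₀(0:t), y_i(0:t), u₀(0:t-1), u_i(0:t-1)}`. -/
abbrev Info (i : Fin n) (t : ℕ) : Type :=
  (Fin (t + 1) → Fin M.dx₀ → ℝ) × (Fin (t + 1) → Fin (M.dy i) → ℝ) ×
    (Fin t → Fin M.du₀ → ℝ) × (Fin t → Fin (M.du i) → ℝ)

/-- Affine control laws for all agents. -/
structure AffineStrategy where
  g₀ : ∀ t, M.Info₀ t →ᵃ[ℝ] (Fin M.du₀ → ℝ)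
  g : ∀ i t, M.Info i t →ᵃ[ℝ] (Fin (M.du i) → ℝ)

end Model

/-! ### Primitive random variables -/

/-- Initial states, process noises and observation noises. -/
structure Primitives {n : ℕ} (M : Model n) (Ω : Type*) where
  x₀ : Ω → Fin M.dx₀ → ℝ
  x : ∀ i, Ω → Fin (M.dx i) → ℝ
  w₀ : ℕ → Ω → Fin M.dx₀ → ℝ
  w : ∀ i, ℕ → Ω → Fin (M.dx i) → ℝ
  v : ∀ i, ℕ → Ω → Fin (M.dy i) → ℝ

/-- Labels of the primitive random variables of the times `0, …, N`. -/
inductive PrimIdx (n N : ℕ) : Type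
  | x₀ : PrimIdx n N
  | x (i : Fin n) : PrimIdx n N
  | w₀ (t : Fin (N + 1)) : PrimIdx n N
  | w (i : Fin n) (t : Fin (N + 1)) : PrimIdx n N
  | v (i : Fin n) (t : Fin (N + 1)) : PrimIdx n N

def PrimIdx.dim {n N : ℕ} (M : Model n) : PrimIdx n N → ℕ
  | .x₀ => M.dx₀
  | .x i => M.dx i
  | .w₀ _ => M.dx₀
  | .w i _ => M.dx i
  | .v i _ => M.dy i

def Primitives.var {n : ℕ} {M : Model n} {Ω : Type*} (P : Primitives M Ω) (N : ℕ) :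
    (k : PrimIdx n N) → Ω → Fin (k.dim M) → ℝ
  | .x₀ => P.x₀
  | .x i => P.x i
  | .w₀ t => P.w₀ t
  | .w i t => P.w i t
  | .v i t => P.v i t

/-- The covariance matrix of a random vector. -/
def covMatrix {Ω ι : Type*} [MeasurableSpace Ω] (μ : Measure Ω) (X : Ω → ι → ℝ) :
    Matrix ι ι ℝ :=
  Matrix.of fun a b => cov[fun ω => X ω a, fun ω => X ω b; μ]

/-- The primitive random variables are independent, with zero mean and finite variance, and those
of the minor agents have the covariances `S`. -/
structure Primitives.Admissible {n : ℕ} {M : Model n} {Ω : Type*} [MeasurableSpace Ω]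
    (P : Primitives M Ω) (μ : Measure Ω) (N : ℕ) (S : M.Covariances) : Prop where
  measurable : ∀ k, Measurable (P.var N k)
  indep : iIndepFun (P.var N) μ
  memLp : ∀ k, MemLp (P.var N k) 2 μ
  mean_zero : ∀ k, ∫ ω, P.var N k ω ∂μ = 0
  cov_x : ∀ i, covMatrix μ (P.x i) = S.x i
  cov_w : ∀ i, ∀ t ≤ N, covMatrix μ (P.w i t) = S.w i
  cov_v : ∀ i, ∀ t ≤ N, covMatrix μ (P.v i t) = S.v i

/-! ### The closed loop -/

section ClosedLoop

variable {n : ℕ} {M : Model n} {Ω : Type*} (P : Primitives M Ω) (g : M.AffineStrategy)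

mutual

/-- State `x₀(t)` of the major agent. -/
def x₀ (t : ℕ) (ω : Ω) : Fin M.dx₀ → ℝ :=
  match t with
  | 0 => P.x₀ ω
  | t + 1 => M.A₀₀ *ᵥ x₀ t ω + M.B₀₀ *ᵥ u₀ t ω + P.w₀ t ω
termination_by (t, 0)

/-- Control `u₀(t)` of the major agent. -/
def u₀ (t : ℕ) (ω : Ω) : Fin M.du₀ → ℝ :=
  g.g₀ t (fun s => x₀ s.1 ω, fun s => u₀ s.1 ω)
termination_by (t, 1)
decreasing_by
  all_goals
    have := s.isLt
    simp only [Prod.lex_def]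
    omega

end

mutual

/-- State `x_i(t)` of the minor agent `i`. -/
def x (i : Fin n) (t : ℕ) (ω : Ω) : Fin (M.dx i) → ℝ :=
  match t with
  | 0 => P.x i ω
  | t + 1 => M.A₁₁ i *ᵥ x i t ω + M.A₁₀ i *ᵥ x₀ P g t ω + M.B₁₁ i *ᵥ u i t ω
      + M.B₁₀ i *ᵥ u₀ P g t ω + P.w i t ω
termination_by (t, 0)

/-- Control `u_i(t)` of the minor agent `i`; the second entry of its data is `y_i(0:t)`. -/
def u (i : Fin n) (t : ℕ) (ω : Ω) : Fin (M.du i) → ℝ :=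
  g.g i t (fun s => x₀ P g s.1 ω, fun s => M.C i *ᵥ x i s.1 ω + P.v i s.1 ω,
    fun s => u₀ P g s.1 ω, fun s => u i s.1 ω)
termination_by (t, 1)
decreasing_by
  all_goals
    have := s.isLt
    simp only [Prod.lex_def]
    omega

end

/-- Output `y_i(t)` of the minor agent `i`. -/
def y (i : Fin n) (t : ℕ) (ω : Ω) : Fin (M.dy i) → ℝ :=
  M.C i *ᵥ x P g i t ω + P.v i t ω

/-- The information `I₀(t)`. -/
def info₀ (t : ℕ) (ω : Ω) : M.Info₀ t :=
  (fun s => x₀ P g s.1 ω, fun s => u₀ P g s.1 ω)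

/-- The information `I_i(t)`. -/
def info (i : Fin n) (t : ℕ) (ω : Ω) : M.Info i t :=
  (fun s => x₀ P g s.1 ω, fun s => y P g i s.1 ω, fun s => u₀ P g s.1 ω, fun s => u P g i s.1 ω)

theorem u₀_eq (t : ℕ) (ω : Ω) : u₀ P g t ω = g.g₀ t (info₀ P g t ω) := by
  rw [u₀]; rfl

theorem u_eq (i : Fin n) (t : ℕ) (ω : Ω) : u P g i t ω = g.g i t (info P g i t ω) := by
  rw [u]; rfl

/-- The stacked state `x(t)`. -/
def state (t : ℕ) (ω : Ω) : M.StateIdx → ℝ :=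
  Sum.elim (x₀ P g t ω) fun p => x P g p.1 t ω p.2

/-- The stacked control `u(t)`. -/
def control (t : ℕ) (ω : Ω) : M.ControlIdx → ℝ :=
  Sum.elim (u₀ P g t ω) fun p => u P g p.1 t ω p.2

variable [MeasurableSpace Ω] (μ : Measure Ω)

/-- The expected total cost `J(g)`. -/
def cost (N : ℕ) : ℝ :=
  ∫ ω, ((∑ t ∈ Finset.range N, (state P g t ω ⬝ᵥ M.Q *ᵥ state P g t ω
      + control P g t ω ⬝ᵥ M.R *ᵥ control P g t ω))
    + state P g N ω ⬝ᵥ M.QT *ᵥ state P g N ω) ∂μ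

/-- `g` is a best strategy among the affine ones. -/
def IsOptimal (N : ℕ) : Prop :=
  ∀ g' : M.AffineStrategy, cost P g μ N ≤ cost P g' μ N

end ClosedLoop

/-! ### LLMS and MMSE estimates -/

section Estimates

variable {Ω E ι : Type*} [MeasurableSpace Ω] [AddCommGroup E] [Module ℝ E] [Fintype ι]

/-- `f(Z)` has the least mean square error among all estimates of `X` that are affine in the data
`Z`. (For centred `X` and `Z` the minimum is attained by a linear `f`.) -/
def IsLLMSEstimator (μ : Measure Ω) (Z : Ω → E) (X : Ω → ι → ℝ) (f : E →ᵃ[ℝ] (ι → ℝ)) : Prop :=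
  ∀ h : E →ᵃ[ℝ] (ι → ℝ),
    ∫ ω, ∑ a, (X ω a - f (Z ω) a) ^ 2 ∂μ ≤ ∫ ω, ∑ a, (X ω a - h (Z ω) a) ^ 2 ∂μ

/-- The LLMS estimate of `X` given `Z`. -/
def llms (μ : Measure Ω) (Z : Ω → E) (X : Ω → ι → ℝ) (ω : Ω) : ι → ℝ :=
  Classical.epsilon (IsLLMSEstimator μ Z X) (Z ω)

variable {n : ℕ} {M : Model n} (P : Primitives M Ω) (g : M.AffineStrategy) (μ : Measure Ω)

/-- The major agent's LLMS estimate `x̂(t|c)` of the state of the system. -/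
def xhatCom (t : ℕ) : Ω → M.StateIdx → ℝ :=
  llms μ (info₀ P g t) (state P g t)

/-- The component `x̂_i(t|c)` of `x̂(t|c)`. -/
def xhatComMinor (i : Fin n) (t : ℕ) (ω : Ω) : Fin (M.dx i) → ℝ :=
  fun a => xhatCom P g μ t ω (Sum.inr ⟨i, a⟩)

/-- The LLMS estimate `x̂(t|i)` of the state of the system by the minor agent `i`. -/
def xhatMinor (i : Fin n) (t : ℕ) : Ω → M.StateIdx → ℝ :=
  llms μ (info P g i t) (state P g t)

/-- The component `x̂_i(t|i)` of `x̂(t|i)`. -/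
def xhatLoc (i : Fin n) (t : ℕ) (ω : Ω) : Fin (M.dx i) → ℝ :=
  fun a => xhatMinor P g μ i t ω (Sum.inr ⟨i, a⟩)

/-- The σ-algebra generated by `I₀(t)`. -/
abbrev commonSigma (t : ℕ) : MeasurableSpace Ω :=
  MeasurableSpace.comap (info₀ P g t) inferInstance

/-- The common control `u^c(t) = E[u(t) | I₀(t)]`. -/
def controlCom (t : ℕ) : Ω → M.ControlIdx → ℝ :=
  μ[control P g t | commonSigma P g t]

/-- The one-step prediction of `x_i(t+1)` from `x̂_i(t|i)`, `x₀(t)`, `u_i(t)`, `u₀(t)`. -/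
def prediction (i : Fin n) (t : ℕ) (ω : Ω) : Fin (M.dx i) → ℝ :=
  M.A₁₁ i *ᵥ xhatLoc P g μ i t ω + M.A₁₀ i *ᵥ x₀ P g t ω + M.B₁₁ i *ᵥ u P g i t ω
    + M.B₁₀ i *ᵥ u₀ P g t ω

/-- The controls of the times `0, …, N - 1` have the certainty-equivalent form
`u₀ = -L^c_0 x̂(t|c)`, `u_i = -L^c_i x̂(t|c) - L^ℓ_i (x̂_i(t|i) - x̂_i(t|c))`. -/
def HasOptimalForm (N : ℕ) : Prop :=
  ∀ t < N,
    (∀ᵐ ω ∂μ, u₀ P g t ω = -(M.gainCom₀ N t *ᵥ xhatCom P g μ t ω)) ∧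
    ∀ i, ∀ᵐ ω ∂μ, u P g i t ω = -(M.gainComMinor N i t *ᵥ xhatCom P g μ t ω)
      - M.gainLoc N i t *ᵥ (xhatLoc P g μ i t ω - xhatComMinor P g μ i t ω)

end Estimates

end MajorMinor

end

open MeasureTheory ProbabilityTheory Matrix

noncomputable section

namespace MajorMinor

-- The information pattern is nonclassical, but it is equivalent to one that no strategy can
-- influence. Remove from the output of a minor agent everything caused by the controls and by the
-- major agent: what remains is the output of a system driven by the agent's own noise (`freeState`,
-- `freeOutput`). The removed part (`drift`) is an affine function of earlier data of the same
-- agent. Hence, under every affine strategy, the affine functions of `I₀(t)` form the fixed space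
-- `commonSpace`, spanned by the constants and the major agent's primitives, and those of `I_i(t)`
-- form `commonSpace ⊔ localSpace`, where `localSpace` is spanned by the free outputs
-- (`affOf_info₀`, `affOf_info`). Choosing an affine strategy amounts to choosing control processes
-- in these spaces (`exists_strategy`).
--
-- Each control therefore splits into a common part `uc` and local parts `ul i`, and by linearity
-- and block triangularity so does the state (`IsDecomposition.state_eq`). Independence and zero
-- means make the common part orthogonal to the local parts, and the local parts of different agents
-- orthogonal to each other. In the expected cost all cross terms vanish and only the diagonal
-- blocks of `Q`, `QT`, `R` act on the local parts, so the problem decouples into one fully observed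
-- linear quadratic problem for the common part and one partially observed problem for each minor
-- agent (`IsDecomposition.cost_eq_sum`).
--
-- Completing squares along the Riccati recursions (`sum_quadForm_eq`) solves each of them. In the
-- local problems the error of the free estimate `p` is orthogonal to `localSpace` and the same for
-- all strategies, so it contributes only a constant. This gives cost = `minimalCost` + `costGap`,
-- where `costGap` is a sum of positive definite forms in the deviations from certainty equivalence
-- (`IsDecomposition.cost_eq`). Some strategy has zero gap, so the minimizers are exactly the
-- strategies with zero gap, and feedback recursions then determine their controls almost surely.
--
-- The estimates come from the same decomposition. The normal equations identify `x̂(t|c)` with the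
-- common state and `x̂_i(t|i)` with the common state plus local drift plus `p`. The discarded local
-- part is independent of the common data and centred, so the major agent's linear estimate is also
-- the conditional expectation without Gaussianity. The filter recursion only has to be proved for
-- the free system, where it is the usual innovation argument (`IsFreeEstimate.update`).

/-! ### Random vectors with components in a space of random variables -/

section VecMem

variable {Ω E F ι κ : Type*} [AddCommGroup E] [Module ℝ E] [AddCommGroup F] [Module ℝ F]

/-- Every linear functional of the random vector `Z` lies in the space `W` of random variables. -/
def VecMem (W : Submodule ℝ (Ω → ℝ)) (Z : Ω → E) : Prop :=
  ∀ φ : E →ₗ[ℝ] ℝ, (fun ω => φ (Z ω)) ∈ W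

variable {W W' : Submodule ℝ (Ω → ℝ)}

theorem VecMem.mono {Z : Ω → E} (hZ : VecMem W Z) (h : W ≤ W') : VecMem W' Z :=
  fun φ => h (hZ φ)

theorem VecMem.map {Z : Ω → E} (hZ : VecMem W Z) (f : E →ₗ[ℝ] F) : VecMem W fun ω => f (Z ω) :=
  fun φ => hZ (φ ∘ₗ f)

theorem VecMem.zero : VecMem W fun _ : Ω => (0 : E) := fun φ => by
  simp only [map_zero]; exact W.zero_mem

theorem VecMem.add {Z Z' : Ω → E} (hZ : VecMem W Z) (hZ' : VecMem W Z') :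
    VecMem W fun ω => Z ω + Z' ω := fun φ => by
  simp only [map_add]; exact W.add_mem (hZ φ) (hZ' φ)

theorem VecMem.sub {Z Z' : Ω → E} (hZ : VecMem W Z) (hZ' : VecMem W Z') :
    VecMem W fun ω => Z ω - Z' ω := fun φ => by
  simp only [map_sub]; exact W.sub_mem (hZ φ) (hZ' φ)

theorem VecMem.neg {Z : Ω → E} (hZ : VecMem W Z) : VecMem W fun ω => -Z ω := fun φ => by
  simp only [map_neg]; exact W.neg_mem (hZ φ)

theorem VecMem.prodMk {Z : Ω → E} {Z' : Ω → F} (hZ : VecMem W Z) (hZ' : VecMem W Z') :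
    VecMem W fun ω => (Z ω, Z' ω) := fun φ => by
  have : (fun ω => φ (Z ω, Z' ω)) =
      (fun ω => (φ ∘ₗ LinearMap.inl ℝ E F) (Z ω)) + fun ω => (φ ∘ₗ LinearMap.inr ℝ E F) (Z' ω) := by
    funext ω
    simp [← map_add]
  rw [this]
  exact W.add_mem (hZ _) (hZ' _)

theorem VecMem.pi [Finite ι] {Z : Ω → ι → E} (hZ : ∀ a, VecMem W fun ω => Z ω a) :
    VecMem W Z := fun φ => by
  classical
  cases nonempty_fintype ι
  have : (fun ω => φ (Z ω)) =
      ∑ a, fun ω => (φ ∘ₗ LinearMap.single ℝ (fun _ : ι => E) a) (Z ω a) := by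
    funext ω
    simp only [Finset.sum_apply, LinearMap.comp_apply, LinearMap.coe_single, ← map_sum]
    rw [Finset.univ_sum_single]
  rw [this]
  exact W.sum_mem fun a _ => hZ a _

theorem VecMem.of_apply [Finite ι] {Z : Ω → ι → ℝ} (hZ : ∀ a, (fun ω => Z ω a) ∈ W) :
    VecMem W Z := VecMem.pi fun a φ => by
  have : (fun ω => φ (Z ω a)) = φ 1 • fun ω => Z ω a := by
    funext ω
    rw [Pi.smul_apply, smul_eq_mul, mul_comm, ← smul_eq_mul, ← map_smul, smul_eq_mul, mul_one]
  rw [this]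
  exact W.smul_mem _ (hZ a)

theorem VecMem.apply {Z : Ω → ι → ℝ} (hZ : VecMem W Z) (a : ι) : (fun ω => Z ω a) ∈ W :=
  hZ (LinearMap.proj a)

theorem VecMem.eval {Z : Ω → ι → E} (hZ : VecMem W Z) (a : ι) : VecMem W fun ω => Z ω a :=
  hZ.map (LinearMap.proj a)

theorem VecMem.precomp {Z : Ω → ι → ℝ} (hZ : VecMem W Z) (e : κ → ι) :
    VecMem W fun ω a => Z ω (e a) :=
  hZ.map (LinearMap.funLeft ℝ ℝ e)

theorem VecMem.fst {Z : Ω → E × F} (hZ : VecMem W Z) : VecMem W fun ω => (Z ω).1 :=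
  hZ.map (LinearMap.fst ℝ E F)

theorem VecMem.snd {Z : Ω → E × F} (hZ : VecMem W Z) : VecMem W fun ω => (Z ω).2 :=
  hZ.map (LinearMap.snd ℝ E F)

theorem VecMem.mulVec [Fintype ι] {Z : Ω → ι → ℝ} (hZ : VecMem W Z) (A : Matrix κ ι ℝ) :
    VecMem W fun ω => A *ᵥ Z ω :=
  hZ.map A.mulVecLin

theorem VecMem.sumElim [Finite ι] [Finite κ] {Z : Ω → ι → ℝ} {Z' : Ω → κ → ℝ} (hZ : VecMem W Z)
    (hZ' : VecMem W Z') : VecMem W fun ω => Sum.elim (Z ω) (Z' ω) :=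
  VecMem.of_apply fun a => by
    cases a with
    | inl a => exact hZ.apply a
    | inr a => exact hZ'.apply a

theorem VecMem.const (hW : (fun _ => 1) ∈ W) (c : E) : VecMem W fun _ => c := fun φ => by
  have : (fun _ : Ω => φ c) = φ c • fun _ => (1 : ℝ) := by funext ω; simp
  rw [this]
  exact W.smul_mem _ hW

theorem VecMem.affine {Z : Ω → E} (hZ : VecMem W Z) (hW : (fun _ => 1) ∈ W) (f : E →ᵃ[ℝ] F) :
    VecMem W fun ω => f (Z ω) := by
  rw [show (fun ω => f (Z ω)) = fun ω => f.linear (Z ω) + f 0 by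
    funext ω; rw [f.decomp]; simp]
  exact (hZ.map f.linear).add (VecMem.const hW _)

/-- Splits a control of a minor agent into a common and a local part. The splitting is merely
chosen; later arguments use only the membership of the two parts. -/
theorem VecMem.exists_add_of_sup [Finite ι] {Z : Ω → ι → ℝ} (hZ : VecMem (W ⊔ W') Z) :
    ∃ X Y : Ω → ι → ℝ, VecMem W X ∧ VecMem W' Y ∧ ∀ ω, Z ω = X ω + Y ω := by
  have h : ∀ a, ∃ f ∈ W, ∃ h ∈ W', f + h = fun ω => Z ω a :=
    fun a => Submodule.mem_sup.1 (hZ.apply a)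
  choose f hf h hh e using h
  refine ⟨fun ω a => f a ω, fun ω a => h a ω, VecMem.of_apply hf, VecMem.of_apply hh, fun ω => ?_⟩
  funext a
  exact (congrFun (e a) ω).symm

/-- The random variables that are affine functions of the data `Z`. -/
def affOf (Z : Ω → E) : Submodule ℝ (Ω → ℝ) where
  carrier := {h | ∃ f : E →ᵃ[ℝ] ℝ, ∀ ω, f (Z ω) = h ω}
  add_mem' := by
    rintro _ _ ⟨f, hf⟩ ⟨f', hf'⟩
    exact ⟨f + f', fun ω => by simp [hf, hf']⟩
  zero_mem' := ⟨0, fun ω => by simp⟩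
  smul_mem' := by
    rintro c _ ⟨f, hf⟩
    exact ⟨c • f, fun ω => by simp [hf]⟩

theorem one_mem_affOf (Z : Ω → E) : (fun _ => 1) ∈ affOf Z :=
  ⟨AffineMap.const ℝ E 1, fun _ => rfl⟩

theorem vecMem_affOf (Z : Ω → E) : VecMem (affOf Z) Z :=
  fun φ => ⟨φ.toAffineMap, fun _ => rfl⟩

theorem affOf_le {Z : Ω → E} (hW : (fun _ => 1) ∈ W) (hZ : VecMem W Z) : affOf Z ≤ W := by
  rintro h ⟨f, hf⟩
  rw [show h = fun ω => f (Z ω) from funext fun ω => (hf ω).symm]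
  exact (hZ.affine hW f) LinearMap.id

theorem VecMem.exists_affineMap {Z : Ω → E} {X : Ω → ι → ℝ} (h : VecMem (affOf Z) X) :
    ∃ f : E →ᵃ[ℝ] (ι → ℝ), ∀ ω, f (Z ω) = X ω := by
  choose f hf using fun a => h.apply a
  exact ⟨AffineMap.pi f, fun ω => funext fun a => hf a ω⟩

end VecMem

/-! ### Second moments -/

section Moments

variable {Ω ι κ l : Type*} [MeasurableSpace Ω] {μ : Measure Ω}

/-- The square integrable random variables. -/
def squareIntegrable (μ : Measure Ω) : Submodule ℝ (Ω → ℝ) where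
  carrier := {f | MemLp f 2 μ}
  add_mem' := fun hf hg => hf.add hg
  zero_mem' := MemLp.zero
  smul_mem' := fun c _ hf => hf.const_smul c

local notation "L2" => squareIntegrable

theorem integrable_mul_of_mem {f h : Ω → ℝ} (hf : f ∈ L2 μ) (hh : h ∈ L2 μ) :
    Integrable (fun ω => f ω * h ω) μ :=
  MemLp.integrable_mul (p := 2) (q := 2) hf hh

theorem integrable_of_mem [IsFiniteMeasure μ] {f : Ω → ℝ} (hf : f ∈ L2 μ) : Integrable f μ :=
  MemLp.integrable one_le_two hf

theorem one_mem_squareIntegrable [IsFiniteMeasure μ] : (fun _ => 1) ∈ L2 μ :=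
  memLp_const (1 : ℝ)

/-- Two spaces of random variables are orthogonal. -/
def Orthogonal (μ : Measure Ω) (W W' : Submodule ℝ (Ω → ℝ)) : Prop :=
  ∀ f ∈ W, ∀ h ∈ W', ∫ ω, f ω * h ω ∂μ = 0

theorem Orthogonal.symm {W W' : Submodule ℝ (Ω → ℝ)} (h : Orthogonal μ W W') :
    Orthogonal μ W' W := fun f hf k hk => by
  simp_rw [mul_comm (f _)]; exact h k hk f hf

theorem Orthogonal.mono {W W' U U' : Submodule ℝ (Ω → ℝ)} (h : Orthogonal μ W W') (hU : U ≤ W)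
    (hU' : U' ≤ W') : Orthogonal μ U U' :=
  fun f hf k hk => h f (hU hf) k (hU' hk)

/-- The random variables orthogonal to a given one. -/
def orthogonalTo (μ : Measure Ω) (f : Ω → ℝ) (hf : f ∈ L2 μ) : Submodule ℝ (Ω → ℝ) where
  carrier := {h | h ∈ L2 μ ∧ ∫ ω, f ω * h ω ∂μ = 0}
  add_mem' := by
    rintro h k ⟨h2, h0⟩ ⟨k2, k0⟩
    refine ⟨add_mem h2 k2, ?_⟩
    simp only [Pi.add_apply, mul_add]
    rw [integral_add (integrable_mul_of_mem hf h2) (integrable_mul_of_mem hf k2), h0, k0, add_zero]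
  zero_mem' := ⟨zero_mem _, by simp⟩
  smul_mem' := by
    rintro c h ⟨h2, h0⟩
    refine ⟨Submodule.smul_mem _ c h2, ?_⟩
    simp only [Pi.smul_apply, smul_eq_mul, mul_left_comm _ c]
    rw [integral_const_mul, h0, mul_zero]

/-- The centred square integrable random variables. -/
def centred (μ : Measure Ω) [IsFiniteMeasure μ] : Submodule ℝ (Ω → ℝ) :=
  orthogonalTo μ (fun _ => 1) one_mem_squareIntegrable

theorem mem_centred [IsFiniteMeasure μ] {h : Ω → ℝ} :
    h ∈ centred μ ↔ h ∈ L2 μ ∧ ∫ ω, h ω ∂μ = 0 := by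
  show (h ∈ L2 μ ∧ ∫ ω, 1 * h ω ∂μ = 0) ↔ _
  simp only [one_mul]

theorem mem_centred_congr [IsFiniteMeasure μ] {f h : Ω → ℝ} (hf : f ∈ L2 μ) (hh : h ∈ centred μ)
    (e : f =ᵐ[μ] h) : f ∈ centred μ :=
  mem_centred.2 ⟨hf, by rw [integral_congr_ae e]; exact (mem_centred.1 hh).2⟩

/-- The variables orthogonal to a given square integrable one form a submodule, so orthogonality
extends from generators to spans in one argument and then in the other. Square integrability is what
makes the integral of products additive. -/
theorem orthogonal_span_span {s s' : Set (Ω → ℝ)} (hs : ∀ f ∈ s, f ∈ L2 μ) (hs' : ∀ f ∈ s', f ∈ L2 μ)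
    (h : ∀ f ∈ s, ∀ k ∈ s', ∫ ω, f ω * k ω ∂μ = 0) :
    Orthogonal μ (Submodule.span ℝ s) (Submodule.span ℝ s') := by
  have h1 : ∀ f ∈ s, ∀ k ∈ Submodule.span ℝ s', ∫ ω, f ω * k ω ∂μ = 0 := fun f hf k hk =>
    (Submodule.span_le (p := orthogonalTo μ f (hs f hf)).2
      (fun k hk => ⟨hs' k hk, h f hf k hk⟩) hk).2
  intro f hf k hk
  have hk2 : k ∈ L2 μ := Submodule.span_le (p := L2 μ).2 hs' hk
  have := (Submodule.span_le (p := orthogonalTo μ k hk2).2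
      (fun f hf => ⟨hs f hf, by simp_rw [mul_comm (k _)]; exact h1 f hf k hk⟩) hf).2
  simp_rw [mul_comm (k _)] at this
  exact this

theorem orthogonal_sup_left {W W' U : Submodule ℝ (Ω → ℝ)} (hW : W ≤ L2 μ) (hW' : W' ≤ L2 μ)
    (hU : U ≤ L2 μ) (h : Orthogonal μ W U) (h' : Orthogonal μ W' U) :
    Orthogonal μ (W ⊔ W') U := by
  intro f hf k hk
  obtain ⟨a, ha, b, hb, rfl⟩ := Submodule.mem_sup.1 hf
  simp only [Pi.add_apply, add_mul]
  rw [integral_add (integrable_mul_of_mem (hW ha) (hU hk))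
    (integrable_mul_of_mem (hW' hb) (hU hk)), h a ha k hk, h' b hb k hk, add_zero]

/-- The matrix of second moments `E[X Yᵀ]`. -/
def moment (μ : Measure Ω) (X : Ω → ι → ℝ) (Y : Ω → κ → ℝ) : Matrix ι κ ℝ :=
  Matrix.of fun a b => ∫ ω, X ω a * Y ω b ∂μ

theorem moment_transpose (X : Ω → ι → ℝ) (Y : Ω → κ → ℝ) : (moment μ X Y)ᵀ = moment μ Y X := by
  ext a b
  simp [moment, mul_comm]

theorem moment_add_left {X X' : Ω → ι → ℝ} {Y : Ω → κ → ℝ} (hX : VecMem (L2 μ) X)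
    (hX' : VecMem (L2 μ) X') (hY : VecMem (L2 μ) Y) :
    moment μ (fun ω => X ω + X' ω) Y = moment μ X Y + moment μ X' Y := by
  ext a b
  simp only [moment, of_apply, Pi.add_apply, add_mul, Matrix.add_apply]
  exact integral_add (integrable_mul_of_mem (hX.apply a) (hY.apply b))
    (integrable_mul_of_mem (hX'.apply a) (hY.apply b))

theorem moment_sub_left {X X' : Ω → ι → ℝ} {Y : Ω → κ → ℝ} (hX : VecMem (L2 μ) X)
    (hX' : VecMem (L2 μ) X') (hY : VecMem (L2 μ) Y) :
    moment μ (fun ω => X ω - X' ω) Y = moment μ X Y - moment μ X' Y := by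
  ext a b
  simp only [moment, of_apply, Pi.sub_apply, sub_mul, Matrix.sub_apply]
  exact integral_sub (integrable_mul_of_mem (hX.apply a) (hY.apply b))
    (integrable_mul_of_mem (hX'.apply a) (hY.apply b))

theorem moment_mulVec_left [Fintype ι] {X : Ω → ι → ℝ} {Y : Ω → κ → ℝ} (hX : VecMem (L2 μ) X)
    (hY : VecMem (L2 μ) Y) (A : Matrix l ι ℝ) :
    moment μ (fun ω => A *ᵥ X ω) Y = A * moment μ X Y := by
  ext a b
  simp only [moment, of_apply, mulVec, dotProduct, Matrix.mul_apply, Finset.sum_mul, mul_assoc]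
  rw [integral_finsetSum _ fun c _ =>
    (integrable_mul_of_mem (hX.apply c) (hY.apply b)).const_mul (A a c)]
  simp only [integral_const_mul]

theorem moment_add_right {X : Ω → ι → ℝ} {Y Y' : Ω → κ → ℝ} (hX : VecMem (L2 μ) X)
    (hY : VecMem (L2 μ) Y) (hY' : VecMem (L2 μ) Y') :
    moment μ X (fun ω => Y ω + Y' ω) = moment μ X Y + moment μ X Y' := by
  rw [← moment_transpose, moment_add_left hY hY' hX, transpose_add, moment_transpose,
    moment_transpose]

theorem moment_sub_right {X : Ω → ι → ℝ} {Y Y' : Ω → κ → ℝ} (hX : VecMem (L2 μ) X)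
    (hY : VecMem (L2 μ) Y) (hY' : VecMem (L2 μ) Y') :
    moment μ X (fun ω => Y ω - Y' ω) = moment μ X Y - moment μ X Y' := by
  rw [← moment_transpose, moment_sub_left hY hY' hX, transpose_sub, moment_transpose,
    moment_transpose]

theorem moment_mulVec_right [Fintype κ] {X : Ω → ι → ℝ} {Y : Ω → κ → ℝ} (hX : VecMem (L2 μ) X)
    (hY : VecMem (L2 μ) Y) (A : Matrix l κ ℝ) :
    moment μ X (fun ω => A *ᵥ Y ω) = moment μ X Y * Aᵀ := by
  rw [← moment_transpose, moment_mulVec_left hY hX, transpose_mul, moment_transpose]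

theorem Orthogonal.moment_eq_zero {W W' : Submodule ℝ (Ω → ℝ)} (h : Orthogonal μ W W')
    {X : Ω → ι → ℝ} {Y : Ω → κ → ℝ} (hX : VecMem W X) (hY : VecMem W' Y) : moment μ X Y = 0 := by
  ext a b
  exact h _ (hX.apply a) _ (hY.apply b)

theorem covMatrix_eq_moment [IsFiniteMeasure μ] {X : Ω → ι → ℝ} (hX : VecMem (centred μ) X) :
    covMatrix μ X = moment μ X X := by
  ext a b
  simp only [covMatrix, moment, of_apply, covariance, (mem_centred.1 (hX.apply a)).2,
    (mem_centred.1 (hX.apply b)).2, sub_zero]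

theorem covMatrix_congr {X Y : Ω → ι → ℝ} (h : X =ᵐ[μ] Y) : covMatrix μ X = covMatrix μ Y := by
  ext a b
  have h' : ∀ a, (fun ω => X ω a) =ᵐ[μ] fun ω => Y ω a := fun a =>
    h.mono fun ω hω => by simp only [hω]
  simp only [covMatrix, of_apply, covariance]
  rw [integral_congr_ae (h' a), integral_congr_ae (h' b)]
  refine integral_congr_ae ?_
  filter_upwards [h] with ω hω
  rw [hω]

/-! ### Expected quadratic forms -/

section QuadForm

variable [Fintype ι] [Fintype κ]

/-- `E[Xᵀ Q X]` -/
def quadForm (μ : Measure Ω) (Q : Matrix ι ι ℝ) (X : Ω → ι → ℝ) : ℝ :=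
  ∫ ω, X ω ⬝ᵥ Q *ᵥ X ω ∂μ

theorem integrable_quadForm {X : Ω → ι → ℝ} (hX : VecMem (L2 μ) X) (Q : Matrix ι ι ℝ) :
    Integrable (fun ω => X ω ⬝ᵥ Q *ᵥ X ω) μ :=
  integrable_finsetSum _ fun a _ => integrable_mul_of_mem (hX.apply a) ((hX.mulVec Q).apply a)

/-- An expected quadratic form sees a random vector only through its second moments; vanishing
correlations can therefore be substituted directly. -/
theorem quadForm_eq_sum {X : Ω → ι → ℝ} (hX : VecMem (L2 μ) X) (Q : Matrix ι ι ℝ) :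
    quadForm μ Q X = ∑ a, ∑ b, Q a b * moment μ X X a b := by
  simp only [quadForm, dotProduct, mulVec, Finset.mul_sum, mul_left_comm _ (Q _ _), moment,
    of_apply]
  have hi : ∀ a b, Integrable (fun ω => Q a b * (X ω a * X ω b)) μ := fun a b =>
    (integrable_mul_of_mem (hX.apply a) (hX.apply b)).const_mul _
  rw [integral_finsetSum _ fun a _ => integrable_finsetSum _ fun b _ => hi a b]
  refine Finset.sum_congr rfl fun a _ => ?_
  rw [integral_finsetSum _ fun b _ => hi a b]
  simp only [integral_const_mul]

/-- Both cross moments vanish, one being the transpose of the other, so no symmetry of `Q` is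
needed. -/
theorem quadForm_add {X Y : Ω → ι → ℝ} (hX : VecMem (L2 μ) X) (hY : VecMem (L2 μ) Y)
    (h : moment μ X Y = 0) (Q : Matrix ι ι ℝ) :
    quadForm μ Q (fun ω => X ω + Y ω) = quadForm μ Q X + quadForm μ Q Y := by
  have h' : moment μ Y X = 0 := by rw [← moment_transpose, h, transpose_zero]
  rw [quadForm_eq_sum (hX.add hY), quadForm_eq_sum hX, quadForm_eq_sum hY,
    moment_add_left hX hY (hX.add hY), moment_add_right hX hX hY, moment_add_right hY hX hY, h, h']
  simp [mul_add, Finset.sum_add_distrib]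

theorem dotProduct_mulVec_nonneg {Q : Matrix ι ι ℝ} (hQ : Q.PosSemidef) (x : ι → ℝ) :
    0 ≤ x ⬝ᵥ Q *ᵥ x := by
  simpa using hQ.dotProduct_mulVec_nonneg x

theorem quadForm_nonneg {Q : Matrix ι ι ℝ} (hQ : Q.PosSemidef) (X : Ω → ι → ℝ) :
    0 ≤ quadForm μ Q X :=
  integral_nonneg fun ω => dotProduct_mulVec_nonneg hQ (X ω)

theorem quadForm_eq_zero_iff {Q : Matrix ι ι ℝ} (hQ : Q.PosDef) {X : Ω → ι → ℝ}
    (hX : VecMem (L2 μ) X) : quadForm μ Q X = 0 ↔ ∀ᵐ ω ∂μ, X ω = 0 := by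
  rw [quadForm, integral_eq_zero_iff_of_nonneg
    (fun ω => dotProduct_mulVec_nonneg hQ.posSemidef (X ω)) (integrable_quadForm hX Q)]
  refine Filter.eventually_congr (Filter.Eventually.of_forall fun ω => ⟨fun h => ?_, fun h => ?_⟩)
  · by_contra hne
    have := hQ.dotProduct_mulVec_pos hne
    simp only [star_trivial] at this
    exact this.ne' h
  · simp [h]

end QuadForm

theorem ae_eq_zero_of_integral_sq {f : Ω → ℝ} (hf : f ∈ L2 μ) (h : ∫ ω, f ω * f ω ∂μ = 0) :
    ∀ᵐ ω ∂μ, f ω = 0 := by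
  rw [integral_eq_zero_iff_of_nonneg (fun ω => mul_self_nonneg _) (integrable_mul_of_mem hf hf)] at h
  filter_upwards [h] with ω hω
  exact mul_self_eq_zero.1 hω

/-- Almost surely `Y = -X`, so `E[X_a ^ 2] = -E[X_a Y_a] = 0` in every coordinate. This separates
the common from the local deviation when only their sum is known to vanish. -/
theorem ae_eq_zero_of_orthogonal_add {W W' : Submodule ℝ (Ω → ℝ)} (hW : W ≤ L2 μ)
    (h : Orthogonal μ W W') [Finite ι] {X Y : Ω → ι → ℝ} (hX : VecMem W X)
    (hY : VecMem W' Y) (hXY : ∀ᵐ ω ∂μ, X ω + Y ω = 0) : ∀ᵐ ω ∂μ, X ω = 0 := by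
  have : ∀ a, ∀ᵐ ω ∂μ, X ω a = 0 := fun a => by
    refine ae_eq_zero_of_integral_sq (hW (hX.apply a)) ?_
    have e : ∫ ω, X ω a * X ω a ∂μ = ∫ ω, -(X ω a * Y ω a) ∂μ := by
      refine integral_congr_ae ?_
      filter_upwards [hXY] with ω hω
      have := congrFun hω a
      simp only [Pi.add_apply, Pi.zero_apply] at this
      rw [eq_neg_of_add_eq_zero_left this]; ring
    rw [e, integral_neg, h _ (hX.apply a) _ (hY.apply a), neg_zero]
  filter_upwards [ae_all_iff.2 this] with ω hω using funext hω

/-! ### Least squares -/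

/-- Orthogonal projection in `Lp ℝ 2 μ` onto the image of `W`, which is finite-dimensional and so
admits a projection. -/
theorem exists_projection {W : Submodule ℝ (Ω → ℝ)} (hW : W ≤ L2 μ) [FiniteDimensional ℝ W]
    {f : Ω → ℝ} (hf : f ∈ L2 μ) : ∃ p ∈ W, ∀ h ∈ W, ∫ ω, (f ω - p ω) * h ω ∂μ = 0 := by
  let T : L2 μ →ₗ[ℝ] Lp ℝ 2 μ :=
    { toFun := fun f => MemLp.toLp f.1 f.2
      map_add' := fun _ _ => rfl
      map_smul' := fun _ _ => rfl }
  -- As `K` is a range, the projected class has a representative that lies in `W` itself and not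
  -- just almost surely equal to an element of `W`.
  let K : Submodule ℝ (Lp ℝ 2 μ) := LinearMap.range (T ∘ₗ Submodule.inclusion hW)
  have : FiniteDimensional ℝ K := inferInstance
  obtain ⟨p, hp⟩ := (K.starProjection_apply_mem (T ⟨f, hf⟩))
  refine ⟨p.1, p.2, fun h hh => ?_⟩
  have := Submodule.starProjection_inner_eq_zero (K := K) (T ⟨f, hf⟩) (T ⟨h, hW hh⟩) ⟨⟨h, hh⟩, rfl⟩
  rw [← hp, LinearMap.comp_apply, ← map_sub, L2.inner_def] at this
  rw [← this]
  refine integral_congr_ae ?_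
  filter_upwards [MemLp.coeFn_toLp (hW hh),
    MemLp.coeFn_toLp (sub_mem hf (hW p.2) : (fun ω => f ω - p.1 ω) ∈ L2 μ)] with ω h1 h2
  have e1 : (T ⟨h, hW hh⟩ : Ω → ℝ) ω = h ω := h1
  have e2 : (T (⟨f, hf⟩ - Submodule.inclusion hW p) : Ω → ℝ) ω = f ω - p.1 ω := h2
  rw [e1, e2]
  simp [mul_comm]

section Llms

variable {E : Type*} [AddCommGroup E] [Module ℝ E] [Fintype ι] {Z : Ω → E} {X p : Ω → ι → ℝ}

/-- The mean square error of an estimate, split by the normal equations. -/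
theorem integral_sq_error_eq [IsFiniteMeasure μ] (hZ : VecMem (L2 μ) Z) (hX : VecMem (L2 μ) X)
    (hp : VecMem (affOf Z) p)
    (horth : ∀ a, ∀ h ∈ affOf Z, ∫ ω, (X ω a - p ω a) * h ω ∂μ = 0) (f : E →ᵃ[ℝ] (ι → ℝ)) :
    ∫ ω, ∑ a, (X ω a - f (Z ω) a) ^ 2 ∂μ = ∫ ω, ∑ a, (X ω a - p ω a) ^ 2 ∂μ +
      ∫ ω, ∑ a, (p ω a - f (Z ω) a) ^ 2 ∂μ := by
  have hle : affOf Z ≤ L2 μ := affOf_le one_mem_squareIntegrable hZ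
  have hd : VecMem (affOf Z) fun ω => p ω - f (Z ω) :=
    hp.sub ((vecMem_affOf Z).affine (one_mem_affOf Z) f)
  have hd2 := hd.mono hle
  have he2 := hX.sub (hp.mono hle)
  have hf2 := hX.sub (((vecMem_affOf Z).affine (one_mem_affOf Z) f).mono hle)
  have sq : ∀ {h : Ω → ℝ}, h ∈ L2 μ → Integrable (fun ω => h ω ^ 2) μ :=
    fun hh => by simp only [pow_two]; exact integrable_mul_of_mem hh hh
  have ie : ∀ a, Integrable (fun ω => (X ω a - p ω a) ^ 2) μ := fun a => sq (he2.apply a)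
  have id : ∀ a, Integrable (fun ω => (p ω a - f (Z ω) a) ^ 2) μ := fun a => sq (hd2.apply a)
  have i2 : ∀ a, Integrable (fun ω => (X ω a - f (Z ω) a) ^ 2) μ := fun a => sq (hf2.apply a)
  have ic : ∀ a, Integrable (fun ω => (X ω a - p ω a) * (p ω a - f (Z ω) a)) μ := fun a =>
    integrable_mul_of_mem (he2.apply a) (hd2.apply a)
  rw [integral_finsetSum _ fun a _ => i2 a, integral_finsetSum _ fun a _ => ie a,
    integral_finsetSum _ fun a _ => id a, ← Finset.sum_add_distrib]
  refine Finset.sum_congr rfl fun a _ => ?_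
  have e : ∀ ω, (X ω a - f (Z ω) a) ^ 2 = ((X ω a - p ω a) ^ 2 + (p ω a - f (Z ω) a) ^ 2) +
      2 * ((X ω a - p ω a) * (p ω a - f (Z ω) a)) := fun ω => by ring
  have h0 : ∫ ω, (X ω a - p ω a) * (p ω a - f (Z ω) a) ∂μ = 0 := horth a _ (hd.apply a)
  simp only [e]
  rw [integral_add, integral_add (ie a) (id a), integral_const_mul, h0, mul_zero, add_zero]
  · exact (ie a).add (id a)
  · exact (ic a).const_mul 2

theorem isLLMSEstimator_of_normal_eq [IsFiniteMeasure μ] (hZ : VecMem (L2 μ) Z)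
    (hX : VecMem (L2 μ) X)
    (horth : ∀ a, ∀ h ∈ affOf Z, ∫ ω, (X ω a - p ω a) * h ω ∂μ = 0) {f : E →ᵃ[ℝ] (ι → ℝ)}
    (hf : ∀ ω, f (Z ω) = p ω) : IsLLMSEstimator μ Z X f := by
  intro h
  have hp : VecMem (affOf Z) p := by
    rw [show p = fun ω => f (Z ω) from funext fun ω => (hf ω).symm]
    exact (vecMem_affOf Z).affine (one_mem_affOf Z) f
  rw [integral_sq_error_eq hZ hX hp horth h]
  simp only [hf]
  exact le_add_of_nonneg_right (integral_nonneg fun ω => Finset.sum_nonneg fun a _ => sq_nonneg _)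

theorem exists_isLLMSEstimator [IsFiniteMeasure μ] (hZ : VecMem (L2 μ) Z) (hX : VecMem (L2 μ) X)
    (hp : VecMem (affOf Z) p)
    (horth : ∀ a, ∀ h ∈ affOf Z, ∫ ω, (X ω a - p ω a) * h ω ∂μ = 0) :
    ∃ f, IsLLMSEstimator μ Z X f := by
  obtain ⟨f, hf⟩ := hp.exists_affineMap
  exact ⟨f, isLLMSEstimator_of_normal_eq hZ hX horth hf⟩

/-- `llms` is an arbitrary choice among the minimizers. By the Pythagorean identity
`integral_sq_error_eq`, the excess error of an estimate `f(Z)` is `E|p - f(Z)|²`, so every minimizer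
agrees almost surely with the solution `p` of the normal equations. -/
theorem llms_ae_eq [IsFiniteMeasure μ] (hZ : VecMem (L2 μ) Z) (hX : VecMem (L2 μ) X)
    (hp : VecMem (affOf Z) p)
    (horth : ∀ a, ∀ h ∈ affOf Z, ∫ ω, (X ω a - p ω a) * h ω ∂μ = 0) :
    ∀ᵐ ω ∂μ, llms μ Z X ω = p ω := by
  have hle : affOf Z ≤ L2 μ := affOf_le one_mem_squareIntegrable hZ
  obtain ⟨f₀, hf₀⟩ := hp.exists_affineMap
  have hs : IsLLMSEstimator μ Z X (Classical.epsilon (IsLLMSEstimator μ Z X)) :=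
    Classical.epsilon_spec ⟨f₀, isLLMSEstimator_of_normal_eq hZ hX horth hf₀⟩
  simp only [llms]
  set f := Classical.epsilon (IsLLMSEstimator μ Z X)
  have hle' := hs f₀
  rw [integral_sq_error_eq hZ hX hp horth f] at hle'
  simp only [hf₀] at hle'
  have hd2 : VecMem (L2 μ) fun ω => p ω - f (Z ω) :=
    (hp.sub ((vecMem_affOf Z).affine (one_mem_affOf Z) f)).mono hle
  have hnn : ∀ ω, 0 ≤ ∑ a, (p ω a - f (Z ω) a) ^ 2 :=
    fun ω => Finset.sum_nonneg fun a _ => sq_nonneg _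
  have h0 : ∫ ω, ∑ a, (p ω a - f (Z ω) a) ^ 2 ∂μ = 0 :=
    le_antisymm (by linarith) (integral_nonneg hnn)
  rw [integral_eq_zero_iff_of_nonneg hnn (integrable_finsetSum _ fun a _ => by
    simp only [pow_two]; exact integrable_mul_of_mem (hd2.apply a) (hd2.apply a))] at h0
  filter_upwards [h0] with ω hω
  funext a
  have := (Finset.sum_eq_zero_iff_of_nonneg fun a _ => sq_nonneg (p ω a - f (Z ω) a)).1 hω a
    (Finset.mem_univ a)
  exact (sub_eq_zero.1 (pow_eq_zero_iff two_ne_zero |>.1 this)).symm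

/-- The least squares estimate of a centred vector given centred data is linear. -/
theorem exists_linear_isLLMSEstimator [IsProbabilityMeasure μ] (hZ : VecMem (centred μ) Z)
    (hX : VecMem (centred μ) X) (hp : VecMem (affOf Z) p)
    (horth : ∀ a, ∀ h ∈ affOf Z, ∫ ω, (X ω a - p ω a) * h ω ∂μ = 0) :
    ∃ f : E →ₗ[ℝ] (ι → ℝ), IsLLMSEstimator μ Z X f.toAffineMap := by
  have hc : centred μ ≤ L2 μ := fun h hh => (mem_centred.1 hh).1
  obtain ⟨f, hf⟩ := hp.exists_affineMap
  have hle : affOf Z ≤ L2 μ := affOf_le one_mem_squareIntegrable (hZ.mono hc)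
  -- Testing the normal equations against the constant `1` gives `E[p] = E[X] = 0`, while centred
  -- data give `E[p] = f 0`.
  have h0 : f 0 = 0 := by
    funext a
    have h1 := horth a _ (one_mem_affOf Z)
    simp only [mul_one] at h1
    rw [integral_sub (integrable_of_mem (hc (hX.apply a)))
      (integrable_of_mem (hle (hp.apply a))), (mem_centred.1 (hX.apply a)).2, zero_sub,
      neg_eq_zero] at h1
    have h2 : ∫ ω, p ω a ∂μ = ∫ ω, (f.linear (Z ω) a + f 0 a) ∂μ := by
      refine integral_congr_ae (Filter.Eventually.of_forall fun ω => ?_)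
      simp only [← hf]
      conv_lhs => rw [f.decomp]
      rfl
    have h3 := (hZ.map f.linear).apply a
    rw [h1, integral_add (integrable_of_mem (hc h3)) (integrable_const _),
      (mem_centred.1 h3).2] at h2
    simpa using h2.symm
  refine ⟨f.linear, isLLMSEstimator_of_normal_eq (hZ.mono hc) (hX.mono hc) horth fun ω => ?_⟩
  rw [← hf, f.decomp]
  simp [h0]

end Llms

end Moments

/-! ### Completing squares -/

section CompleteSquare

variable {l m : Type*} [Fintype l] [Fintype m] [DecidableEq m]
  {P A Q : Matrix l l ℝ} {B : Matrix l m ℝ} {R : Matrix m m ℝ}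

theorem dotProduct_transpose_mulVec {l m : Type*} [Fintype l] [Fintype m] (B : Matrix l m ℝ)
    (u : m → ℝ) (x : l → ℝ) : u ⬝ᵥ Bᵀ *ᵥ x = (B *ᵥ u) ⬝ᵥ x := by
  rw [dotProduct_mulVec, vecMul_transpose]

theorem posDef_add_conj {l m : Type*} [Fintype l] [Fintype m] {P : Matrix l l ℝ}
    {R : Matrix m m ℝ} (hP : P.PosSemidef) (hR : R.PosDef) (B : Matrix l m ℝ) :
    (R + Bᵀ * P * B).PosDef := by
  have := hP.conjTranspose_mul_mul_same B
  rw [conjTranspose_eq_transpose_of_trivial] at this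
  exact hR.add_posSemidef this

theorem dotProduct_mulVec_comm_of_isSymm {l : Type*} [Fintype l] {P : Matrix l l ℝ} (hP : P.IsSymm)
    (x y : l → ℝ) : x ⬝ᵥ P *ᵥ y = y ⬝ᵥ P *ᵥ x := by
  rw [dotProduct_mulVec, dotProduct_comm, ← mulVec_transpose, hP.eq]

/-- One step of dynamic programming. -/
theorem riccati_complete_square (hP : P.PosSemidef) (hR : R.PosDef) (A Q : Matrix l l ℝ)
    (B : Matrix l m ℝ) (x : l → ℝ) (u : m → ℝ) :
    x ⬝ᵥ Q *ᵥ x + u ⬝ᵥ R *ᵥ u + (A *ᵥ x + B *ᵥ u) ⬝ᵥ P *ᵥ (A *ᵥ x + B *ᵥ u) =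
      x ⬝ᵥ riccati P A B Q R *ᵥ x +
        (u + riccatiGain P A B R *ᵥ x) ⬝ᵥ
          (R + Bᵀ * P * B) *ᵥ (u + riccatiGain P A B R *ᵥ x) := by
  have hPs : P.IsSymm := by
    have := hP.isHermitian; rwa [IsHermitian, conjTranspose_eq_transpose_of_trivial] at this
  have hD := posDef_add_conj hP hR B
  set D := R + Bᵀ * P * B with hDdef
  have hDs : D.IsSymm := by
    have := hD.isHermitian; rwa [IsHermitian, conjTranspose_eq_transpose_of_trivial] at this
  have hDu : IsUnit D.det := (Matrix.isUnit_iff_isUnit_det D).1 hD.isUnit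
  set L := riccatiGain P A B R with hL
  have hDL : D * L = Bᵀ * P * A := by
    rw [hL, riccatiGain, ← hDdef, Matrix.mul_assoc, Matrix.mul_assoc, ← Matrix.mul_assoc D,
      Matrix.mul_nonsing_inv D hDu, Matrix.one_mul, Matrix.mul_assoc]
  have hDLx : D *ᵥ (L *ᵥ x) = Bᵀ *ᵥ (P *ᵥ (A *ᵥ x)) := by
    rw [mulVec_mulVec, hDL, mulVec_mulVec, mulVec_mulVec, Matrix.mul_assoc]
  have hric : riccati P A B Q R *ᵥ x = Q *ᵥ x + Aᵀ *ᵥ (P *ᵥ (A *ᵥ x))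
      - Lᵀ *ᵥ (Bᵀ *ᵥ (P *ᵥ (A *ᵥ x))) := by
    have hLT : Lᵀ = Aᵀ * P * B * D⁻¹ := by
      rw [hL, riccatiGain, ← hDdef]
      simp only [transpose_mul, transpose_transpose, transpose_nonsing_inv, hDs.eq, hPs.eq,
        Matrix.mul_assoc]
    rw [riccati, ← hDdef, ← hLT]
    simp only [sub_mulVec, add_mulVec, mulVec_mulVec, Matrix.mul_assoc]
  have e1 : u ⬝ᵥ D *ᵥ u = u ⬝ᵥ R *ᵥ u + (B *ᵥ u) ⬝ᵥ P *ᵥ (B *ᵥ u) := by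
    rw [hDdef, add_mulVec, dotProduct_add, Matrix.mul_assoc, ← mulVec_mulVec, ← mulVec_mulVec,
      dotProduct_transpose_mulVec]
  rw [hric]
  simp only [mulVec_add, add_dotProduct, dotProduct_add, dotProduct_sub]
  rw [dotProduct_mulVec_comm_of_isSymm hDs (L *ᵥ x) u, hDLx, e1]
  simp only [dotProduct_transpose_mulVec]
  rw [dotProduct_mulVec_comm_of_isSymm hPs (A *ᵥ x) (B *ᵥ u)]
  ring

/-- The control `u = -L x`, with `L` the Riccati gain, annihilates the completed square, so the
Riccati form at `x` equals a sum of nonnegative costs. -/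
theorem riccati_posSemidef (hP : P.PosSemidef) (hR : R.PosDef) (hQ : Q.PosSemidef)
    (A : Matrix l l ℝ) (B : Matrix l m ℝ) : (riccati P A B Q R).PosSemidef := by
  have hPs : Pᵀ = P := by
    have := hP.isHermitian; rwa [IsHermitian, conjTranspose_eq_transpose_of_trivial] at this
  have hQs : Qᵀ = Q := by
    have := hQ.isHermitian; rwa [IsHermitian, conjTranspose_eq_transpose_of_trivial] at this
  have hRs : Rᵀ = R := by
    have := hR.isHermitian; rwa [IsHermitian, conjTranspose_eq_transpose_of_trivial] at this
  refine PosSemidef.of_dotProduct_mulVec_nonneg ?_ fun x => ?_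
  · rw [IsHermitian, conjTranspose_eq_transpose_of_trivial, riccati]
    simp only [transpose_sub, transpose_add, transpose_mul, transpose_transpose,
      transpose_nonsing_inv, hPs, hQs, hRs, Matrix.mul_assoc]
  · have h := riccati_complete_square hP hR A Q B x (-(riccatiGain P A B R *ᵥ x))
    rw [neg_add_cancel, zero_dotProduct, add_zero] at h
    rw [star_trivial, ← h]
    exact add_nonneg (add_nonneg (dotProduct_mulVec_nonneg hQ _)
      (dotProduct_mulVec_nonneg hR.posSemidef _)) (dotProduct_mulVec_nonneg hP _)

variable {Ω : Type*} [MeasurableSpace Ω] {μ : Measure Ω}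

/-- The quadratic cost of a linear system driven by noise that is uncorrelated with the current
state and control. -/
theorem sum_quadForm_eq {A Q QT : Matrix l l ℝ} {B : Matrix l m ℝ} {R : Matrix m m ℝ}
    (hQ : Q.PosSemidef) (hQT : QT.PosSemidef) (hR : R.PosDef) {S : ℕ → Matrix l l ℝ}
    (hS0 : S 0 = QT) (hS : ∀ k, S (k + 1) = riccati (S k) A B Q R) {N : ℕ}
    {x w : ℕ → Ω → l → ℝ} {u : ℕ → Ω → m → ℝ}
    (hx : ∀ t ≤ N, VecMem (squareIntegrable μ) (x t))
    (hu : ∀ t < N, VecMem (squareIntegrable μ) (u t))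
    (hw : ∀ t < N, VecMem (squareIntegrable μ) (w t))
    (hdyn : ∀ t < N, ∀ ω, x (t + 1) ω = A *ᵥ x t ω + B *ᵥ u t ω + w t ω)
    (hxw : ∀ t < N, moment μ (x t) (w t) = 0) (huw : ∀ t < N, moment μ (u t) (w t) = 0) :
    (∑ t ∈ Finset.range N, (quadForm μ Q (x t) + quadForm μ R (u t))) + quadForm μ QT (x N) =
      (quadForm μ (S N) (x 0) + ∑ t ∈ Finset.range N, quadForm μ (S (N - (t + 1))) (w t)) +
        ∑ t ∈ Finset.range N, quadForm μ (R + Bᵀ * S (N - (t + 1)) * B)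
          (fun ω => u t ω + riccatiGain (S (N - (t + 1))) A B R *ᵥ x t ω) := by
  have hSpos : ∀ k, (S k).PosSemidef := fun k => by
    induction k with
    | zero => rw [hS0]; exact hQT
    | succ k ih => rw [hS]; exact riccati_posSemidef ih hR hQ A B
  -- Bellman's identity: the stage cost is the drop of the value function along the trajectory, plus
  -- the cost of the noise, plus the square of the deviation from the optimal feedback. Summation
  -- over `t` telescopes the drops.
  have step : ∀ t ∈ Finset.range N, quadForm μ Q (x t) + quadForm μ R (u t) =
      (quadForm μ (S (N - t)) (x t) - quadForm μ (S (N - (t + 1))) (x (t + 1))) +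
      (quadForm μ (S (N - (t + 1))) (w t) + quadForm μ (R + Bᵀ * S (N - (t + 1)) * B)
          (fun ω => u t ω + riccatiGain (S (N - (t + 1))) A B R *ᵥ x t ω)) := fun t ht => by
    have ht := Finset.mem_range.1 ht
    have hxt := hx t ht.le
    have hut := hu t ht
    have hwt := hw t ht
    have hz : VecMem (squareIntegrable μ) fun ω => A *ᵥ x t ω + B *ᵥ u t ω :=
      (hxt.mulVec A).add (hut.mulVec B)
    have e1 : quadForm μ (S (N - (t + 1))) (x (t + 1)) =
        quadForm μ (S (N - (t + 1))) (fun ω => A *ᵥ x t ω + B *ᵥ u t ω) +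
          quadForm μ (S (N - (t + 1))) (w t) := by
      rw [← quadForm_add hz hwt]
      · exact congrArg _ (funext (hdyn t ht))
      · rw [moment_add_left (hxt.mulVec A) (hut.mulVec B) hwt, moment_mulVec_left hxt hwt,
          moment_mulVec_left hut hwt, hxw t ht, huw t ht, Matrix.mul_zero, Matrix.mul_zero,
          add_zero]
    have e2 : quadForm μ Q (x t) + quadForm μ R (u t) +
        quadForm μ (S (N - (t + 1))) (fun ω => A *ᵥ x t ω + B *ᵥ u t ω) =
        quadForm μ (S (N - t)) (x t) + quadForm μ (R + Bᵀ * S (N - (t + 1)) * B)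
          (fun ω => u t ω + riccatiGain (S (N - (t + 1))) A B R *ᵥ x t ω) := by
      have hv : VecMem (squareIntegrable μ) fun ω =>
          u t ω + riccatiGain (S (N - (t + 1))) A B R *ᵥ x t ω := hut.add (hxt.mulVec _)
      -- `S` is indexed by the number of steps to go; `t < N` makes the truncated difference a
      -- successor, so the Riccati recursion applies.
      rw [show N - t = (N - (t + 1)) + 1 by omega, hS]
      have hxu : Integrable (fun ω => x t ω ⬝ᵥ Q *ᵥ x t ω + u t ω ⬝ᵥ R *ᵥ u t ω) μ :=
        (integrable_quadForm hxt Q).add (integrable_quadForm hut R)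
      simp only [quadForm]
      rw [← integral_add (integrable_quadForm hxt Q) (integrable_quadForm hut R),
        ← integral_add hxu (integrable_quadForm hz _),
        ← integral_add (integrable_quadForm hxt _) (integrable_quadForm hv _)]
      exact congrArg _ (funext fun ω => riccati_complete_square (hSpos _) hR A Q B (x t ω) (u t ω))
    linarith
  rw [Finset.sum_congr rfl step, Finset.sum_add_distrib, Finset.sum_add_distrib,
    Finset.sum_range_sub' (fun t => quadForm μ (S (N - t)) (x t))]
  simp only [Nat.sub_zero, Nat.sub_self, hS0]
  ring

end CompleteSquare

/-! ### One step of the recursive least squares filter -/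

section Filter

variable {Ω l p : Type*} [MeasurableSpace Ω] {μ : Measure Ω} [Fintype l] [Fintype p]
  [DecidableEq p]

/-- With `ν = C ξ + v`, the gain solves the normal equation `K E[ν νᵀ] = E[ξ νᵀ]`. The error `ξ - K
ν` is then uncorrelated with `ν`, and its second moment loses exactly `K E[ν νᵀ] Kᵀ`. -/
theorem filter_step {ξ : Ω → l → ℝ} {v : Ω → p → ℝ} (hξ : VecMem (squareIntegrable μ) ξ)
    (hv : VecMem (squareIntegrable μ) v) (hξv : moment μ ξ v = 0) (C : Matrix p l ℝ)
    (hM : IsUnit (C * moment μ ξ ξ * Cᵀ + moment μ v v)) {K : Matrix l p ℝ}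
    (hK : K = moment μ ξ ξ * Cᵀ * (C * moment μ ξ ξ * Cᵀ + moment μ v v)⁻¹) :
    moment μ (fun ω => ξ ω - K *ᵥ (C *ᵥ ξ ω + v ω)) (fun ω => C *ᵥ ξ ω + v ω) = 0 ∧
    moment μ (fun ω => ξ ω - K *ᵥ (C *ᵥ ξ ω + v ω)) (fun ω => ξ ω - K *ᵥ (C *ᵥ ξ ω + v ω)) =
      moment μ ξ ξ - K * (C * moment μ ξ ξ * Cᵀ + moment μ v v) * Kᵀ := by
  have hν : VecMem (squareIntegrable μ) fun ω => C *ᵥ ξ ω + v ω := (hξ.mulVec C).add hv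
  have hKν := hν.mulVec K
  have he := hξ.sub hKν
  have hvξ : moment μ v ξ = 0 := by rw [← moment_transpose, hξv, transpose_zero]
  have h1 : moment μ ξ (fun ω => C *ᵥ ξ ω + v ω) = moment μ ξ ξ * Cᵀ := by
    rw [moment_add_right hξ (hξ.mulVec C) hv, moment_mulVec_right hξ hξ, hξv, add_zero]
  have h2 : moment μ (fun ω => C *ᵥ ξ ω + v ω) (fun ω => C *ᵥ ξ ω + v ω) =
      C * moment μ ξ ξ * Cᵀ + moment μ v v := by
    rw [moment_add_left (hξ.mulVec C) hv hν, moment_mulVec_left hξ hν, h1,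
      moment_add_right hv (hξ.mulVec C) hv, moment_mulVec_right hv hξ, hvξ, Matrix.zero_mul,
      zero_add, Matrix.mul_assoc]
  have hKM : K * (C * moment μ ξ ξ * Cᵀ + moment μ v v) = moment μ ξ ξ * Cᵀ := by
    rw [hK, Matrix.mul_assoc, Matrix.nonsing_inv_mul _ ((Matrix.isUnit_iff_isUnit_det _).1 hM),
      Matrix.mul_one]
  have h3 : moment μ (fun ω => ξ ω - K *ᵥ (C *ᵥ ξ ω + v ω)) (fun ω => C *ᵥ ξ ω + v ω) = 0 := by
    rw [moment_sub_left hξ hKν hν, moment_mulVec_left hν hν, h1, h2, hKM, sub_self]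
  refine ⟨h3, ?_⟩
  rw [moment_sub_right he hξ hKν, moment_mulVec_right he hν, h3, Matrix.zero_mul, sub_zero,
    ← moment_transpose, moment_sub_right hξ hξ hKν, moment_mulVec_right hξ hν, h1, hKM,
    transpose_sub, moment_transpose, ← hKM, transpose_mul, transpose_mul, transpose_transpose,
    ← h2, moment_transpose, Matrix.mul_assoc]

end Filter

/-! ### Stacked vectors -/

section Stacked

variable {n : ℕ} {ι₀ : Type*} {κ : Fin n → Type*}

/-- The component of a stacked vector that belongs to the minor agent `i`. -/
def minorPart (i : Fin n) (X : (ι₀ ⊕ Σ i, κ i) → ℝ) : κ i → ℝ := fun a => X (Sum.inr ⟨i, a⟩)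

/-- The stacked vector `vec(0, X₁, …, Xₙ)`. -/
def minorStack (X : ∀ i, κ i → ℝ) : (ι₀ ⊕ Σ i, κ i) → ℝ := Sum.elim 0 fun p => X p.1 p.2

theorem stacked_ext {X Y : (ι₀ ⊕ Σ i, κ i) → ℝ} (h₀ : ∀ a, X (Sum.inl a) = Y (Sum.inl a))
    (h : ∀ i, minorPart i X = minorPart i Y) : X = Y := by
  funext a
  rcases a with a | ⟨i, a⟩
  · exact h₀ a
  · exact congrFun (h i) a

variable {Ω : Type*}

theorem VecMem.minorPart {W : Submodule ℝ (Ω → ℝ)} {X : Ω → (ι₀ ⊕ Σ i, κ i) → ℝ}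
    (hX : VecMem W X) (i : Fin n) : VecMem W fun ω => minorPart i (X ω) :=
  hX.precomp fun a => Sum.inr ⟨i, a⟩

theorem VecMem.minorStack [Finite ι₀] [∀ i, Finite (κ i)] {W : Submodule ℝ (Ω → ℝ)}
    {X : ∀ i, Ω → κ i → ℝ} (hX : ∀ i, VecMem W (X i)) :
    VecMem W fun ω => minorStack (ι₀ := ι₀) fun i => X i ω :=
  VecMem.of_apply fun a => by
    rcases a with a | ⟨i, a⟩
    · exact W.zero_mem
    · exact (hX i).apply a

variable [MeasurableSpace Ω] {μ : Measure Ω} [Fintype ι₀] [∀ i, Fintype (κ i)]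

/-- The off-diagonal blocks of `Q` are paired with vanishing cross moments. This is why the local
Riccati recursions involve diagonal blocks only, although the cost may couple the agents. -/
theorem quadForm_minorStack {X : ∀ i, Ω → κ i → ℝ} (hX : ∀ i, VecMem (squareIntegrable μ) (X i))
    (h : ∀ i j, i ≠ j → moment μ (X i) (X j) = 0)
    (Q : Matrix (ι₀ ⊕ Σ i, κ i) (ι₀ ⊕ Σ i, κ i) ℝ) :
    quadForm μ Q (fun ω => minorStack fun i => X i ω) =
      ∑ i, quadForm μ (Q.submatrix (fun a => Sum.inr ⟨i, a⟩) fun a => Sum.inr ⟨i, a⟩) (X i) := by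
  rw [quadForm_eq_sum (VecMem.minorStack hX)]
  simp only [Fintype.sum_sum_type, Fintype.sum_sigma, quadForm_eq_sum (hX _)]
  have h0 : ∀ a b, moment μ (fun ω => minorStack (ι₀ := ι₀) fun i => X i ω)
      (fun ω => minorStack (ι₀ := ι₀) fun i => X i ω) (Sum.inl a) b = 0 := fun a b => by
    simp [moment, minorStack]
  have h0' : ∀ a b, moment μ (fun ω => minorStack (ι₀ := ι₀) fun i => X i ω)
      (fun ω => minorStack (ι₀ := ι₀) fun i => X i ω) b (Sum.inl a) = 0 := fun a b => by
    simp [moment, minorStack]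
  simp only [h0, h0', mul_zero, Finset.sum_const_zero, zero_add]
  refine Finset.sum_congr rfl fun i _ => Finset.sum_congr rfl fun a _ => ?_
  rw [Finset.sum_eq_single i]
  · rfl
  · intro j _ hj
    refine Finset.sum_eq_zero fun b _ => ?_
    have : moment μ (X i) (X j) a b = 0 := by rw [h i j hj.symm]; rfl
    exact mul_eq_zero_of_right _ this
  · simp

theorem quadForm_add_minorStack {Y : Ω → (ι₀ ⊕ Σ i, κ i) → ℝ} {X : ∀ i, Ω → κ i → ℝ}
    (hY : VecMem (squareIntegrable μ) Y) (hX : ∀ i, VecMem (squareIntegrable μ) (X i))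
    (hYX : ∀ i, moment μ Y (X i) = 0) (h : ∀ i j, i ≠ j → moment μ (X i) (X j) = 0)
    (Q : Matrix (ι₀ ⊕ Σ i, κ i) (ι₀ ⊕ Σ i, κ i) ℝ) :
    quadForm μ Q (fun ω => Y ω + minorStack fun i => X i ω) = quadForm μ Q Y +
      ∑ i, quadForm μ (Q.submatrix (fun a => Sum.inr ⟨i, a⟩) fun a => Sum.inr ⟨i, a⟩) (X i) := by
  rw [quadForm_add hY (VecMem.minorStack hX), quadForm_minorStack hX h]
  ext a b
  rcases b with b | ⟨i, b⟩
  · simp [moment, minorStack]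
  · exact congrFun (congrFun (hYX i) a) b

end Stacked

-- Block lower triangular matrices acting on stacked vectors.

section BlockTriangular

variable {n : ℕ} {ι₀ κ₀ : Type*} {ι κ : Fin n → Type*} [Fintype κ₀] [∀ i, Fintype (κ i)]
  (D : Matrix ι₀ κ₀ ℝ) (E : ∀ i, Matrix (ι i) κ₀ ℝ) (F : ∀ i, Matrix (ι i) (κ i) ℝ)
  (X : (κ₀ ⊕ Σ i, κ i) → ℝ)

theorem blockTriangular_mulVec_inl :
    (fun a => (fromBlocks D 0 (Matrix.of fun p b => E p.1 p.2 b) (blockDiagonal' F) *ᵥ X)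
      (Sum.inl a)) = D *ᵥ fun a => X (Sum.inl a) := by
  rw [fromBlocks_mulVec]
  funext a
  simp
  rfl

theorem blockTriangular_mulVec_minorPart (i : Fin n) :
    minorPart i (fromBlocks D 0 (Matrix.of fun p b => E p.1 p.2 b) (blockDiagonal' F) *ᵥ X) =
      E i *ᵥ (fun a => X (Sum.inl a)) + F i *ᵥ minorPart i X := by
  rw [fromBlocks_mulVec]
  funext a
  simp only [minorPart, Sum.elim_inr, Pi.add_apply]
  congr 1
  simp only [mulVec, dotProduct, Fintype.sum_sigma, Function.comp]
  rw [Finset.sum_eq_single i]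
  · simp only [blockDiagonal'_apply_eq]
    rfl
  · intro j _ hj
    refine Finset.sum_eq_zero fun b _ => ?_
    rw [blockDiagonal'_apply_ne _ _ _ hj.symm, zero_mul]
  · simp

end BlockTriangular

/-! ### The information of the agents in terms of the primitive random variables -/

section Spaces

variable {n : ℕ} {M : Model n} {Ω : Type*} (P : Primitives M Ω)

/-- The affine functions of `x₀(0), w₀(0), …, w₀(t-1)`. -/
def commonSpace (t : ℕ) : Submodule ℝ (Ω → ℝ) :=
  Submodule.span ℝ {h | h = (fun _ => 1) ∨ (∃ a, h = fun ω => P.x₀ ω a) ∨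
    ∃ s < t, ∃ a, h = fun ω => P.w₀ s ω a}

/-- The state of the minor agent `i` when nothing acts on it but its own noise. -/
def freeState (i : Fin n) : ℕ → Ω → Fin (M.dx i) → ℝ
  | 0 => P.x i
  | t + 1 => fun ω => M.A₁₁ i *ᵥ freeState i t ω + P.w i t ω

/-- The output of the minor agent `i` when nothing acts on it but its own noise. -/
def freeOutput (i : Fin n) (t : ℕ) (ω : Ω) : Fin (M.dy i) → ℝ :=
  M.C i *ᵥ freeState P i t ω + P.v i t ω

/-- The linear functions of the free outputs up to time `t`. -/
def localSpace (i : Fin n) (t : ℕ) : Submodule ℝ (Ω → ℝ) :=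
  Submodule.span ℝ {h | ∃ s ≤ t, ∃ a, h = fun ω => freeOutput P i s ω a}

/-- The random variables that are affine functions of `I_i(t)`, whatever the strategy. -/
def agentSpace (i : Fin n) (t : ℕ) : Submodule ℝ (Ω → ℝ) := commonSpace P t ⊔ localSpace P i t

variable {P}

theorem commonSpace_le {t : ℕ} {W : Submodule ℝ (Ω → ℝ)} (h1 : (fun _ => 1) ∈ W)
    (hx : VecMem W P.x₀) (hw : ∀ s < t, VecMem W (P.w₀ s)) : commonSpace P t ≤ W := by
  refine Submodule.span_le.2 ?_
  rintro h (rfl | ⟨a, rfl⟩ | ⟨s, hs, a, rfl⟩)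
  · exact h1
  · exact hx.apply a
  · exact (hw s hs).apply a

theorem localSpace_le {i : Fin n} {t : ℕ} {W : Submodule ℝ (Ω → ℝ)}
    (hy : ∀ s ≤ t, VecMem W (freeOutput P i s)) : localSpace P i t ≤ W := by
  refine Submodule.span_le.2 ?_
  rintro h ⟨s, hs, a, rfl⟩
  exact (hy s hs).apply a

variable (P)

theorem one_mem_commonSpace (t : ℕ) : (fun _ => 1) ∈ commonSpace P t :=
  Submodule.subset_span (Or.inl rfl)

theorem vecMem_commonSpace_x₀ (t : ℕ) : VecMem (commonSpace P t) P.x₀ :=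
  VecMem.of_apply fun a => Submodule.subset_span (Or.inr (Or.inl ⟨a, rfl⟩))

theorem vecMem_commonSpace_w₀ {s t : ℕ} (h : s < t) : VecMem (commonSpace P t) (P.w₀ s) :=
  VecMem.of_apply fun a => Submodule.subset_span (Or.inr (Or.inr ⟨s, h, a, rfl⟩))

theorem vecMem_localSpace (i : Fin n) {s t : ℕ} (h : s ≤ t) :
    VecMem (localSpace P i t) (freeOutput P i s) :=
  VecMem.of_apply fun a => Submodule.subset_span ⟨s, h, a, rfl⟩

theorem commonSpace_mono {s t : ℕ} (h : s ≤ t) : commonSpace P s ≤ commonSpace P t :=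
  commonSpace_le (one_mem_commonSpace P t) (vecMem_commonSpace_x₀ P t)
    fun _ hr => vecMem_commonSpace_w₀ P (hr.trans_le h)

theorem localSpace_mono (i : Fin n) {s t : ℕ} (h : s ≤ t) : localSpace P i s ≤ localSpace P i t :=
  localSpace_le fun _ hr => vecMem_localSpace P i (hr.trans h)

theorem agentSpace_mono (i : Fin n) {s t : ℕ} (h : s ≤ t) : agentSpace P i s ≤ agentSpace P i t :=
  sup_le_sup (commonSpace_mono P h) (localSpace_mono P i h)

theorem commonSpace_le_agentSpace (i : Fin n) (t : ℕ) : commonSpace P t ≤ agentSpace P i t :=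
  le_sup_left

theorem localSpace_le_agentSpace (i : Fin n) (t : ℕ) : localSpace P i t ≤ agentSpace P i t :=
  le_sup_right

theorem one_mem_agentSpace (i : Fin n) (t : ℕ) : (fun _ => 1) ∈ agentSpace P i t :=
  commonSpace_le_agentSpace P i t (one_mem_commonSpace P t)

/-- Finitely many free outputs span the space; `exists_projection` relies on this to produce the
free estimate. -/
instance localSpace_finiteDimensional (i : Fin n) (t : ℕ) :
    FiniteDimensional ℝ (localSpace P i t) := by
  refine FiniteDimensional.span_of_finite ℝ ?_
  refine ((Set.finite_Iic t).biUnion fun s _ =>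
    Set.finite_range fun (a : Fin (M.dy i)) (ω : Ω) => freeOutput P i s ω a).subset ?_
  rintro h ⟨s, hs, a, rfl⟩
  exact Set.mem_biUnion (Set.mem_Iic.2 hs) ⟨a, rfl⟩

variable (g : M.AffineStrategy)

theorem x₀_zero (ω : Ω) : x₀ P g 0 ω = P.x₀ ω := by rw [x₀]

theorem x₀_succ (t : ℕ) (ω : Ω) :
    x₀ P g (t + 1) ω = M.A₀₀ *ᵥ x₀ P g t ω + M.B₀₀ *ᵥ u₀ P g t ω + P.w₀ t ω := by rw [x₀]

theorem x_zero (i : Fin n) (ω : Ω) : x P g i 0 ω = P.x i ω := by rw [x]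

theorem x_succ (i : Fin n) (t : ℕ) (ω : Ω) :
    x P g i (t + 1) ω = M.A₁₁ i *ᵥ x P g i t ω + M.A₁₀ i *ᵥ x₀ P g t ω + M.B₁₁ i *ᵥ u P g i t ω
      + M.B₁₀ i *ᵥ u₀ P g t ω + P.w i t ω := by rw [x]

/-- The part of the state of a minor agent that is due to the controls and to the major agent. -/
def drift (i : Fin n) (t : ℕ) (ω : Ω) : Fin (M.dx i) → ℝ := x P g i t ω - freeState P i t ω

theorem drift_zero (i : Fin n) (ω : Ω) : drift P g i 0 ω = 0 := by
  rw [drift, x_zero, freeState, sub_self]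

theorem drift_succ (i : Fin n) (t : ℕ) (ω : Ω) :
    drift P g i (t + 1) ω = M.A₁₁ i *ᵥ drift P g i t ω + M.A₁₀ i *ᵥ x₀ P g t ω
      + M.B₁₁ i *ᵥ u P g i t ω + M.B₁₀ i *ᵥ u₀ P g t ω := by
  simp only [drift, x_succ, freeState, mulVec_sub]
  abel

theorem y_eq_drift (i : Fin n) (t : ℕ) (ω : Ω) :
    y P g i t ω = M.C i *ᵥ drift P g i t ω + freeOutput P i t ω := by
  rw [y, drift, freeOutput, mulVec_sub]
  abel

/-- The state at `t` involves noise only up to `t - 1`, and the control at `t` is an affine function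
of states up to `t` and earlier controls. Within one induction step the state must therefore be
treated before the control. -/
theorem major_mem (t : ℕ) :
    VecMem (commonSpace P t) (x₀ P g t) ∧ VecMem (commonSpace P t) (u₀ P g t) := by
  induction t using Nat.strong_induction_on with
  | _ t ih =>
    have hx : VecMem (commonSpace P t) (x₀ P g t) := by
      cases t with
      | zero =>
        rw [show x₀ P g 0 = P.x₀ from funext (x₀_zero P g)]
        exact vecMem_commonSpace_x₀ P 0
      | succ s =>
        rw [funext (x₀_succ P g s)]
        have h := ih s s.lt_succ_self
        have hm := commonSpace_mono P s.le_succ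
        exact (((h.1.mono hm).mulVec _).add ((h.2.mono hm).mulVec _)).add
          (vecMem_commonSpace_w₀ P s.lt_succ_self)
    refine ⟨hx, ?_⟩
    rw [funext (u₀_eq P g t)]
    refine VecMem.affine (VecMem.prodMk (VecMem.pi fun s => ?_) (VecMem.pi fun s => ?_))
      (one_mem_commonSpace P t) (g.g₀ t)
    · rcases (Nat.lt_succ_iff.1 s.2).eq_or_lt with h | h
      · simp only [h]; exact hx
      · exact (ih s.1 h).1.mono (commonSpace_mono P h.le)
    · exact (ih s.1 s.2).2.mono (commonSpace_mono P s.2.le)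

theorem info₀_mem (t : ℕ) : VecMem (commonSpace P t) (info₀ P g t) :=
  VecMem.prodMk
    (VecMem.pi fun s => (major_mem P g s.1).1.mono (commonSpace_mono P (Nat.lt_succ_iff.1 s.2)))
    (VecMem.pi fun s => (major_mem P g s.1).2.mono (commonSpace_mono P s.2.le))

/-- The state of a minor agent is not in its information space, but its drift is, being driven by
known states and controls. The output differs from the free output only by `C_i` times the drift, so
the outputs, and hence the controls, are in the space too. -/
theorem minor_mem (i : Fin n) (t : ℕ) :
    VecMem (agentSpace P i t) (drift P g i t) ∧ VecMem (agentSpace P i t) (u P g i t) := by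
  have hx₀ : ∀ {s t}, s ≤ t → VecMem (agentSpace P i t) (x₀ P g s) := fun h =>
    (major_mem P g _).1.mono ((commonSpace_mono P h).trans (commonSpace_le_agentSpace P i _))
  have hu₀ : ∀ {s t}, s ≤ t → VecMem (agentSpace P i t) (u₀ P g s) := fun h =>
    (major_mem P g _).2.mono ((commonSpace_mono P h).trans (commonSpace_le_agentSpace P i _))
  induction t using Nat.strong_induction_on with
  | _ t ih =>
    have hx : VecMem (agentSpace P i t) (drift P g i t) := by
      cases t with
      | zero =>
        rw [show drift P g i 0 = fun _ => 0 from funext (drift_zero P g i)]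
        exact VecMem.zero
      | succ s =>
        rw [funext (drift_succ P g i s)]
        have h := ih s s.lt_succ_self
        have hm := agentSpace_mono P i s.le_succ
        exact ((((h.1.mono hm).mulVec _).add ((hx₀ s.le_succ).mulVec _)).add
          ((h.2.mono hm).mulVec _)).add ((hu₀ s.le_succ).mulVec _)
    refine ⟨hx, ?_⟩
    rw [funext (u_eq P g i t)]
    refine VecMem.affine (VecMem.prodMk (VecMem.pi fun s => ?_) (VecMem.prodMk
      (VecMem.pi fun s => ?_) (VecMem.prodMk (VecMem.pi fun s => ?_) (VecMem.pi fun s => ?_))))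
      (one_mem_agentSpace P i t) (g.g i t)
    · exact hx₀ (Nat.lt_succ_iff.1 s.2)
    · simp only [y_eq_drift]
      refine VecMem.add (VecMem.mulVec ?_ _) ((vecMem_localSpace P i
        (Nat.lt_succ_iff.1 s.2)).mono (localSpace_le_agentSpace P i t))
      rcases (Nat.lt_succ_iff.1 s.2).eq_or_lt with h | h
      · simp only [h]; exact hx
      · exact (ih s.1 h).1.mono (agentSpace_mono P i h.le)
    · exact hu₀ s.2.le
    · exact (ih s.1 s.2).2.mono (agentSpace_mono P i s.2.le)

theorem info_mem (i : Fin n) (t : ℕ) : VecMem (agentSpace P i t) (info P g i t) := by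
  refine VecMem.prodMk (VecMem.pi fun s => ?_) (VecMem.prodMk
      (VecMem.pi fun s => ?_) (VecMem.prodMk (VecMem.pi fun s => ?_) (VecMem.pi fun s => ?_)))
  · exact (major_mem P g _).1.mono ((commonSpace_mono P (Nat.lt_succ_iff.1 s.2)).trans
      (commonSpace_le_agentSpace P i _))
  · simp only [y_eq_drift]
    exact (((minor_mem P g i s).1.mono (agentSpace_mono P i (Nat.lt_succ_iff.1 s.2))).mulVec _).add
      ((vecMem_localSpace P i (Nat.lt_succ_iff.1 s.2)).mono (localSpace_le_agentSpace P i t))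
  · exact (major_mem P g _).2.mono ((commonSpace_mono P s.2.le).trans
      (commonSpace_le_agentSpace P i _))
  · exact (minor_mem P g i s).2.mono (agentSpace_mono P i s.2.le)

/-- The primitive random variables known to the major agent are affine functions of its data that
do not depend on the strategy. -/
theorem commonSpace_le_comap (t : ℕ) : commonSpace P t ≤
    (affOf fun q : M.AffineStrategy × Ω => info₀ P q.1 t q.2).comap
      (LinearMap.funLeft ℝ ℝ Prod.snd) := by
  have hZ := vecMem_affOf fun q : M.AffineStrategy × Ω => info₀ P q.1 t q.2
  have hx : ∀ s (_ : s ≤ t), VecMem (affOf fun q : M.AffineStrategy × Ω => info₀ P q.1 t q.2)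
      fun q => x₀ P q.1 s q.2 := fun s hs => hZ.fst.eval ⟨s, Nat.lt_succ_iff.2 hs⟩
  have hu : ∀ s (_ : s < t), VecMem (affOf fun q : M.AffineStrategy × Ω => info₀ P q.1 t q.2)
      fun q => u₀ P q.1 s q.2 := fun s hs => hZ.snd.eval ⟨s, hs⟩
  refine commonSpace_le (one_mem_affOf _) (fun φ => ?_) (fun s hs φ => ?_)
  · have := hx 0 t.zero_le φ
    simp only [x₀_zero] at this
    exact this
  · have := (((hx (s + 1) hs).sub ((hx s hs.le).mulVec M.A₀₀)).sub ((hu s hs).mulVec M.B₀₀)) φ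
    simp only [x₀_succ, add_assoc, add_sub_cancel_left] at this
    exact this

/-- An agent knows the states and controls that drive its drift, so it can recompute the drift and
subtract it from its output to recover the free output. Data are regarded as random vectors on
`AffineStrategy × Ω`, which makes the recovering affine map the same for all strategies. -/
theorem agentSpace_le_comap (i : Fin n) (t : ℕ) : agentSpace P i t ≤
    (affOf fun q : M.AffineStrategy × Ω => info P q.1 i t q.2).comap
      (LinearMap.funLeft ℝ ℝ Prod.snd) := by
  set W := affOf fun q : M.AffineStrategy × Ω => info P q.1 i t q.2
  have hZ : VecMem W _ := vecMem_affOf fun q : M.AffineStrategy × Ω => info P q.1 i t q.2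
  have hx₀ : ∀ s (_ : s ≤ t), VecMem W fun q => x₀ P q.1 s q.2 :=
    fun s hs => hZ.fst.eval ⟨s, Nat.lt_succ_iff.2 hs⟩
  have hy : ∀ s (_ : s ≤ t), VecMem W fun q => y P q.1 i s q.2 :=
    fun s hs => hZ.snd.fst.eval ⟨s, Nat.lt_succ_iff.2 hs⟩
  have hu₀ : ∀ s (_ : s < t), VecMem W fun q => u₀ P q.1 s q.2 :=
    fun s hs => hZ.snd.snd.fst.eval ⟨s, hs⟩
  have hu : ∀ s (_ : s < t), VecMem W fun q => u P q.1 i s q.2 :=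
    fun s hs => hZ.snd.snd.snd.eval ⟨s, hs⟩
  have hd : ∀ s (_ : s ≤ t), VecMem W fun q => drift P q.1 i s q.2 := fun s => by
    induction s with
    | zero => intro _; simp only [drift_zero]; exact VecMem.zero
    | succ s ih =>
      intro hs
      simp only [drift_succ]
      exact ((((ih (by omega)).mulVec _).add ((hx₀ s (by omega)).mulVec _)).add
        ((hu s (by omega)).mulVec _)).add ((hu₀ s (by omega)).mulVec _)
  refine sup_le ?_ (localSpace_le fun s hs φ => ?_)
  · refine commonSpace_le (one_mem_affOf _) (fun φ => ?_) (fun s hs φ => ?_)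
    · have := hx₀ 0 t.zero_le φ
      simp only [x₀_zero] at this
      exact this
    · have := (((hx₀ (s + 1) hs).sub ((hx₀ s hs.le).mulVec M.A₀₀)).sub
        ((hu₀ s hs).mulVec M.B₀₀)) φ
      simp only [x₀_succ, add_assoc, add_sub_cancel_left] at this
      exact this
  · have := ((hy s hs).sub ((hd s hs).mulVec (M.C i))) φ
    simp only [y_eq_drift, add_sub_cancel_left] at this
    exact this

/-- The order of quantifiers is the point: `f` is fixed before `g`, so it can be used as a control
law of a strategy that is still to be built. -/
theorem exists_affineMap_info₀ {ι : Type*} {t : ℕ} {X : Ω → ι → ℝ}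
    (hX : VecMem (commonSpace P t) X) :
    ∃ f : M.Info₀ t →ᵃ[ℝ] (ι → ℝ), ∀ g ω, f (info₀ P g t ω) = X ω := by
  have h : VecMem (affOf fun q : M.AffineStrategy × Ω => info₀ P q.1 t q.2) fun q => X q.2 :=
    fun φ => commonSpace_le_comap P t (hX φ)
  obtain ⟨f, hf⟩ := h.exists_affineMap
  exact ⟨f, fun g ω => hf (g, ω)⟩

theorem exists_affineMap_info {ι : Type*} {i : Fin n} {t : ℕ} {X : Ω → ι → ℝ}
    (hX : VecMem (agentSpace P i t) X) :
    ∃ f : M.Info i t →ᵃ[ℝ] (ι → ℝ), ∀ g ω, f (info P g i t ω) = X ω := by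
  have h : VecMem (affOf fun q : M.AffineStrategy × Ω => info P q.1 i t q.2) fun q => X q.2 :=
    fun φ => agentSpace_le_comap P i t (hX φ)
  obtain ⟨f, hf⟩ := h.exists_affineMap
  exact ⟨f, fun g ω => hf (g, ω)⟩

/-- Controls have no dual effect: the right-hand side does not mention `g`. -/
theorem affOf_info₀ (t : ℕ) : affOf (info₀ P g t) = commonSpace P t := by
  refine le_antisymm (affOf_le (one_mem_commonSpace P t) (info₀_mem P g t)) fun h hh => ?_
  obtain ⟨f, hf⟩ := commonSpace_le_comap P t hh
  exact ⟨f, fun ω => hf (g, ω)⟩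

theorem affOf_info (i : Fin n) (t : ℕ) : affOf (info P g i t) = agentSpace P i t := by
  refine le_antisymm (affOf_le (one_mem_agentSpace P i t) (info_mem P g i t)) fun h hh => ?_
  obtain ⟨f, hf⟩ := agentSpace_le_comap P i t hh
  exact ⟨f, fun ω => hf (g, ω)⟩

end Spaces

/-! ### Common and local parts of the controls and states -/

section Decomposition

variable {n : ℕ} {M : Model n} {Ω : Type*} (P : Primitives M Ω) (g : M.AffineStrategy)

/-- `uc` and `ul` are common and local parts of the controls under the strategy `g`. -/
structure IsDecomposition (uc : ℕ → Ω → M.ControlIdx → ℝ)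
    (ul : ∀ i : Fin n, ℕ → Ω → Fin (M.du i) → ℝ) : Prop where
  major : ∀ t ω, u₀ P g t ω = fun a => uc t ω (Sum.inl a)
  minor : ∀ i t ω, u P g i t ω = minorPart i (uc t ω) + ul i t ω
  common_mem : ∀ t, VecMem (commonSpace P t) (uc t)
  local_mem : ∀ i t, VecMem (localSpace P i t) (ul i t)

theorem exists_isDecomposition : ∃ uc ul, IsDecomposition P g uc ul := by
  choose X Y hX hY h using fun i t => (minor_mem P g i t).2.exists_add_of_sup
  refine ⟨fun t ω => Sum.elim (u₀ P g t ω) fun p => X p.1 t ω p.2, Y, fun t ω => rfl, h,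
    fun t => VecMem.sumElim (major_mem P g t).2 (VecMem.of_apply fun p => (hX p.1 t).apply p.2), hY⟩

/-- The common part of the stacked state. -/
def commonState (uc : ℕ → Ω → M.ControlIdx → ℝ) : ℕ → Ω → M.StateIdx → ℝ
  | 0 => fun ω => Sum.elim (P.x₀ ω) 0
  | t + 1 => fun ω => M.A *ᵥ commonState uc t ω + M.B *ᵥ uc t ω + Sum.elim (P.w₀ t ω) 0

/-- The effect of the local part of the controls on the state of a minor agent. -/
def localDrift (i : Fin n) (ul : ℕ → Ω → Fin (M.du i) → ℝ) : ℕ → Ω → Fin (M.dx i) → ℝ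
  | 0 => fun _ => 0
  | t + 1 => fun ω => M.A₁₁ i *ᵥ localDrift i ul t ω + M.B₁₁ i *ᵥ ul t ω

variable {P g} {uc : ℕ → Ω → M.ControlIdx → ℝ} {ul : ∀ i : Fin n, ℕ → Ω → Fin (M.du i) → ℝ}

theorem vecMem_commonState (h : ∀ t, VecMem (commonSpace P t) (uc t)) (t : ℕ) :
    VecMem (commonSpace P t) (commonState P uc t) := by
  induction t with
  | zero => exact VecMem.sumElim (vecMem_commonSpace_x₀ P 0) VecMem.zero
  | succ t ih =>
    have hm := commonSpace_mono P t.le_succ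
    exact (((ih.mono hm).mulVec _).add (((h t).mono hm).mulVec _)).add
      (VecMem.sumElim (vecMem_commonSpace_w₀ P t.lt_succ_self) VecMem.zero)

theorem vecMem_localDrift {i : Fin n} {ul : ℕ → Ω → Fin (M.du i) → ℝ}
    (h : ∀ t, VecMem (localSpace P i t) (ul t)) (t : ℕ) :
    VecMem (localSpace P i t) (localDrift i ul t) := by
  induction t with
  | zero => exact VecMem.zero
  | succ t ih =>
    have hm := localSpace_mono P i t.le_succ
    exact ((ih.mono hm).mulVec _).add (((h t).mono hm).mulVec _)

theorem IsDecomposition.x₀_eq (h : IsDecomposition P g uc ul) (t : ℕ) (ω : Ω) :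
    x₀ P g t ω = fun a => commonState P uc t ω (Sum.inl a) := by
  induction t with
  | zero => rw [x₀_zero]; rfl
  | succ t ih =>
    have hA := blockTriangular_mulVec_inl M.A₀₀ M.A₁₀ M.A₁₁ (commonState P uc t ω)
    have hB := blockTriangular_mulVec_inl M.B₀₀ M.B₁₀ M.B₁₁ (uc t ω)
    rw [x₀_succ, ih, h.major, ← hA, ← hB]
    rfl

/-- Superposition. By block triangularity the row of agent `i` sees only the major agent and agent
`i` itself, so no local part of another agent enters. -/
theorem IsDecomposition.x_eq (h : IsDecomposition P g uc ul) (i : Fin n) (t : ℕ) (ω : Ω) :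
    x P g i t ω = minorPart i (commonState P uc t ω) +
      (localDrift i (ul i) t ω + freeState P i t ω) := by
  induction t with
  | zero =>
    rw [x_zero]
    simp only [localDrift, freeState, zero_add]
    exact (zero_add _).symm
  | succ t ih =>
    have hA := blockTriangular_mulVec_minorPart M.A₀₀ M.A₁₀ M.A₁₁ (commonState P uc t ω) i
    have hB := blockTriangular_mulVec_minorPart M.B₀₀ M.B₁₀ M.B₁₁ (uc t ω) i
    have e : minorPart i (commonState P uc (t + 1) ω) =
        minorPart i (M.A *ᵥ commonState P uc t ω) + minorPart i (M.B *ᵥ uc t ω) := by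
      funext a
      simp [minorPart, commonState]
    rw [x_succ, ih, h.major, h.minor, h.x₀_eq, e, Model.A, Model.B, hA, hB, localDrift, freeState]
    simp only [mulVec_add]
    abel

theorem IsDecomposition.state_eq (h : IsDecomposition P g uc ul) (t : ℕ) (ω : Ω) :
    state P g t ω = commonState P uc t ω +
      minorStack fun i => localDrift i (ul i) t ω + freeState P i t ω := by
  refine stacked_ext (fun a => ?_) fun i => ?_
  · simp [state, h.x₀_eq, minorStack]
  · exact h.x_eq i t ω

theorem IsDecomposition.control_eq (h : IsDecomposition P g uc ul) (t : ℕ) (ω : Ω) :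
    control P g t ω = uc t ω + minorStack fun i => ul i t ω := by
  refine stacked_ext (fun a => ?_) fun i => ?_
  · simp [control, h.major, minorStack]
  · exact h.minor i t ω

/-- Controls that depend on the information of the agents come from an affine strategy. -/
theorem exists_strategy (hc : ∀ t, VecMem (commonSpace P t) (uc t))
    (hl : ∀ i t, VecMem (localSpace P i t) (ul i t)) :
    ∃ g : M.AffineStrategy, IsDecomposition P g uc ul := by
  choose f₀ hf₀ using fun t => exists_affineMap_info₀ P ((hc t).precomp Sum.inl)
  choose f hf using fun i t => exists_affineMap_info P
    ((((hc t).mono (commonSpace_le_agentSpace P i t)).minorPart i).add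
      ((hl i t).mono (localSpace_le_agentSpace P i t)))
  -- The laws `f₀`, `f` return the prescribed controls on the data generated by any strategy, in
  -- particular by the one they define.
  exact ⟨⟨f₀, f⟩, fun t ω => by rw [u₀_eq]; exact hf₀ t _ ω,
    fun i t ω => by rw [u_eq]; exact hf i t _ ω, hc, hl⟩

end Decomposition

/-! ### Linear functions of the primitive random variables -/

theorem measurable_pi_of_apply {Ω ι E : Type*} {m : MeasurableSpace Ω} [MeasurableSpace E]
    {Z : Ω → ι → E} (h : ∀ a, Measurable fun ω => Z ω a) : Measurable Z :=
  measurable_pi_lambda _ h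

theorem VecMem.measurable {Ω ι : Type*} {m : MeasurableSpace Ω} {W : Submodule ℝ (Ω → ℝ)}
    {Z : Ω → ι → ℝ} (hZ : VecMem W Z) (hW : ∀ f ∈ W, Measurable f) : Measurable Z :=
  measurable_pi_of_apply fun a => hW _ (hZ.apply a)

section PrimSpace

variable {n : ℕ} {M : Model n} {Ω : Type*} (P : Primitives M Ω) (N : ℕ)

/-- The linear functions of the primitive random variables with labels in `K`. -/
def primSpace (K : Set (PrimIdx n N)) : Submodule ℝ (Ω → ℝ) :=
  Submodule.span ℝ {h | ∃ k ∈ K, ∃ a, h = fun ω => P.var N k ω a}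

/-- Labels of `x₀(0), w₀(0), …, w₀(t-1)`. -/
def commonIdx (n N t : ℕ) : Set (PrimIdx n N) := fun k =>
  match k with
  | .x₀ => True
  | .w₀ s => s.1 < t
  | _ => False

/-- Labels of `x_i(0), w_i(0), …, w_i(t-1), v_i(0), …, v_i(t)`. -/
def localIdx {n : ℕ} (N : ℕ) (i : Fin n) (t : ℕ) : Set (PrimIdx n N) := fun k =>
  match k with
  | .x j => j = i
  | .w j s => j = i ∧ s.1 < t
  | .v j s => j = i ∧ s.1 ≤ t
  | _ => False

variable {N}

theorem vecMem_primSpace {K : Set (PrimIdx n N)} {k : PrimIdx n N} (hk : k ∈ K) :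
    VecMem (primSpace P N K) (P.var N k) :=
  VecMem.of_apply fun a => Submodule.subset_span ⟨k, hk, a, rfl⟩

theorem primSpace_mono {K K' : Set (PrimIdx n N)} (h : K ⊆ K') :
    primSpace P N K ≤ primSpace P N K' :=
  Submodule.span_mono fun _ ⟨k, hk, a, e⟩ => ⟨k, h hk, a, e⟩

theorem localIdx_mono (i : Fin n) {s t : ℕ} (h : s ≤ t) : localIdx N i s ⊆ localIdx N i t := by
  rintro (_ | j | r | ⟨j, r⟩ | ⟨j, r⟩) hk
  · exact hk
  · exact hk
  · exact hk
  · exact ⟨hk.1, hk.2.trans_le h⟩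
  · exact ⟨hk.1, hk.2.trans h⟩

theorem disjoint_commonIdx_localIdx (i : Fin n) (s t : ℕ) :
    Disjoint (commonIdx n N s) (localIdx N i t) := by
  rw [Set.disjoint_left]
  rintro (_ | j | r | ⟨j, r⟩ | ⟨j, r⟩) hk hk'
  · exact hk'
  · exact hk
  · exact hk'
  · exact hk
  · exact hk

theorem disjoint_localIdx {i j : Fin n} (hij : i ≠ j) (s t : ℕ) :
    Disjoint (localIdx N i s) (localIdx N j t) := by
  rw [Set.disjoint_left]
  rintro (_ | j | r | ⟨j, r⟩ | ⟨j, r⟩) hk hk'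
  · exact hk
  · exact hij (hk.symm.trans hk')
  · exact hk
  · exact hij (hk.1.symm.trans hk'.1)
  · exact hij (hk.1.symm.trans hk'.1)

theorem vecMem_freeState (i : Fin n) {t : ℕ} (ht : t ≤ N) :
    VecMem (primSpace P N (localIdx N i t)) (freeState P i t) := by
  induction t with
  | zero => exact vecMem_primSpace P (k := .x i) (show i = i from rfl)
  | succ t ih =>
    exact (((ih (by omega)).mono (primSpace_mono P (localIdx_mono i t.le_succ))).mulVec _).add
      (vecMem_primSpace P (k := .w i ⟨t, by omega⟩) ⟨rfl, t.lt_succ_self⟩)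

theorem localSpace_le_primSpace (i : Fin n) {t : ℕ} (ht : t ≤ N) :
    localSpace P i t ≤ primSpace P N (localIdx N i t) :=
  localSpace_le fun s hs =>
    (((vecMem_freeState P i (hs.trans ht)).mono (primSpace_mono P (localIdx_mono i hs))).mulVec
      _).add (vecMem_primSpace P (k := .v i ⟨s, by omega⟩) ⟨rfl, hs⟩)

/-- The constants are split off because the remaining summand is centred. The bound is `N + 1`
because the labels include the noise of time `N`. -/
theorem commonSpace_le_primSpace {t : ℕ} (ht : t ≤ N + 1) :
    commonSpace P t ≤ Submodule.span ℝ {fun _ => 1} ⊔ primSpace P N (commonIdx n N t) := by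
  refine commonSpace_le (le_sup_left (α := Submodule ℝ (Ω → ℝ))
      (Submodule.mem_span_singleton_self _)) ?_ fun s hs => ?_
  · exact (vecMem_primSpace P (K := commonIdx n N t) (k := .x₀) trivial).mono le_sup_right
  · exact (vecMem_primSpace P (K := commonIdx n N t) (k := .w₀ ⟨s, by omega⟩) hs).mono le_sup_right

theorem IsDecomposition.localState_mem {P : Primitives M Ω} {g : M.AffineStrategy}
    {uc : ℕ → Ω → M.ControlIdx → ℝ} {ul : ∀ i : Fin n, ℕ → Ω → Fin (M.du i) → ℝ}
    (hd : IsDecomposition P g uc ul) (i : Fin n) {t : ℕ}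
    (ht : t ≤ N) : VecMem (primSpace P N (localIdx N i t))
      fun ω => localDrift i (ul i) t ω + freeState P i t ω :=
  ((vecMem_localDrift (hd.local_mem i) t).mono (localSpace_le_primSpace P i ht)).add
    (vecMem_freeState P i ht)

theorem IsDecomposition.commonState_mem_affOf {P : Primitives M Ω} {g : M.AffineStrategy}
    {uc : ℕ → Ω → M.ControlIdx → ℝ} {ul : ∀ i : Fin n, ℕ → Ω → Fin (M.du i) → ℝ}
    (hd : IsDecomposition P g uc ul) (t : ℕ) :
    VecMem (affOf (info₀ P g t)) (commonState P uc t) := by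
  rw [affOf_info₀]
  exact vecMem_commonState hd.common_mem t

end PrimSpace

-- Centring and orthogonality from independence.

section Probability

variable {n N : ℕ} {M : Model n} {Ω : Type*} [MeasurableSpace Ω] {μ : Measure Ω}
  [IsProbabilityMeasure μ] {P : Primitives M Ω} {S : M.Covariances}

theorem Primitives.Admissible.var_mem (hP : P.Admissible μ N S) (k : PrimIdx n N) : VecMem (centred μ) (P.var N k) :=
  VecMem.of_apply fun a => by
    have hm : ∀ a, MemLp (fun ω => P.var N k ω a) 2 μ := memLp_pi_iff.1 (hP.memLp k)
    refine mem_centred.2 ⟨hm a, ?_⟩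
    rw [← eval_integral (f := P.var N k) (fun a => (hm a).integrable one_le_two) a,
      hP.mean_zero k]
    rfl

theorem Primitives.Admissible.primSpace_le_centred (hP : P.Admissible μ N S) (K : Set (PrimIdx n N)) :
    primSpace P N K ≤ centred μ :=
  Submodule.span_le.2 <| by rintro _ ⟨k, -, a, rfl⟩; exact (hP.var_mem k).apply a

theorem Primitives.Admissible.primSpace_le (hP : P.Admissible μ N S) (K : Set (PrimIdx n N)) :
    primSpace P N K ≤ squareIntegrable μ :=
  fun _ h => (mem_centred.1 (hP.primSpace_le_centred K h)).1

/-- Components of distinct primitives are independent with mean zero, so the expectation of their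
product factors into zero; bilinearity does the rest. -/
theorem Primitives.Admissible.primSpace_orthogonal (hP : P.Admissible μ N S) {K K' : Set (PrimIdx n N)}
    (h : Disjoint K K') : Orthogonal μ (primSpace P N K) (primSpace P N K') := by
  refine orthogonal_span_span ?_ ?_ ?_
  · rintro _ ⟨k, -, a, rfl⟩; exact (mem_centred.1 ((hP.var_mem k).apply a)).1
  · rintro _ ⟨k, -, a, rfl⟩; exact (mem_centred.1 ((hP.var_mem k).apply a)).1
  · rintro _ ⟨k, hk, a, rfl⟩ _ ⟨l, hl, b, rfl⟩
    have hkl : k ≠ l := fun e => Set.disjoint_left.1 h hk (e ▸ hl)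
    have hi := (hP.indep.indepFun hkl).comp (measurable_pi_apply a) (measurable_pi_apply b)
    have ha := mem_centred.1 ((hP.var_mem k).apply a)
    have hb := mem_centred.1 ((hP.var_mem l).apply b)
    have := hi.integral_mul_eq_mul_integral ha.1.1 hb.1.1
    refine this.trans ?_
    refine mul_eq_zero_of_left ha.2 _

theorem Primitives.Admissible.commonSpace_le (hP : P.Admissible μ N S) {t : ℕ} (ht : t ≤ N + 1) :
    commonSpace P t ≤ squareIntegrable μ :=
  (commonSpace_le_primSpace P ht).trans (sup_le
    (Submodule.span_le.2 (by rintro _ rfl; exact one_mem_squareIntegrable)) (hP.primSpace_le _))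

theorem Primitives.Admissible.localSpace_le (hP : P.Admissible μ N S) (i : Fin n) {t : ℕ} (ht : t ≤ N) :
    localSpace P i t ≤ squareIntegrable μ :=
  (localSpace_le_primSpace P i ht).trans (hP.primSpace_le _)

theorem Primitives.Admissible.agentSpace_le (hP : P.Admissible μ N S) (i : Fin n) {t : ℕ} (ht : t ≤ N) :
    agentSpace P i t ≤ squareIntegrable μ :=
  sup_le (hP.commonSpace_le (by omega)) (hP.localSpace_le i ht)

/-- Besides disjointness of labels this uses zero means: the constants in `commonSpace` are
orthogonal to `primSpace` because the latter is centred. -/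
theorem Primitives.Admissible.commonSpace_orthogonal (hP : P.Admissible μ N S) {t : ℕ} (ht : t ≤ N + 1)
    {K : Set (PrimIdx n N)} (h : Disjoint (commonIdx n N t) K) :
    Orthogonal μ (commonSpace P t) (primSpace P N K) := by
  refine (orthogonal_sup_left (Submodule.span_le.2 (by rintro _ rfl; exact
    one_mem_squareIntegrable)) (hP.primSpace_le _) (hP.primSpace_le _) ?_
    (hP.primSpace_orthogonal h)).mono (commonSpace_le_primSpace P ht) le_rfl
  intro f hf k hk
  obtain ⟨c, rfl⟩ := Submodule.mem_span_singleton.1 hf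
  simp only [Pi.smul_apply, smul_eq_mul, mul_one]
  rw [integral_const_mul, (mem_centred.1 (hP.primSpace_le_centred K hk)).2, mul_zero]

theorem Primitives.Admissible.commonSpace_orthogonal_local (hP : P.Admissible μ N S) {s t : ℕ} (hs : s ≤ N + 1)
    (i : Fin n) : Orthogonal μ (commonSpace P s) (primSpace P N (localIdx N i t)) :=
  hP.commonSpace_orthogonal hs (disjoint_commonIdx_localIdx i s t)

/-! ### Conditional expectations given the common information -/

/-- `X` is measurable with respect to the common information, while `Y` is independent of it and has
mean zero. Here independence of the primitives is essential; uncorrelatedness would not determine a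
conditional expectation. -/
theorem Primitives.Admissible.condExp_common (hP : P.Admissible μ N S) (g : M.AffineStrategy) {ι : Type*} [Fintype ι]
    {t : ℕ} (ht : t ≤ N) {X Y : Ω → ι → ℝ} (hX : VecMem (commonSpace P t) X)
    {K : Set (PrimIdx n N)} (hK : Disjoint (commonIdx n N t) K) (hY : VecMem (primSpace P N K) Y) :
    μ[fun ω => X ω + Y ω | commonSigma P g t] =ᵐ[μ] X := by
  let m : PrimIdx n N → MeasurableSpace Ω := fun k => MeasurableSpace.comap (P.var N k) inferInstance
  have hm : ∀ k, m k ≤ ‹MeasurableSpace Ω› := fun k => (hP.measurable k).comap_le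
  have hind : Indep (⨆ k ∈ K, m k) (⨆ k ∈ commonIdx n N t, m k) μ :=
    indep_iSup_of_disjoint hm hP.indep.iIndep hK.symm
  have hmeas : ∀ (K : Set (PrimIdx n N)) (f), f ∈ primSpace P N K →
      Measurable[⨆ k ∈ K, m k] f := fun K f hf => by
    induction hf using Submodule.span_induction with
    | mem f hf =>
      obtain ⟨k, hk, a, rfl⟩ := hf
      have h1 : Measurable[m k] fun ω => P.var N k ω a :=
        (measurable_pi_apply a).comp (comap_measurable _)
      exact h1.mono (le_iSup₂ (f := fun k (_ : k ∈ K) => m k) k hk) le_rfl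
    | zero => exact measurable_const
    | add f h _ _ hf hh => exact hf.add hh
    | smul c f _ hf => exact hf.const_smul c
  have hcom : ∀ f ∈ commonSpace P t, Measurable[⨆ k ∈ commonIdx n N t, m k] f := fun f hf => by
    obtain ⟨a, ha, b, hb, rfl⟩ := Submodule.mem_sup.1
      (commonSpace_le_primSpace P (ht.trans N.le_succ) hf)
    obtain ⟨c, rfl⟩ := Submodule.mem_span_singleton.1 ha
    exact Measurable.add measurable_const (hmeas _ b hb)
  -- The common data are functions of the major agent's primitives, so independence of `Y` from
  -- those primitives passes to the smaller σ-algebra.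
  have hle : commonSigma P g t ≤ ⨆ k ∈ commonIdx n N t, m k := by
    refine Measurable.comap_le ?_
    have hi := info₀_mem P g t
    exact Measurable.prodMk
      (measurable_pi_of_apply fun s => hi.fst.eval s |>.measurable hcom)
      (measurable_pi_of_apply fun s => hi.snd.eval s |>.measurable hcom)
  have hle0 : (⨆ k ∈ commonIdx n N t, m k) ≤ ‹MeasurableSpace Ω› := iSup₂_le fun k _ => hm k
  have hleK : (⨆ k ∈ K, m k) ≤ ‹MeasurableSpace Ω› := iSup₂_le fun k _ => hm k
  have hXint : Integrable X μ := Integrable.of_eval fun a =>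
    integrable_of_mem (hP.commonSpace_le (by omega) (hX.apply a))
  have hYint : Integrable Y μ := Integrable.of_eval fun a =>
    integrable_of_mem (hP.primSpace_le K (hY.apply a))
  -- Conversely, every element of `commonSpace` is an affine function of `I₀(t)`, hence measurable
  -- with respect to the common σ-algebra.
  have hXm : StronglyMeasurable[commonSigma P g t] X := by
    rw [← affOf_info₀ P g t] at hX
    obtain ⟨f, hf⟩ := hX.exists_affineMap
    rw [show X = fun ω => f (info₀ P g t ω) from funext fun ω => (hf ω).symm]
    refine Measurable.stronglyMeasurable ?_
    exact (AffineMap.continuous_of_finiteDimensional f).measurable.comp (comap_measurable _)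
  have hYm : StronglyMeasurable[⨆ k ∈ K, m k] Y :=
    (hY.measurable (hmeas K)).stronglyMeasurable
  have h1 := condExp_add hXint hYint (commonSigma P g t)
  have h2 := condExp_indep_eq hleK (hle.trans hle0) hYm (indep_of_indep_of_le_right hind hle)
  rw [condExp_of_stronglyMeasurable (hle.trans hle0) hXm hXint] at h1
  have h3 : ∫ ω, Y ω ∂μ = 0 := by
    funext a
    rw [eval_integral fun a => integrable_of_mem (hP.primSpace_le K (hY.apply a))]
    exact (mem_centred.1 (hP.primSpace_le_centred K (hY.apply a))).2
  filter_upwards [h1, h2] with ω e1 e2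
  refine e1.trans ?_
  rw [Pi.add_apply, e2, h3, add_zero]

end Probability

/-! ### Estimates -/

section Estimation

variable {n : ℕ} {M : Model n} {Ω : Type*} [MeasurableSpace Ω]

/-- `p i t` is the least squares estimate of the free state of the minor agent `i` from its free
outputs up to time `t`. -/
structure IsFreeEstimate (P : Primitives M Ω) (μ : Measure Ω) (N : ℕ)
    (p : ∀ i : Fin n, ℕ → Ω → Fin (M.dx i) → ℝ) : Prop where
  mem : ∀ i t, VecMem (localSpace P i t) (p i t)
  normal_eq : ∀ i, ∀ t ≤ N, ∀ a, ∀ h ∈ localSpace P i t,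
    ∫ ω, (freeState P i t ω a - p i t ω a) * h ω ∂μ = 0

variable {N : ℕ} {μ : Measure Ω} {P : Primitives M Ω}
  {S : M.Covariances}

theorem Primitives.Admissible.exists_isFreeEstimate [IsProbabilityMeasure μ] (hP : P.Admissible μ N S)
    : ∃ p, IsFreeEstimate P μ N p := by
  have : ∀ i t, ∀ a, ∃ q ∈ localSpace P i t, t ≤ N → ∀ h ∈ localSpace P i t,
      ∫ ω, (freeState P i t ω a - q ω) * h ω ∂μ = 0 := fun i t a => by
    by_cases ht : t ≤ N
    · obtain ⟨q, hq, h⟩ := exists_projection (hP.localSpace_le i ht)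
        (hP.primSpace_le _ ((vecMem_freeState P i ht).apply a))
      exact ⟨q, hq, fun _ => h⟩
    -- Nothing is assumed about the primitives after time `N`; the value `0` only makes the family
    -- total.
    · exact ⟨0, zero_mem _, fun h => absurd h ht⟩
  choose q hq h using this
  exact ⟨fun i t ω a => q i t a ω, fun i t => VecMem.of_apply (hq i t),
    fun i t ht a => h i t a ht⟩

variable {p : ∀ i : Fin n, ℕ → Ω → Fin (M.dx i) → ℝ} 
  {g : M.AffineStrategy} {uc : ℕ → Ω → M.ControlIdx → ℝ}
  {ul : ∀ i : Fin n, ℕ → Ω → Fin (M.du i) → ℝ}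

theorem IsDecomposition.state_mem [IsProbabilityMeasure μ] (hP : P.Admissible μ N S)
    (hd : IsDecomposition P g uc ul) {t : ℕ} (ht : t ≤ N) :
    VecMem (squareIntegrable μ) (state P g t) := by
  rw [funext (hd.state_eq t)]
  exact ((vecMem_commonState hd.common_mem t).mono (hP.commonSpace_le (by omega))).add
    (VecMem.minorStack fun i => (hd.localState_mem i ht).mono (hP.primSpace_le _))

theorem Primitives.Admissible.info₀_mem [IsProbabilityMeasure μ] (hP : P.Admissible μ N S)
    {t : ℕ} (ht : t ≤ N) :
    VecMem (squareIntegrable μ) (info₀ P g t) :=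
  (MajorMinor.info₀_mem P g t).mono (hP.commonSpace_le (by omega))

theorem Primitives.Admissible.info_mem [IsProbabilityMeasure μ] (hP : P.Admissible μ N S)
    (i : Fin n) {t : ℕ} (ht : t ≤ N) :
    VecMem (squareIntegrable μ) (info P g i t) :=
  (MajorMinor.info_mem P g i t).mono (hP.agentSpace_le i ht)

/-- The error of the common state is a stack of local parts, and these are orthogonal to
`commonSpace`, that is, to all affine functions of `I₀(t)`. -/
theorem IsDecomposition.normal_eq_common [IsProbabilityMeasure μ] (hP : P.Admissible μ N S)
    (hd : IsDecomposition P g uc ul) {t : ℕ} (ht : t ≤ N) :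
    ∀ a, ∀ h ∈ affOf (info₀ P g t),
      ∫ ω, (state P g t ω a - commonState P uc t ω a) * h ω ∂μ = 0 := by
  intro a h hh
  rw [affOf_info₀] at hh
  simp only [hd.state_eq, Pi.add_apply, add_sub_cancel_left]
  rcases a with a | ⟨i, a⟩
  · simp [minorStack]
  · exact (hP.commonSpace_orthogonal_local (by omega) i).symm _
      ((hd.localState_mem i ht).apply a) h hh

theorem IsDecomposition.xhatCom_ae [IsProbabilityMeasure μ] (hP : P.Admissible μ N S)
    (hd : IsDecomposition P g uc ul) {t : ℕ} (ht : t ≤ N) :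
    ∀ᵐ ω ∂μ, xhatCom P g μ t ω = commonState P uc t ω := by
  exact llms_ae_eq (hP.info₀_mem ht) (hd.state_mem hP ht) (hd.commonState_mem_affOf t)
    (hd.normal_eq_common hP ht)

/-- The estimate of the stacked state by the minor agent `i`. -/
def minorEstimate (P : Primitives M Ω) (p : ∀ i : Fin n, ℕ → Ω → Fin (M.dx i) → ℝ)
    (uc : ℕ → Ω → M.ControlIdx → ℝ) (ul : ∀ i : Fin n, ℕ → Ω → Fin (M.du i) → ℝ) (i : Fin n)
    (t : ℕ) (ω : Ω) : M.StateIdx → ℝ :=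
  commonState P uc t ω +
    minorStack fun j => if j = i then localDrift j (ul j) t ω + p j t ω else 0

theorem IsDecomposition.minorEstimate_mem (hd : IsDecomposition P g uc ul)
    (hp : IsFreeEstimate P μ N p) (i : Fin n) (t : ℕ) :
    VecMem (affOf (info P g i t)) (minorEstimate P p uc ul i t) := by
  rw [affOf_info]
  refine ((vecMem_commonState hd.common_mem t).mono (commonSpace_le_agentSpace P i t)).add
    (VecMem.minorStack (X := fun j ω => if j = i then localDrift j (ul j) t ω + p j t ω else 0)
      fun j => ?_)
  by_cases h : j = i
  · subst h
    simp only [if_true]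
    exact ((vecMem_localDrift (hd.local_mem j) t).add (hp.mem j t)).mono
      (localSpace_le_agentSpace P j t)
  · simp only [h, if_false]
    exact VecMem.zero

theorem IsFreeEstimate.error_mem (hp : IsFreeEstimate P μ N p) (i : Fin n) {t : ℕ} (ht : t ≤ N) :
    VecMem (primSpace P N (localIdx N i t)) fun ω => freeState P i t ω - p i t ω :=
  (vecMem_freeState P i ht).sub ((hp.mem i t).mono (localSpace_le_primSpace P i ht))

/-- The error is zero in the major block. In the agent's own block it is the free estimation error,
orthogonal to `commonSpace` by independence and to `localSpace` by the choice of `p`. In the block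
of another agent it is that agent's whole local state, which is uncorrelated with the data of agent
`i` and is therefore estimated by zero. -/
theorem IsDecomposition.normal_eq_minor [IsProbabilityMeasure μ] (hP : P.Admissible μ N S)
    (hd : IsDecomposition P g uc ul)
    (hp : IsFreeEstimate P μ N p) (i : Fin n) {t : ℕ} (ht : t ≤ N) :
    ∀ a, ∀ h ∈ affOf (info P g i t),
      ∫ ω, (state P g t ω a - minorEstimate P p uc ul i t ω a) * h ω ∂μ = 0 := by
  intro a h hh
  rw [affOf_info] at hh
  simp only [hd.state_eq, minorEstimate, Pi.add_apply, add_sub_add_left_eq_sub]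
  have main : ∀ f ∈ squareIntegrable μ, Orthogonal μ (commonSpace P t) (Submodule.span ℝ {f}) →
      Orthogonal μ (localSpace P i t) (Submodule.span ℝ {f}) → ∫ ω, f ω * h ω ∂μ = 0 :=
    fun f hf h1 h2 => (orthogonal_sup_left (hP.commonSpace_le (by omega)) (hP.localSpace_le i ht)
      (Submodule.span_le.2 (by rintro _ rfl; exact hf)) h1 h2).symm f
      (Submodule.mem_span_singleton_self f) h hh
  rcases a with a | ⟨j, a⟩
  · simp [minorStack]
  · by_cases hj : j = i
    · subst hj
      simp only [minorStack, Sum.elim_inr, if_true, Pi.add_apply, add_sub_add_left_eq_sub]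
      have hm := (hp.error_mem j ht).apply a
      refine main (fun ω => freeState P j t ω a - p j t ω a) (hP.primSpace_le _ hm) ?_ ?_
      · exact (hP.commonSpace_orthogonal_local (by omega) j).mono le_rfl
          (Submodule.span_le.2 (by rintro _ rfl; exact hm))
      · intro f hf k hk
        obtain ⟨c, rfl⟩ := Submodule.mem_span_singleton.1 hk
        simp only [Pi.smul_apply, smul_eq_mul, mul_left_comm _ c]
        simp only [mul_comm (f _)]
        rw [integral_const_mul, hp.normal_eq j t ht a f hf, mul_zero]
    · simp only [minorStack, Sum.elim_inr, hj, if_false, Pi.zero_apply, sub_zero]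
      have hm := (hd.localState_mem j ht).apply a
      refine main _ (hP.primSpace_le _ hm) ?_ ?_
      · exact (hP.commonSpace_orthogonal_local (by omega) j).mono le_rfl
          (Submodule.span_le.2 (by rintro _ rfl; exact hm))
      · exact (hP.primSpace_orthogonal (disjoint_localIdx (Ne.symm hj) t t)).mono
          (localSpace_le_primSpace P i ht) (Submodule.span_le.2 (by rintro _ rfl; exact hm))

theorem IsDecomposition.xhatMinor_ae [IsProbabilityMeasure μ] (hP : P.Admissible μ N S)
    (hd : IsDecomposition P g uc ul)
    (hp : IsFreeEstimate P μ N p) (i : Fin n) {t : ℕ} (ht : t ≤ N) :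
    ∀ᵐ ω ∂μ, xhatMinor P g μ i t ω = minorEstimate P p uc ul i t ω :=
  llms_ae_eq (hP.info_mem i ht) (hd.state_mem hP ht) (hd.minorEstimate_mem hp i t)
    (hd.normal_eq_minor hP hp i ht)

theorem IsDecomposition.xhatLoc_ae [IsProbabilityMeasure μ] (hP : P.Admissible μ N S)
    (hd : IsDecomposition P g uc ul)
    (hp : IsFreeEstimate P μ N p) (i : Fin n) {t : ℕ} (ht : t ≤ N) :
    ∀ᵐ ω ∂μ, xhatLoc P g μ i t ω =
      minorPart i (commonState P uc t ω) + (localDrift i (ul i) t ω + p i t ω) := by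
  filter_upwards [hd.xhatMinor_ae hP hp i ht] with ω hω
  funext a
  rw [xhatLoc, hω]
  simp [minorEstimate, minorStack, minorPart]

/-- The estimation error of a minor agent does not depend on the strategy. -/
theorem IsFreeEstimate.xhatLoc_ae [IsProbabilityMeasure μ] (hP : P.Admissible μ N S)
    (hp : IsFreeEstimate P μ N p) (g : M.AffineStrategy) (i : Fin n)
    {t : ℕ} (ht : t ≤ N) :
    ∀ᵐ ω ∂μ, xhatLoc P g μ i t ω = x P g i t ω - (freeState P i t ω - p i t ω) := by
  obtain ⟨uc, ul, hd⟩ := exists_isDecomposition P g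
  filter_upwards [hd.xhatLoc_ae hP hp i ht] with ω hω
  rw [hω, hd.x_eq]
  abel

end Estimation

/-! ### The recursive least squares filter -/

section Kalman

variable {n : ℕ} {M : Model n} (S : M.Covariances) (i : Fin n)

/-- The covariance of the error of the prediction of `x_i(t)` before `y_i(t)` is observed. -/
def priorCov : ℕ → Matrix (Fin (M.dx i)) (Fin (M.dx i)) ℝ
  | 0 => S.x i
  | t + 1 => M.A₁₁ i * Model.errorCov S i t * (M.A₁₁ i)ᵀ + S.w i

/-- `priorCov` gives the initial step and the later steps the same shape, so that
`IsFreeEstimate.update` can treat both at once. -/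
theorem filterInnovationCov_eq (t : ℕ) :
    Model.filterInnovationCov S i t = M.C i * priorCov S i t * (M.C i)ᵀ + S.v i := by
  cases t <;> simp only [Model.filterInnovationCov, innovationCov, priorCov, Matrix.mul_zero,
    Matrix.zero_mul, zero_add, Matrix.mul_add, Matrix.add_mul, Matrix.mul_assoc]

theorem filterGain_eq (t : ℕ) :
    Model.filterGain S i t =
      priorCov S i t * (M.C i)ᵀ * (M.C i * priorCov S i t * (M.C i)ᵀ + S.v i)⁻¹ := by
  rw [← filterInnovationCov_eq]
  cases t with
  | zero => simp only [Model.filterGain, Model.filterInnovationCov, kalmanGain, priorCov,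
      Matrix.mul_zero, Matrix.zero_mul, zero_add]
  | succ t => simp only [Model.filterGain, Model.filterInnovationCov, kalmanGain, priorCov,
      Matrix.add_mul]

theorem errorCov_eq (t : ℕ) :
    Model.errorCov S i t = priorCov S i t - Model.filterGain S i t *
      (M.C i * priorCov S i t * (M.C i)ᵀ + S.v i) * (Model.filterGain S i t)ᵀ := by
  rw [← filterInnovationCov_eq]
  cases t with
  | zero => simp only [Model.errorCov, kalmanCov, Model.filterGain, Model.filterInnovationCov,
      priorCov, Matrix.mul_zero, Matrix.zero_mul, zero_add]
  | succ t => rfl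

variable {Ω : Type*} (P : Primitives M Ω) (p : ∀ i : Fin n, ℕ → Ω → Fin (M.dx i) → ℝ)

/-- The prediction of the free state at time `t` from the free outputs before time `t`. -/
def freePrediction : ℕ → Ω → Fin (M.dx i) → ℝ
  | 0 => fun _ => 0
  | t + 1 => fun ω => M.A₁₁ i *ᵥ p i t ω

/-- The error of the prediction of the free state. -/
def predictionError (t : ℕ) (ω : Ω) : Fin (M.dx i) → ℝ :=
  freeState P i t ω - freePrediction i p t ω

theorem predictionError_zero (ω : Ω) : predictionError i P p 0 ω = P.x i ω :=
  sub_zero _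

theorem predictionError_succ (t : ℕ) (ω : Ω) : predictionError i P p (t + 1) ω =
    M.A₁₁ i *ᵥ (freeState P i t ω - p i t ω) + P.w i t ω := by
  simp only [predictionError, freeState, freePrediction, mulVec_sub]
  abel

variable {S i P p} [MeasurableSpace Ω] {μ : Measure Ω} {N : ℕ}

/-- The difference of two solutions of the normal equations lies in `localSpace` and is orthogonal
to `localSpace`, hence to itself. -/
theorem IsFreeEstimate.ae_unique [IsProbabilityMeasure μ] (hP : P.Admissible μ N S)
    (hp : IsFreeEstimate P μ N p) {t : ℕ} (ht : t ≤ N) {q : Ω → Fin (M.dx i) → ℝ}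
    (hq : VecMem (localSpace P i t) q)
    (h : ∀ a, ∀ h ∈ localSpace P i t, ∫ ω, (freeState P i t ω a - q ω a) * h ω ∂μ = 0) :
    ∀ᵐ ω ∂μ, p i t ω = q ω := by
  have hle := hP.localSpace_le i ht
  have hf := (vecMem_freeState P i ht).mono (hP.primSpace_le _)
  have hd := (hp.mem i t).sub hq
  have : ∀ a, ∀ᵐ ω ∂μ, p i t ω a - q ω a = 0 := fun a => by
    have hda : (fun ω => p i t ω a - q ω a) ∈ localSpace P i t := hd.apply a
    refine ae_eq_zero_of_integral_sq (hle hda) ?_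
    have e : ∀ ω, (p i t ω a - q ω a) * (p i t ω a - q ω a) =
        (freeState P i t ω a - q ω a) * (p i t ω a - q ω a) -
        (freeState P i t ω a - p i t ω a) * (p i t ω a - q ω a) := fun ω => by ring
    simp only [e]
    rw [integral_sub, h a _ hda, hp.normal_eq i t ht a _ hda, sub_zero]
    · exact integrable_mul_of_mem ((hf.sub (hq.mono hle)).apply a) (hle hda)
    · exact integrable_mul_of_mem ((hf.sub ((hp.mem i t).mono hle)).apply a) (hle hda)
  filter_upwards [ae_all_iff.2 this] with ω hω
  exact funext fun a => sub_eq_zero.1 (hω a)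

theorem IsFreeEstimate.moment_error_eq_zero (hp : IsFreeEstimate P μ N p) {t : ℕ} (ht : t ≤ N)
    {ι : Type*} {X : Ω → ι → ℝ} (hX : VecMem (localSpace P i t) X) :
    moment μ (fun ω => freeState P i t ω - p i t ω) X = 0 := by
  ext a b
  exact hp.normal_eq i t ht a _ (hX.apply b)

/-- The prediction uses outputs before time `t` only, so the current observation noise does not
enter its error. This makes the two uncorrelated in the update. -/
theorem IsFreeEstimate.predictionError_mem (hp : IsFreeEstimate P μ N p) {t : ℕ} (ht : t ≤ N) :
    VecMem (primSpace P N {k | k ≠ .v i ⟨t, Nat.lt_succ_iff.2 ht⟩}) (predictionError i P p t) := by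
  cases t with
  | zero =>
    rw [funext (predictionError_zero i P p)]
    exact vecMem_primSpace P (k := .x i) (by simp)
  | succ t =>
    rw [funext (predictionError_succ i P p t)]
    refine ((((hp.error_mem i (by omega)).mono (primSpace_mono P ?_)).mulVec _)).add
      (vecMem_primSpace P (k := .w i ⟨t, by omega⟩) (by simp))
    rintro k hk rfl
    have : t + 1 ≤ t := hk.2
    omega

/-- The prediction error is `A_{ii}` times the previous estimation error, orthogonal to earlier
outputs by the normal equations, plus a fresh process noise. The index type `Unit` turns a random
variable into a vector so that the moment calculus applies. -/
theorem IsFreeEstimate.moment_predictionError [IsProbabilityMeasure μ] (hP : P.Admissible μ N S)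
    (hp : IsFreeEstimate P μ N p) {t : ℕ} (ht : t + 1 ≤ N) {h : Ω → ℝ}
    (hh : h ∈ localSpace P i t) :
    moment μ (predictionError i P p (t + 1)) (fun ω (_ : Unit) => h ω) = 0 := by
  have hh' := localSpace_le_primSpace P (N := N) i (by omega) hh
  have hH : VecMem (primSpace P N (localIdx N i t)) (fun ω (_ : Unit) => h ω) :=
    VecMem.of_apply fun _ => hh'
  have hw : VecMem (primSpace P N {.w i ⟨t, by omega⟩}) (P.w i t) :=
    vecMem_primSpace P (k := .w i ⟨t, by omega⟩) rfl
  have he := hp.error_mem i (t := t) (by omega)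
  have hd : Disjoint {PrimIdx.w i ⟨t, by omega⟩} (localIdx N i t) := by
    rw [Set.disjoint_singleton_left]
    rintro ⟨-, h⟩
    exact lt_irrefl _ h
  rw [funext (predictionError_succ i P p t),
    moment_add_left ((he.mono (hP.primSpace_le _)).mulVec _) (hw.mono (hP.primSpace_le _))
      (hH.mono (hP.primSpace_le _)),
    moment_mulVec_left (he.mono (hP.primSpace_le _)) (hH.mono (hP.primSpace_le _)),
    hp.moment_error_eq_zero (by omega) (VecMem.of_apply fun _ => hh), (hP.primSpace_orthogonal hd).moment_eq_zero hw hH,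
    Matrix.mul_zero, add_zero]

theorem Primitives.Admissible.moment_x [IsProbabilityMeasure μ] (hP : P.Admissible μ N S) :
    moment μ (P.x i) (P.x i) = S.x i :=
  (covMatrix_eq_moment (hP.var_mem (.x i))).symm.trans (hP.cov_x i)

theorem Primitives.Admissible.moment_w [IsProbabilityMeasure μ] (hP : P.Admissible μ N S) {t : ℕ}
    (ht : t ≤ N) : moment μ (P.w i t) (P.w i t) = S.w i :=
  (covMatrix_eq_moment (hP.var_mem (.w i ⟨t, Nat.lt_succ_iff.2 ht⟩))).symm.trans (hP.cov_w i t ht)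

theorem Primitives.Admissible.moment_v [IsProbabilityMeasure μ] (hP : P.Admissible μ N S) {t : ℕ}
    (ht : t ≤ N) : moment μ (P.v i t) (P.v i t) = S.v i :=
  (covMatrix_eq_moment (hP.var_mem (.v i ⟨t, Nat.lt_succ_iff.2 ht⟩))).symm.trans (hP.cov_v i t ht)

/-- The update of the estimate by an observation. -/
theorem IsFreeEstimate.update [IsProbabilityMeasure μ] (hP : P.Admissible μ N S)
    (hp : IsFreeEstimate P μ N p) {t : ℕ} (ht : t ≤ N)
    (hprior : moment μ (predictionError i P p t) (predictionError i P p t) = priorCov S i t)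
    (hu : IsUnit (Model.filterInnovationCov S i t)) :
    (∀ᵐ ω ∂μ, freeState P i t ω - p i t ω = predictionError i P p t ω -
      Model.filterGain S i t *ᵥ (M.C i *ᵥ predictionError i P p t ω + P.v i t ω)) ∧
    moment μ (fun ω => freeState P i t ω - p i t ω) (fun ω => freeState P i t ω - p i t ω) =
      Model.errorCov S i t := by
  set ξ := predictionError i P p t with hξdef
  set K := Model.filterGain S i t with hKdef
  have hξm := hp.predictionError_mem (i := i) ht
  have hvm : VecMem (primSpace P N {.v i ⟨t, Nat.lt_succ_iff.2 ht⟩}) (P.v i t) :=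
    vecMem_primSpace P (k := .v i ⟨t, Nat.lt_succ_iff.2 ht⟩) rfl
  have hξ : VecMem (squareIntegrable μ) ξ := hξm.mono (hP.primSpace_le _)
  have hv : VecMem (squareIntegrable μ) (P.v i t) := hvm.mono (hP.primSpace_le _)
  have hξv : moment μ ξ (P.v i t) = 0 := by
    refine (hP.primSpace_orthogonal ?_).moment_eq_zero hξm hvm
    rw [Set.disjoint_singleton_right]
    exact fun h => h rfl
  have hM := filterInnovationCov_eq S i t
  rw [← hprior, ← hP.moment_v ht] at hM
  have hK := filterGain_eq S i t
  rw [← hprior, ← hP.moment_v ht] at hK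
  rw [hM] at hu
  obtain ⟨h1, h2⟩ := filter_step hξ hv hξv (M.C i) hu hK
  have hν : VecMem (squareIntegrable μ) fun ω => M.C i *ᵥ ξ ω + P.v i t ω := (hξ.mulVec _).add hv
  have he : VecMem (squareIntegrable μ) fun ω => ξ ω - K *ᵥ (M.C i *ᵥ ξ ω + P.v i t ω) :=
    hξ.sub (hν.mulVec K)
  have hpred : VecMem (localSpace P i t) (freePrediction i p t) := by
    cases t with
    | zero => exact VecMem.zero
    | succ t => exact ((hp.mem i t).mono (localSpace_mono P i t.le_succ)).mulVec _
  have hνeq : ∀ ω, M.C i *ᵥ ξ ω + P.v i t ω =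
      freeOutput P i t ω - M.C i *ᵥ freePrediction i p t ω := fun ω => by
    rw [hξdef, predictionError, freeOutput, mulVec_sub]
    abel
  have hνl : VecMem (localSpace P i t) fun ω => M.C i *ᵥ ξ ω + P.v i t ω := by
    simp only [hνeq]
    exact (vecMem_localSpace P i le_rfl).sub (hpred.mulVec _)
  -- The candidate error is orthogonal to the current innovation by the choice of the gain, and to
  -- earlier outputs because both the prediction error and the innovation are. Together these
  -- exhaust `localSpace P i t`.
  have horth : ∀ a, localSpace P i t ≤ orthogonalTo μ
      (fun ω => (ξ ω - K *ᵥ (M.C i *ᵥ ξ ω + P.v i t ω)) a) (he.apply a) := fun a => by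
    set W := orthogonalTo μ (fun ω => (ξ ω - K *ᵥ (M.C i *ᵥ ξ ω + P.v i t ω)) a) (he.apply a)
    have hνW : VecMem W fun ω => M.C i *ᵥ ξ ω + P.v i t ω := VecMem.of_apply fun b =>
      ⟨hν.apply b, congrFun (congrFun h1 a) b⟩
    -- Phrased with `s + 1 = t`, the claim is vacuous at `t = 0`, where there are no earlier
    -- outputs.
    have hprev : ∀ s, s + 1 = t → localSpace P i s ≤ W := by
      rintro s rfl h hh
      have hhp := localSpace_le_primSpace P (N := N) i (by omega) hh
      have hHp : VecMem (primSpace P N (localIdx N i s)) (fun ω (_ : Unit) => h ω) :=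
        VecMem.of_apply fun _ => hhp
      have hH := hHp.mono (hP.primSpace_le _)
      have hdis : Disjoint {PrimIdx.v i ⟨s + 1, Nat.lt_succ_iff.2 ht⟩} (localIdx N i s) := by
        rw [Set.disjoint_singleton_left]
        rintro ⟨-, h⟩
        exact Nat.not_succ_le_self s h
      have e1 := hp.moment_predictionError hP ht hh
      have e2 := (hP.primSpace_orthogonal hdis).moment_eq_zero hvm hHp
      have e3 : moment μ (fun ω => ξ ω - K *ᵥ (M.C i *ᵥ ξ ω + P.v i (s + 1) ω))
          (fun ω (_ : Unit) => h ω) = 0 := by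
        rw [moment_sub_left hξ (hν.mulVec K) hH, moment_mulVec_left hν hH,
          moment_add_left (hξ.mulVec _) hv hH, moment_mulVec_left hξ hH, e1, e2]
        simp
      exact ⟨hP.primSpace_le _ hhp, congrFun (congrFun e3 a) ()⟩
    have hpredW : VecMem W (freePrediction i p t) := by
      cases t with
      | zero => exact VecMem.zero
      | succ s => exact ((hp.mem i s).mono (hprev s rfl)).mulVec _
    refine localSpace_le fun s hs => ?_
    rcases hs.eq_or_lt with rfl | hs
    -- The current free output is the innovation plus `C_i` times the prediction, and the prediction
    -- belongs to the earlier space.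
    · rw [show freeOutput P i s = fun ω => (M.C i *ᵥ ξ ω + P.v i s ω) +
        M.C i *ᵥ freePrediction i p s ω from funext fun ω => by rw [hνeq]; abel]
      exact hνW.add (hpredW.mulVec _)
    · exact (vecMem_localSpace P i (Nat.le_pred_of_lt hs)).mono
        (hprev (t - 1) (by omega))
  have hq := hpred.add (hνl.mulVec K)
  have hae := hp.ae_unique hP ht hq fun a h hh => by
    have := (horth a hh).2
    refine Eq.trans (congrArg _ (funext fun ω => ?_)) this
    simp only [hξdef, predictionError, Pi.add_apply, Pi.sub_apply]
    ring
  have hae' : ∀ᵐ ω ∂μ, freeState P i t ω - p i t ω =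
      ξ ω - K *ᵥ (M.C i *ᵥ ξ ω + P.v i t ω) := by
    filter_upwards [hae] with ω hω
    rw [hω]
    simp only [hξdef, predictionError]
    abel
  refine ⟨hae', ?_⟩
  rw [errorCov_eq, ← hprior, ← hP.moment_v ht, ← h2]
  ext a b
  refine integral_congr_ae ?_
  filter_upwards [hae'] with ω hω
  rw [hω]

/-- The noise `w_i(t)` is not among the primitives behind the estimation error at time `t`, so the
cross terms vanish. The error covariance at time `t` comes from `IsFreeEstimate.update`, so
prediction and update alternate in the induction. -/
theorem IsFreeEstimate.moment_prior [IsProbabilityMeasure μ] (hP : P.Admissible μ N S)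
    (hp : IsFreeEstimate P μ N p) {t : ℕ} (ht : t ≤ N)
    (hu : ∀ s < t, IsUnit (Model.filterInnovationCov S i s)) :
    moment μ (predictionError i P p t) (predictionError i P p t) = priorCov S i t := by
  induction t with
  | zero =>
    rw [funext (predictionError_zero i P p)]
    exact hP.moment_x
  | succ t ih =>
    have hprior := ih (by omega) fun s hs => hu s (by omega)
    have hcov := (hp.update hP (by omega) hprior (hu t t.lt_succ_self)).2
    have hem := hp.error_mem i (t := t) (by omega)
    have hwm : VecMem (primSpace P N {.w i ⟨t, by omega⟩}) (P.w i t) :=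
      vecMem_primSpace P (k := .w i ⟨t, by omega⟩) rfl
    have hd : Disjoint {PrimIdx.w i ⟨t, by omega⟩} (localIdx N i t) := by
      rw [Set.disjoint_singleton_left]
      rintro ⟨-, h⟩
      exact lt_irrefl _ h
    have he := hem.mono (hP.primSpace_le _)
    have hw := hwm.mono (hP.primSpace_le _)
    have h0 := (hP.primSpace_orthogonal hd).moment_eq_zero hwm hem
    have h0' := (hP.primSpace_orthogonal hd).symm.moment_eq_zero hem hwm
    have hAe := he.mulVec (M.A₁₁ i)
    rw [funext (predictionError_succ i P p t), moment_add_left hAe hw (hAe.add hw),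
      moment_add_right hAe hAe hw, moment_add_right hw hAe hw, moment_mulVec_left he hAe,
      moment_mulVec_right he he, moment_mulVec_left he hw, moment_mulVec_right hw he, h0, h0',
      hcov, hP.moment_w (by omega), priorCov]
    simp [Matrix.mul_assoc]

theorem IsFreeEstimate.filter [IsProbabilityMeasure μ] (hP : P.Admissible μ N S)
    (hp : IsFreeEstimate P μ N p) {t : ℕ} (ht : t ≤ N)
    (hu : ∀ s ≤ t, IsUnit (Model.filterInnovationCov S i s)) :
    (∀ᵐ ω ∂μ, freeState P i t ω - p i t ω = predictionError i P p t ω -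
      Model.filterGain S i t *ᵥ (M.C i *ᵥ predictionError i P p t ω + P.v i t ω)) ∧
    moment μ (fun ω => freeState P i t ω - p i t ω) (fun ω => freeState P i t ω - p i t ω) =
      Model.errorCov S i t :=
  hp.update hP ht (hp.moment_prior hP ht fun s hs => hu s hs.le) (hu t le_rfl)

end Kalman

/-! ### The cost of a strategy -/

section Cost

variable {n : ℕ} {M : Model n} {Ω : Type*} [MeasurableSpace Ω] (P : Primitives M Ω)
  (p : ∀ i : Fin n, ℕ → Ω → Fin (M.dx i) → ℝ) (μ : Measure Ω) (N : ℕ)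
  (uc : ℕ → Ω → M.ControlIdx → ℝ) (ul : ∀ i : Fin n, ℕ → Ω → Fin (M.du i) → ℝ)

/-- The deviation of the common part of the controls from certainty equivalence. -/
def commonDeviation (t : ℕ) (ω : Ω) : M.ControlIdx → ℝ :=
  uc t ω + M.gainCom N t *ᵥ commonState P uc t ω

/-- The deviation of the local part of the controls from certainty equivalence. -/
def localDeviation (i : Fin n) (t : ℕ) (ω : Ω) : Fin (M.du i) → ℝ :=
  ul i t ω + M.gainLoc N i t *ᵥ (localDrift i (ul i) t ω + p i t ω)

/-- The weight of the common deviation at time `t`. -/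
def commonWeight (M : Model n) (N t : ℕ) : Matrix M.ControlIdx M.ControlIdx ℝ :=
  M.R + M.Bᵀ * M.riccatiCom (N - (t + 1)) * M.B

/-- The weight of the local deviation at time `t`. -/
def localWeight (M : Model n) (N : ℕ) (i : Fin n) (t : ℕ) :
    Matrix (Fin (M.du i)) (Fin (M.du i)) ℝ :=
  M.Rblock i + (M.B₁₁ i)ᵀ * M.riccatiLoc i (N - (t + 1)) * M.B₁₁ i

/-- The part of the cost that no strategy can avoid. -/
def minimalCost : ℝ :=
  (quadForm μ (M.riccatiCom N) (fun ω => Sum.elim (P.x₀ ω) 0) +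
    ∑ t ∈ Finset.range N, quadForm μ (M.riccatiCom (N - (t + 1)))
      (fun ω => Sum.elim (P.w₀ t ω) 0)) +
  ∑ i, ((quadForm μ (M.riccatiLoc i N) (P.x i) +
    ∑ t ∈ Finset.range N, quadForm μ (M.riccatiLoc i (N - (t + 1))) (P.w i t)) +
    ∑ t ∈ Finset.range N, quadForm μ (localWeight M N i t)
      (fun ω => M.gainLoc N i t *ᵥ (freeState P i t ω - p i t ω)))

/-- The part of the cost that is due to deviations from certainty equivalence. -/
def costGap : ℝ :=
  (∑ t ∈ Finset.range N, quadForm μ (commonWeight M N t) (commonDeviation P N uc t)) +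
    ∑ i, ∑ t ∈ Finset.range N, quadForm μ (localWeight M N i t) (localDeviation p N ul i t)

/-- The controls are certainty equivalent at the times `0, …, N - 1`. -/
def IsCertaintyEquivalent : Prop :=
  (∀ t < N, ∀ᵐ ω ∂μ, commonDeviation P N uc t ω = 0) ∧
    ∀ i, ∀ t < N, ∀ᵐ ω ∂μ, localDeviation p N ul i t ω = 0

end Cost

-- Positivity of the Riccati matrices and of the weights of the deviations.

section Riccati

variable {n : ℕ} {M : Model n}

theorem riccatiCom_posSemidef (hQ : M.Q.PosSemidef) (hQT : M.QT.PosSemidef) (hR : M.R.PosDef)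
    (k : ℕ) : (M.riccatiCom k).PosSemidef := by
  induction k with
  | zero => exact hQT
  | succ k ih => exact riccati_posSemidef ih hR hQ _ _

theorem Rblock_posDef (hR : M.R.PosDef) (i : Fin n) : (M.Rblock i).PosDef :=
  hR.submatrix fun a b h => by simpa using h

theorem riccatiLoc_posSemidef (hQ : M.Q.PosSemidef) (hQT : M.QT.PosSemidef) (hR : M.R.PosDef)
    (i : Fin n) (k : ℕ) : (M.riccatiLoc i k).PosSemidef := by
  induction k with
  | zero => exact hQT.submatrix _
  | succ k ih => exact riccati_posSemidef ih (Rblock_posDef hR i) (hQ.submatrix _) _ _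

theorem commonWeight_posDef (hQ : M.Q.PosSemidef) (hQT : M.QT.PosSemidef) (hR : M.R.PosDef)
    (N t : ℕ) : (commonWeight M N t).PosDef :=
  posDef_add_conj (riccatiCom_posSemidef hQ hQT hR _) hR _

theorem localWeight_posDef (hQ : M.Q.PosSemidef) (hQT : M.QT.PosSemidef) (hR : M.R.PosDef)
    (N : ℕ) (i : Fin n) (t : ℕ) : (localWeight M N i t).PosDef :=
  posDef_add_conj (riccatiLoc_posSemidef hQ hQT hR i _) (Rblock_posDef hR i) _

end Riccati

theorem IsDecomposition.commonDeviation_mem {n : ℕ} {M : Model n} {Ω : Type*}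
    {P : Primitives M Ω} {g : M.AffineStrategy} {uc : ℕ → Ω → M.ControlIdx → ℝ}
    {ul : ∀ i : Fin n, ℕ → Ω → Fin (M.du i) → ℝ} (hd : IsDecomposition P g uc ul) (N t : ℕ) :
    VecMem (commonSpace P t) (commonDeviation P N uc t) :=
  (hd.common_mem t).add ((vecMem_commonState hd.common_mem t).mulVec _)

-- Decoupling of the cost and optimality of certainty equivalence.

section Optimality

variable {n N : ℕ} {M : Model n} {Ω : Type*} [MeasurableSpace Ω] {μ : Measure Ω}
  {P : Primitives M Ω} {S : M.Covariances} {p : ∀ i : Fin n, ℕ → Ω → Fin (M.dx i) → ℝ}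
  {g : M.AffineStrategy} {uc : ℕ → Ω → M.ControlIdx → ℝ}
  {ul : ∀ i : Fin n, ℕ → Ω → Fin (M.du i) → ℝ}

theorem IsDecomposition.localDeviation_mem (hd : IsDecomposition P g uc ul)
    (hp : IsFreeEstimate P μ N p) (i : Fin n) (t : ℕ) :
    VecMem (localSpace P i t) (localDeviation p N ul i t) :=
  (hd.local_mem i t).add (((vecMem_localDrift (hd.local_mem i) t).add (hp.mem i t)).mulVec _)

theorem costGap_nonneg (hQ : M.Q.PosSemidef) (hQT : M.QT.PosSemidef) (hR : M.R.PosDef) :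
    0 ≤ costGap P p μ N uc ul :=
  add_nonneg (Finset.sum_nonneg fun t _ =>
    quadForm_nonneg (commonWeight_posDef hQ hQT hR N t).posSemidef _)
    (Finset.sum_nonneg fun i _ => Finset.sum_nonneg fun t _ =>
      quadForm_nonneg (localWeight_posDef hQ hQT hR N i t).posSemidef _)

/-- The free estimate `p` is available before any strategy is chosen, so the feedback laws can be
run as closed-loop recursions inside the information spaces, and `exists_strategy` realizes the
resulting controls. -/
theorem exists_isCertaintyEquivalent (hp : IsFreeEstimate P μ N p) :
    ∃ (g : M.AffineStrategy) (uc : ℕ → Ω → M.ControlIdx → ℝ)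
      (ul : ∀ i : Fin n, ℕ → Ω → Fin (M.du i) → ℝ),
      IsDecomposition P g uc ul ∧ IsCertaintyEquivalent P p μ N uc ul := by
  -- `commonState` and `localDrift` are functions of whole control processes, which would make the
  -- feedback definition circular. The closed-loop trajectories `X` and `D` are therefore built
  -- first, and the controls are read off from them.
  let X : ℕ → Ω → M.StateIdx → ℝ := fun t => Nat.rec (fun ω => Sum.elim (P.x₀ ω) 0)
    (fun t X ω => M.A *ᵥ X ω + M.B *ᵥ (-(M.gainCom N t *ᵥ X ω)) + Sum.elim (P.w₀ t ω) 0) t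
  let D : ∀ i : Fin n, ℕ → Ω → Fin (M.dx i) → ℝ := fun i t => Nat.rec (fun _ => 0)
    (fun t D ω => M.A₁₁ i *ᵥ D ω + M.B₁₁ i *ᵥ (-(M.gainLoc N i t *ᵥ (D ω + p i t ω)))) t
  let uc : ℕ → Ω → M.ControlIdx → ℝ := fun t ω => -(M.gainCom N t *ᵥ X t ω)
  let ul : ∀ i : Fin n, ℕ → Ω → Fin (M.du i) → ℝ :=
    fun i t ω => -(M.gainLoc N i t *ᵥ (D i t ω + p i t ω))
  have hX : ∀ t, commonState P uc t = X t := fun t => by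
    induction t with
    | zero => rfl
    | succ t ih => rw [commonState, ih]
  have hD : ∀ i t, localDrift i (ul i) t = D i t := fun i t => by
    induction t with
    | zero => rfl
    | succ t ih => rw [localDrift, ih]
  have hXm : ∀ t, VecMem (commonSpace P t) (X t) := fun t => by
    induction t with
    | zero => exact VecMem.sumElim (vecMem_commonSpace_x₀ P 0) VecMem.zero
    | succ t ih =>
      have ih := ih.mono (commonSpace_mono P t.le_succ)
      exact ((ih.mulVec _).add ((ih.mulVec _).neg.mulVec _)).add
        (VecMem.sumElim (vecMem_commonSpace_w₀ P t.lt_succ_self) VecMem.zero)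
  have hDm : ∀ i t, VecMem (localSpace P i t) (D i t) := fun i t => by
    induction t with
    | zero => exact VecMem.zero
    | succ t ih =>
      have hm := localSpace_mono P i t.le_succ
      exact ((ih.mono hm).mulVec _).add
        ((((ih.mono hm).add ((hp.mem i t).mono hm)).mulVec _).neg.mulVec _)
  obtain ⟨g, hg⟩ := exists_strategy (P := P) (uc := uc) (ul := ul)
    (fun t => ((hXm t).mulVec _).neg) (fun i t => (((hDm i t).add (hp.mem i t)).mulVec _).neg)
  refine ⟨g, uc, ul, hg, fun t _ => Filter.Eventually.of_forall fun ω => ?_,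
    fun i t _ => Filter.Eventually.of_forall fun ω => ?_⟩
  · rw [commonDeviation, hX]
    exact neg_add_cancel _
  · rw [localDeviation, hD]
    exact neg_add_cancel _

/-- Both families follow the same feedback recursion with the same initial values, the same common
noise and the same `p`. -/
theorem IsCertaintyEquivalent.ae_unique {uc' : ℕ → Ω → M.ControlIdx → ℝ}
    {ul' : ∀ i : Fin n, ℕ → Ω → Fin (M.du i) → ℝ} (h : IsCertaintyEquivalent P p μ N uc ul)
    (h' : IsCertaintyEquivalent P p μ N uc' ul') {t : ℕ} (ht : t < N) :
    (∀ᵐ ω ∂μ, uc t ω = uc' t ω) ∧ ∀ i, ∀ᵐ ω ∂μ, ul i t ω = ul' i t ω := by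
  have huc : ∀ t < N, (∀ᵐ ω ∂μ, commonState P uc t ω = commonState P uc' t ω) →
      ∀ᵐ ω ∂μ, uc t ω = uc' t ω := fun t ht e => by
    filter_upwards [e, h.1 t ht, h'.1 t ht] with ω e h1 h2
    rw [commonDeviation, ← eq_neg_iff_add_eq_zero] at h1 h2
    rw [h1, h2, e]
  have hul : ∀ i, ∀ t < N, (∀ᵐ ω ∂μ, localDrift i (ul i) t ω = localDrift i (ul' i) t ω) →
      ∀ᵐ ω ∂μ, ul i t ω = ul' i t ω := fun i t ht e => by
    filter_upwards [e, h.2 i t ht, h'.2 i t ht] with ω e h1 h2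
    rw [localDeviation, ← eq_neg_iff_add_eq_zero] at h1 h2
    rw [h1, h2, e]
  have hX : ∀ t < N, ∀ᵐ ω ∂μ, commonState P uc t ω = commonState P uc' t ω := fun t => by
    induction t with
    | zero => exact fun _ => Filter.Eventually.of_forall fun ω => rfl
    | succ t ih =>
      intro ht
      filter_upwards [ih (by omega), huc t (by omega) (ih (by omega))] with ω e1 e2
      simp only [commonState, e1, e2]
  have hD : ∀ i, ∀ t < N, ∀ᵐ ω ∂μ, localDrift i (ul i) t ω = localDrift i (ul' i) t ω :=
    fun i t => by
    induction t with
    | zero => exact fun _ => Filter.Eventually.of_forall fun ω => rfl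
    | succ t ih =>
      intro ht
      filter_upwards [ih (by omega), hul i t (by omega) (ih (by omega))] with ω e1 e2
      simp only [localDrift, e1, e2]
  exact ⟨huc t ht (hX t ht), fun i => hul i t ht (hD i t ht)⟩

variable [IsProbabilityMeasure μ]

theorem Primitives.Admissible.commonNoise_mem (hP : P.Admissible μ N S) {t : ℕ} (ht : t < N) :
    VecMem (squareIntegrable μ) (fun ω => (Sum.elim (P.w₀ t ω) 0 : M.StateIdx → ℝ)) ∧
    Orthogonal μ (commonSpace P t) (primSpace P N {.w₀ ⟨t, ht.trans N.lt_succ_self⟩}) ∧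
    VecMem (primSpace P N {.w₀ ⟨t, ht.trans N.lt_succ_self⟩})
      (fun ω => (Sum.elim (P.w₀ t ω) 0 : M.StateIdx → ℝ)) := by
  have hw : VecMem (primSpace P N {.w₀ ⟨t, ht.trans N.lt_succ_self⟩})
      (fun ω => (Sum.elim (P.w₀ t ω) 0 : M.StateIdx → ℝ)) :=
    VecMem.sumElim (vecMem_primSpace P (k := .w₀ ⟨t, ht.trans N.lt_succ_self⟩) rfl) VecMem.zero
  refine ⟨hw.mono (hP.primSpace_le _), hP.commonSpace_orthogonal (by omega) ?_, hw⟩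
  rw [Set.disjoint_singleton_right]
  exact fun h => lt_irrefl t h

theorem IsDecomposition.common_cost_eq (hP : P.Admissible μ N S) (hQ : M.Q.PosSemidef)
    (hQT : M.QT.PosSemidef) (hR : M.R.PosDef) (hd : IsDecomposition P g uc ul) :
    (∑ t ∈ Finset.range N, (quadForm μ M.Q (commonState P uc t) + quadForm μ M.R (uc t))) +
      quadForm μ M.QT (commonState P uc N) =
    (quadForm μ (M.riccatiCom N) (fun ω => Sum.elim (P.x₀ ω) 0) +
      ∑ t ∈ Finset.range N, quadForm μ (M.riccatiCom (N - (t + 1)))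
        (fun ω => Sum.elim (P.w₀ t ω) 0)) +
      ∑ t ∈ Finset.range N, quadForm μ (commonWeight M N t) (commonDeviation P N uc t) := by
  have hx := vecMem_commonState hd.common_mem
  refine sum_quadForm_eq hQ hQT hR (S := M.riccatiCom) rfl (fun _ => rfl) (x := commonState P uc)
    (w := fun t ω => Sum.elim (P.w₀ t ω) 0)
    (fun t ht => (hx t).mono (hP.commonSpace_le (by omega)))
    (fun t ht => (hd.common_mem t).mono (hP.commonSpace_le (by omega)))
    (fun t ht => (hP.commonNoise_mem ht).1) (fun _ _ _ => rfl) (fun t ht => ?_) (fun t ht => ?_)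
  · exact (hP.commonNoise_mem ht).2.1.moment_eq_zero (hx t) (hP.commonNoise_mem ht).2.2
  · exact (hP.commonNoise_mem ht).2.1.moment_eq_zero (hd.common_mem t) (hP.commonNoise_mem ht).2.2

/-- The separation principle: completing squares as if the local state were observed leaves a
deviation from full-state feedback, which splits into an unavoidable estimation part and
`localDeviation`. -/
theorem IsDecomposition.local_cost_eq (hP : P.Admissible μ N S) (hQ : M.Q.PosSemidef)
    (hQT : M.QT.PosSemidef) (hR : M.R.PosDef) (hd : IsDecomposition P g uc ul)
    (hp : IsFreeEstimate P μ N p) (i : Fin n) :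
    (∑ t ∈ Finset.range N,
      (quadForm μ (M.Qblock i) (fun ω => localDrift i (ul i) t ω + freeState P i t ω) +
        quadForm μ (M.Rblock i) (ul i t))) +
      quadForm μ (M.QTblock i) (fun ω => localDrift i (ul i) N ω + freeState P i N ω) =
    ((quadForm μ (M.riccatiLoc i N) (P.x i) +
      ∑ t ∈ Finset.range N, quadForm μ (M.riccatiLoc i (N - (t + 1))) (P.w i t)) +
      ∑ t ∈ Finset.range N, quadForm μ (localWeight M N i t)
        (fun ω => M.gainLoc N i t *ᵥ (freeState P i t ω - p i t ω))) +
      ∑ t ∈ Finset.range N, quadForm μ (localWeight M N i t) (localDeviation p N ul i t) := by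
  have hx : ∀ t ≤ N, VecMem (primSpace P N (localIdx N i t))
      fun ω => localDrift i (ul i) t ω + freeState P i t ω := fun t ht => hd.localState_mem i ht
  have hul : ∀ t ≤ N, VecMem (primSpace P N (localIdx N i t)) (ul i t) := fun t ht =>
    (hd.local_mem i t).mono (localSpace_le_primSpace P i ht)
  have hw : ∀ t (ht : t < N), VecMem (primSpace P N {.w i ⟨t, ht.trans N.lt_succ_self⟩}) (P.w i t) :=
    fun t ht => vecMem_primSpace P (k := .w i ⟨t, ht.trans N.lt_succ_self⟩) rfl
  have horth : ∀ t (ht : t < N), Orthogonal μ (primSpace P N (localIdx N i t))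
      (primSpace P N {.w i ⟨t, ht.trans N.lt_succ_self⟩}) := fun t ht => by
    refine hP.primSpace_orthogonal ?_
    rw [Set.disjoint_singleton_right]
    exact fun h => lt_irrefl t h.2
  have key := sum_quadForm_eq (μ := μ) (hQ.submatrix _ : (M.Qblock i).PosSemidef)
    (hQT.submatrix _ : (M.QTblock i).PosSemidef) (Rblock_posDef hR i) (S := M.riccatiLoc i) rfl
    (A := M.A₁₁ i) (B := M.B₁₁ i) (fun _ => rfl) (N := N)
    (x := fun t ω => localDrift i (ul i) t ω + freeState P i t ω) (u := ul i) (w := P.w i)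
    (fun t ht => (hx t ht).mono (hP.primSpace_le _))
    (fun t ht => (hul t ht.le).mono (hP.primSpace_le _))
    (fun t ht => (hw t ht).mono (hP.primSpace_le _))
    (fun t ht ω => by simp only [localDrift, freeState, mulVec_add]; abel)
    (fun t ht => (horth t ht).moment_eq_zero (hx t ht.le) (hw t ht))
    (fun t ht => (horth t ht).moment_eq_zero (hul t ht.le) (hw t ht))
  refine key.trans ?_
  rw [add_assoc (_ + _), ← Finset.sum_add_distrib]
  congr 1
  · congr 2
    funext ω
    exact zero_add _
  refine Finset.sum_congr rfl fun t ht => ?_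
  have ht := (Finset.mem_range.1 ht).le
  have he := (hp.error_mem i ht).mono (hP.primSpace_le _)
  have hdev := hd.localDeviation_mem hp i t
  have hdev2 := hdev.mono (hP.localSpace_le i ht)
  -- The deviation from full-state feedback equals the gain times the estimation error plus
  -- `localDeviation`. The latter lies in `localSpace`, to which the error is orthogonal.
  rw [← quadForm_add (he.mulVec _) hdev2]
  · refine congrArg _ (funext fun ω => ?_)
    have : M.gainLoc N i t = riccatiGain (M.riccatiLoc i (N - (t + 1))) (M.A₁₁ i) (M.B₁₁ i)
      (M.Rblock i) := rfl
    simp only [localDeviation, this, mulVec_add, mulVec_sub]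
    abel
  · rw [moment_mulVec_left he hdev2, hp.moment_error_eq_zero ht hdev, Matrix.mul_zero]

/-- Orthogonality of the common part and of the local parts, at each single time, removes all
coupling between them from the expected cost. -/
theorem IsDecomposition.cost_eq_sum (hP : P.Admissible μ N S) (hd : IsDecomposition P g uc ul) :
    cost P g μ N = ((∑ t ∈ Finset.range N,
      (quadForm μ M.Q (commonState P uc t) + quadForm μ M.R (uc t))) +
      quadForm μ M.QT (commonState P uc N)) +
    ∑ i, ((∑ t ∈ Finset.range N,
      (quadForm μ (M.Qblock i) (fun ω => localDrift i (ul i) t ω + freeState P i t ω) +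
        quadForm μ (M.Rblock i) (ul i t))) +
      quadForm μ (M.QTblock i) (fun ω => localDrift i (ul i) N ω + freeState P i N ω)) := by
  have hc2 : ∀ {t}, t ≤ N → commonSpace P t ≤ squareIntegrable μ :=
    fun ht => hP.commonSpace_le (by omega)
  have hx : ∀ t ≤ N, ∀ (Q : Matrix M.StateIdx M.StateIdx ℝ), quadForm μ Q (state P g t) =
      quadForm μ Q (commonState P uc t) + ∑ i, quadForm μ
        (Q.submatrix (fun a => Sum.inr ⟨i, a⟩) fun a => Sum.inr ⟨i, a⟩)
        (fun ω => localDrift i (ul i) t ω + freeState P i t ω) := fun t ht Q => by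
    rw [funext (hd.state_eq t)]
    exact quadForm_add_minorStack ((vecMem_commonState hd.common_mem t).mono (hc2 ht))
      (X := fun i ω => localDrift i (ul i) t ω + freeState P i t ω)
      (fun i => (hd.localState_mem i ht).mono (hP.primSpace_le _))
      (fun i => (hP.commonSpace_orthogonal_local (by omega) i).moment_eq_zero
        (vecMem_commonState hd.common_mem t) (hd.localState_mem i ht))
      (fun i j hij => (hP.primSpace_orthogonal (disjoint_localIdx hij t t)).moment_eq_zero
        (hd.localState_mem i ht) (hd.localState_mem j ht)) Q
  have hulm : ∀ i, ∀ t ≤ N, VecMem (primSpace P N (localIdx N i t)) (ul i t) := fun i t ht =>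
    (hd.local_mem i t).mono (localSpace_le_primSpace P i ht)
  have hu : ∀ t ≤ N, quadForm μ M.R (control P g t) =
      quadForm μ M.R (uc t) + ∑ i, quadForm μ (M.Rblock i) (ul i t) := fun t ht => by
    rw [funext (hd.control_eq t)]
    exact quadForm_add_minorStack ((hd.common_mem t).mono (hc2 ht)) (X := fun i => ul i t)
      (fun i => (hulm i t ht).mono (hP.primSpace_le _))
      (fun i => (hP.commonSpace_orthogonal_local (by omega) i).moment_eq_zero
        (hd.common_mem t) (hulm i t ht))
      (fun i j hij => (hP.primSpace_orthogonal (disjoint_localIdx hij t t)).moment_eq_zero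
        (hulm i t ht) (hulm j t ht)) M.R
  have hs2 : ∀ t ≤ N, VecMem (squareIntegrable μ) (state P g t) := fun t ht => hd.state_mem hP ht
  have hu2 : ∀ t ≤ N, VecMem (squareIntegrable μ) (control P g t) := fun t ht => by
    rw [funext (hd.control_eq t)]
    exact ((hd.common_mem t).mono (hc2 ht)).add
      (VecMem.minorStack fun i => (hulm i t ht).mono (hP.primSpace_le _))
  have hi : ∀ t ∈ Finset.range N, Integrable (fun ω => state P g t ω ⬝ᵥ M.Q *ᵥ state P g t ω
      + control P g t ω ⬝ᵥ M.R *ᵥ control P g t ω) μ := fun t ht => by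
    have ht := (Finset.mem_range.1 ht).le
    exact (integrable_quadForm (hs2 t ht) _).add (integrable_quadForm (hu2 t ht) _)
  have hcost : cost P g μ N = (∑ t ∈ Finset.range N,
      (quadForm μ M.Q (state P g t) + quadForm μ M.R (control P g t))) +
      quadForm μ M.QT (state P g N) := by
    rw [cost, integral_add (integrable_finsetSum _ hi) (integrable_quadForm (hs2 N le_rfl) _),
      integral_finsetSum _ hi]
    refine congrArg₂ _ (Finset.sum_congr rfl fun t ht => ?_) rfl
    have ht := (Finset.mem_range.1 ht).le
    exact integral_add (integrable_quadForm (hs2 t ht) _) (integrable_quadForm (hu2 t ht) _)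
  rw [hcost, hx N le_rfl, Finset.sum_congr rfl fun t ht => by
    rw [hx t (Finset.mem_range.1 ht).le, hu t (Finset.mem_range.1 ht).le]]
  simp only [Finset.sum_add_distrib]
  have hcomm := Finset.sum_comm (s := Finset.range N) (t := Finset.univ)
    (f := fun t i => quadForm μ (M.Rblock i) (ul i t))
  rw [Finset.sum_comm, hcomm]
  simp only [Model.Qblock, Model.QTblock]
  ring

theorem IsDecomposition.cost_eq (hP : P.Admissible μ N S) (hQ : M.Q.PosSemidef)
    (hQT : M.QT.PosSemidef) (hR : M.R.PosDef) (hd : IsDecomposition P g uc ul)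
    (hp : IsFreeEstimate P μ N p) :
    cost P g μ N = minimalCost P p μ N + costGap P p μ N uc ul := by
  rw [hd.cost_eq_sum hP, hd.common_cost_eq hP hQ hQT hR,
    Finset.sum_congr rfl fun i _ => hd.local_cost_eq hP hQ hQT hR hp i, Finset.sum_add_distrib,
    minimalCost, costGap]
  ring

theorem IsDecomposition.costGap_eq_zero_iff (hP : P.Admissible μ N S) (hQ : M.Q.PosSemidef)
    (hQT : M.QT.PosSemidef) (hR : M.R.PosDef) (hd : IsDecomposition P g uc ul)
    (hp : IsFreeEstimate P μ N p) :
    costGap P p μ N uc ul = 0 ↔ IsCertaintyEquivalent P p μ N uc ul := by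
  have hc : ∀ t, 0 ≤ quadForm μ (commonWeight M N t) (commonDeviation P N uc t) := fun t =>
    quadForm_nonneg (commonWeight_posDef hQ hQT hR N t).posSemidef _
  have hl : ∀ i t, 0 ≤ quadForm μ (localWeight M N i t) (localDeviation p N ul i t) := fun i t =>
    quadForm_nonneg (localWeight_posDef hQ hQT hR N i t).posSemidef _
  rw [costGap, add_eq_zero_iff_of_nonneg (Finset.sum_nonneg fun t _ => hc t)
    (Finset.sum_nonneg fun i _ => Finset.sum_nonneg fun t _ => hl i t),
    Finset.sum_eq_zero_iff_of_nonneg fun t _ => hc t,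
    Finset.sum_eq_zero_iff_of_nonneg fun i _ => Finset.sum_nonneg fun t _ => hl i t]
  simp only [Finset.sum_eq_zero_iff_of_nonneg fun t (_ : t ∈ Finset.range N) => hl _ t,
    Finset.mem_univ, true_imp_iff, Finset.mem_range, IsCertaintyEquivalent]
  refine and_congr (forall₂_congr fun t ht => ?_) (forall_congr' fun i => forall₂_congr fun t ht => ?_)
  · exact quadForm_eq_zero_iff (commonWeight_posDef hQ hQT hR N t)
      ((hd.commonDeviation_mem N t).mono (hP.commonSpace_le (by omega)))
  · exact quadForm_eq_zero_iff (localWeight_posDef hQ hQT hR N i t)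
      ((hd.localDeviation_mem hp i t).mono (hP.localSpace_le i (by omega)))

/-- After the estimates are replaced by their explicit values, the equation for the major agent says
that the major block of the common deviation vanishes, and the equation for a minor agent says that
its block of the common deviation and its local deviation add up to zero. -/
theorem IsDecomposition.hasOptimalForm_iff (hP : P.Admissible μ N S)
    (hd : IsDecomposition P g uc ul) (hp : IsFreeEstimate P μ N p) :
    HasOptimalForm P g μ N ↔ IsCertaintyEquivalent P p μ N uc ul := by
  have h₀ : ∀ t < N, (∀ᵐ ω ∂μ, u₀ P g t ω = -(M.gainCom₀ N t *ᵥ xhatCom P g μ t ω)) ↔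
      ∀ᵐ ω ∂μ, (fun a => commonDeviation P N uc t ω (Sum.inl a)) = 0 := fun t ht => by
    refine Filter.eventually_congr ?_
    filter_upwards [hd.xhatCom_ae hP ht.le] with ω hω
    rw [hω, hd.major, eq_neg_iff_add_eq_zero]
    rfl
  have h₁ : ∀ t < N, ∀ i, (∀ᵐ ω ∂μ, u P g i t ω = -(M.gainComMinor N i t *ᵥ xhatCom P g μ t ω)
      - M.gainLoc N i t *ᵥ (xhatLoc P g μ i t ω - xhatComMinor P g μ i t ω)) ↔
      ∀ᵐ ω ∂μ, minorPart i (commonDeviation P N uc t ω) + localDeviation p N ul i t ω = 0 :=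
    fun t ht i => by
    refine Filter.eventually_congr ?_
    filter_upwards [hd.xhatCom_ae hP ht.le, hd.xhatLoc_ae hP hp i ht.le] with ω hω hω'
    have e1 : xhatComMinor P g μ i t ω = minorPart i (commonState P uc t ω) := by
      funext a; rw [xhatComMinor, hω]; rfl
    have e2 : M.gainComMinor N i t *ᵥ commonState P uc t ω =
        minorPart i (M.gainCom N t *ᵥ commonState P uc t ω) := rfl
    have e3 : minorPart i (commonDeviation P N uc t ω) =
        minorPart i (uc t ω) + minorPart i (M.gainCom N t *ᵥ commonState P uc t ω) := rfl
    rw [hω, hω', e1, e2, e3, hd.minor, add_sub_cancel_left, localDeviation, ← sub_eq_zero]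
    refine Eq.congr ?_ rfl
    abel
  constructor
  · intro h
    -- The two summands lie in the orthogonal spaces `commonSpace` and `localSpace`, so each of them
    -- vanishes.
    have hsplit : ∀ t < N, ∀ i, (∀ᵐ ω ∂μ, minorPart i (commonDeviation P N uc t ω) = 0) ∧
        ∀ᵐ ω ∂μ, localDeviation p N ul i t ω = 0 := fun t ht i => by
      have h1 := (h₁ t ht i).1 ((h t ht).2 i)
      have hc := (hd.commonDeviation_mem N t).minorPart i
      have hl := hd.localDeviation_mem hp i t
      have ho : Orthogonal μ (commonSpace P t) (localSpace P i t) :=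
        (hP.commonSpace_orthogonal_local (t := t) (by omega) i).mono le_rfl
          (localSpace_le_primSpace P i ht.le)
      exact ⟨ae_eq_zero_of_orthogonal_add (hP.commonSpace_le (by omega)) ho hc hl h1,
        ae_eq_zero_of_orthogonal_add (hP.localSpace_le i ht.le) ho.symm hl hc
          (h1.mono fun ω hω => by rw [add_comm]; exact hω)⟩
    refine ⟨fun t ht => ?_, fun i t ht => (hsplit t ht i).2⟩
    filter_upwards [(h₀ t ht).1 (h t ht).1, ae_all_iff.2 fun i => (hsplit t ht i).1] with ω e e'
    exact stacked_ext (fun a => congrFun e a) e'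
  · rintro ⟨hc, hl⟩ t ht
    refine ⟨(h₀ t ht).2 ?_, fun i => (h₁ t ht i).2 ?_⟩
    · filter_upwards [hc t ht] with ω hω
      rw [hω]; rfl
    · filter_upwards [hc t ht, hl i t ht] with ω hω hω'
      rw [hω, hω', add_zero]; rfl

/-- `minimalCost` is the same for all strategies and is attained by a certainty equivalent one, so
optimality means zero gap. -/
theorem Primitives.Admissible.isOptimal_iff (hP : P.Admissible μ N S) (hQ : M.Q.PosSemidef)
    (hQT : M.QT.PosSemidef) (hR : M.R.PosDef) (g : M.AffineStrategy) :
    IsOptimal P g μ N ↔ HasOptimalForm P g μ N := by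
  obtain ⟨p, hp⟩ := hP.exists_isFreeEstimate
  obtain ⟨uc, ul, hd⟩ := exists_isDecomposition P g
  obtain ⟨g', uc', ul', hd', hs'⟩ := exists_isCertaintyEquivalent (μ := μ) (N := N) hp
  rw [hd.hasOptimalForm_iff hP hp, ← hd.costGap_eq_zero_iff hP hQ hQT hR hp]
  rw [← hd'.costGap_eq_zero_iff hP hQ hQT hR hp] at hs'
  constructor
  · intro h
    have := h g'
    rw [hd.cost_eq hP hQ hQT hR hp, hd'.cost_eq hP hQ hQT hR hp, hs'] at this
    exact le_antisymm (by linarith) (costGap_nonneg hQ hQT hR)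
  · intro h g''
    obtain ⟨uc'', ul'', hd''⟩ := exists_isDecomposition P g''
    rw [hd.cost_eq hP hQ hQT hR hp, hd''.cost_eq hP hQ hQT hR hp, h]
    have := costGap_nonneg (P := P) (p := p) (μ := μ) (N := N) (uc := uc'') (ul := ul'') hQ hQT hR
    linarith

/-! ### Certainty equivalent controls are centred -/

/-- A general affine strategy may inject constants, but certainty equivalence makes the common
control a linear feedback of the common state, which starts centred and is driven by centred noise.
The feedback holds only almost surely, hence `mem_centred_congr`. -/
theorem IsDecomposition.centred_common (hP : P.Admissible μ N S) (hd : IsDecomposition P g uc ul)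
    (h : IsCertaintyEquivalent P p μ N uc ul) :
    (∀ t ≤ N, VecMem (centred μ) (commonState P uc t)) ∧ ∀ t < N, VecMem (centred μ) (uc t) := by
  have hu : ∀ t < N, VecMem (centred μ) (commonState P uc t) → VecMem (centred μ) (uc t) :=
    fun t ht hx => VecMem.of_apply fun a => by
      refine mem_centred_congr (hP.commonSpace_le (by omega) ((hd.common_mem t).apply a))
        ((hx.mulVec (M.gainCom N t)).neg.apply a) ?_
      filter_upwards [h.1 t ht] with ω hω
      rw [commonDeviation, ← eq_neg_iff_add_eq_zero] at hω
      rw [hω]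
  have hx : ∀ t ≤ N, VecMem (centred μ) (commonState P uc t) := fun t => by
    induction t with
    | zero => exact fun _ => VecMem.sumElim (hP.var_mem .x₀) VecMem.zero
    | succ t ih =>
      intro ht
      have ih := ih (by omega)
      exact ((ih.mulVec _).add ((hu t (by omega) ih).mulVec _)).add
        (VecMem.sumElim (hP.var_mem (.w₀ ⟨t, by omega⟩)) VecMem.zero)
  exact ⟨hx, fun t ht => hu t ht (hx t ht.le)⟩

theorem IsDecomposition.centred_data (hP : P.Admissible μ N S) (hd : IsDecomposition P g uc ul)
    (h : IsCertaintyEquivalent P p μ N uc ul) {t : ℕ} (ht : t ≤ N) :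
    VecMem (centred μ) (state P g t) ∧ VecMem (centred μ) (info₀ P g t) ∧
      ∀ i, VecMem (centred μ) (info P g i t) := by
  obtain ⟨hX, hU⟩ := hd.centred_common hP h
  have hloc : ∀ i, ∀ t ≤ N, VecMem (centred μ)
      fun ω => localDrift i (ul i) t ω + freeState P i t ω := fun i t ht =>
    (hd.localState_mem i ht).mono (hP.primSpace_le_centred _)
  have hx₀ : ∀ s ≤ N, VecMem (centred μ) (x₀ P g s) := fun s hs => by
    rw [funext (hd.x₀_eq s)]; exact (hX s hs).precomp _
  have hu₀ : ∀ s < N, VecMem (centred μ) (u₀ P g s) := fun s hs => by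
    rw [funext (hd.major s)]; exact (hU s hs).precomp _
  have hu : ∀ i, ∀ s < N, VecMem (centred μ) (u P g i s) := fun i s hs => by
    rw [funext (hd.minor i s)]
    exact ((hU s hs).minorPart i).add ((hd.local_mem i s).mono
      ((localSpace_le_primSpace P i hs.le).trans (hP.primSpace_le_centred _)))
  have hy : ∀ i, ∀ s ≤ N, VecMem (centred μ) (y P g i s) := fun i s hs => by
    have hx : VecMem (centred μ) (x P g i s) := by
      rw [funext (hd.x_eq i s)]
      exact ((hX s hs).minorPart i).add (hloc i s hs)
    exact (hx.mulVec _).add (hP.var_mem (.v i ⟨s, by omega⟩))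
  have hxt : ∀ s : Fin (t + 1), s.1 ≤ N := fun s => by omega
  have hut : ∀ s : Fin t, s.1 < N := fun s => by omega
  refine ⟨?_, ?_, fun i => ?_⟩
  · rw [funext (hd.state_eq t)]
    exact (hX t ht).add (VecMem.minorStack fun i => hloc i t ht)
  · exact VecMem.prodMk (VecMem.pi fun s => hx₀ s (hxt s)) (VecMem.pi fun s => hu₀ s (hut s))
  · exact VecMem.prodMk (VecMem.pi fun s => hx₀ s (hxt s)) (VecMem.prodMk
      (VecMem.pi fun s => hy i s (hxt s)) (VecMem.prodMk (VecMem.pi fun s => hu₀ s (hut s))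
      (VecMem.pi fun s => hu i s (hut s))))

end Optimality

/-! ### The recursions for the estimates -/

section Recursions

variable {n N : ℕ} {M : Model n} {Ω : Type*} [MeasurableSpace Ω] {μ : Measure Ω}
  [IsProbabilityMeasure μ] {P : Primitives M Ω} {S : M.Covariances}
  {p : ∀ i : Fin n, ℕ → Ω → Fin (M.dx i) → ℝ} {g : M.AffineStrategy}
  {uc : ℕ → Ω → M.ControlIdx → ℝ} {ul : ∀ i : Fin n, ℕ → Ω → Fin (M.du i) → ℝ}

theorem IsDecomposition.xhatCom_ae_condExp (hP : P.Admissible μ N S)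
    (hd : IsDecomposition P g uc ul) {t : ℕ} (ht : t ≤ N) :
    xhatCom P g μ t =ᵐ[μ] μ[state P g t | commonSigma P g t] := by
  have hY : VecMem (primSpace P N (commonIdx n N t)ᶜ) fun ω =>
      (minorStack fun i => localDrift i (ul i) t ω + freeState P i t ω : M.StateIdx → ℝ) :=
    VecMem.minorStack fun i => (hd.localState_mem i ht).mono (primSpace_mono P
      (disjoint_commonIdx_localIdx i t t).symm.subset_compl_right)
  have h := hP.condExp_common g ht (vecMem_commonState hd.common_mem t) disjoint_compl_right hY
  rw [← funext (hd.state_eq t)] at h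
  exact (Filter.EventuallyEq.trans (hd.xhatCom_ae hP ht) h.symm)

/-- Although `uc` was merely chosen, it is determined almost surely: the local part is centred and
independent of the common data. -/
theorem IsDecomposition.controlCom_ae (hP : P.Admissible μ N S)
    (hd : IsDecomposition P g uc ul) {t : ℕ} (ht : t ≤ N) :
    ∀ᵐ ω ∂μ, controlCom P g μ t ω = uc t ω := by
  have hY : VecMem (primSpace P N (commonIdx n N t)ᶜ) fun ω =>
      (minorStack fun i => ul i t ω : M.ControlIdx → ℝ) :=
    VecMem.minorStack fun i => (hd.local_mem i t).mono ((localSpace_le_primSpace P i ht).trans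
      (primSpace_mono P (disjoint_commonIdx_localIdx i t t).symm.subset_compl_right))
  have h := hP.condExp_common g ht (hd.common_mem t) disjoint_compl_right hY
  rw [← funext (hd.control_eq t)] at h
  exact h

theorem IsDecomposition.xhatCom_zero (hP : P.Admissible μ N S) (hd : IsDecomposition P g uc ul) :
    ∀ᵐ ω ∂μ, xhatCom P g μ 0 ω = Sum.elim (x₀ P g 0 ω) 0 := by
  filter_upwards [hd.xhatCom_ae hP N.zero_le] with ω hω
  rw [hω, x₀_zero]
  rfl

theorem IsDecomposition.xhatCom_succ (hP : P.Admissible μ N S) (hd : IsDecomposition P g uc ul)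
    {t : ℕ} (ht : t < N) : ∀ᵐ ω ∂μ, xhatCom P g μ (t + 1) ω =
      M.A *ᵥ (Sum.elim (x₀ P g t ω) fun p => xhatComMinor P g μ p.1 t ω p.2)
      + M.B *ᵥ (Sum.elim (u₀ P g t ω) fun p => controlCom P g μ t ω (Sum.inr p))
      + Sum.elim (x₀ P g (t + 1) ω - M.A₀₀ *ᵥ (x₀ P g t ω) - M.B₀₀ *ᵥ (u₀ P g t ω)) 0 := by
  filter_upwards [hd.xhatCom_ae hP ht, hd.xhatCom_ae hP ht.le, hd.controlCom_ae hP ht.le]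
    with ω h1 h2 h3
  have e1 : (Sum.elim (x₀ P g t ω) fun p => xhatComMinor P g μ p.1 t ω p.2) =
      commonState P uc t ω := by
    refine stacked_ext (fun a => ?_) fun i => ?_
    · rw [hd.x₀_eq]; rfl
    · funext a
      rw [← h2]; rfl
  have e2 : (Sum.elim (u₀ P g t ω) fun p => controlCom P g μ t ω (Sum.inr p)) = uc t ω := by
    refine stacked_ext (fun a => ?_) fun i => ?_
    · rw [hd.major]; rfl
    · rw [h3]; rfl
  rw [h1, e1, e2, x₀_succ, add_assoc (M.A₀₀ *ᵥ _), add_sub_cancel_left, add_sub_cancel_left]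
  rfl

theorem IsFreeEstimate.xhatLoc_zero (hP : P.Admissible μ N S) (hp : IsFreeEstimate P μ N p)
    (g : M.AffineStrategy) {i : Fin n} (hu : IsUnit (Model.filterInnovationCov S i 0)) :
    ∀ᵐ ω ∂μ, xhatLoc P g μ i 0 ω = Model.filterGain S i 0 *ᵥ (y P g i 0 ω) := by
  have h := (hp.filter hP N.zero_le (i := i) fun s hs => by rwa [Nat.le_zero.1 hs]).1
  filter_upwards [h, hp.xhatLoc_ae hP g i N.zero_le] with ω h1 h2
  rw [h2, h1, predictionError_zero, y, x_zero, sub_sub_cancel]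

theorem IsFreeEstimate.xhatLoc_succ (hP : P.Admissible μ N S) (hp : IsFreeEstimate P μ N p)
    (g : M.AffineStrategy) {i : Fin n} {t : ℕ} (ht : t < N)
    (hu : ∀ s ≤ t + 1, IsUnit (Model.filterInnovationCov S i s)) :
    ∀ᵐ ω ∂μ, xhatLoc P g μ i (t + 1) ω = prediction P g μ i t ω
      + Model.filterGain S i (t + 1) *ᵥ
          (y P g i (t + 1) ω - (M.C i) *ᵥ (prediction P g μ i t ω)) := by
  filter_upwards [(hp.filter hP ht hu).1, hp.xhatLoc_ae hP g i ht, hp.xhatLoc_ae hP g i ht.le]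
    with ω h1 h2 h3
  -- State and prediction are driven by the same controls and major state, so these cancel and only
  -- the strategy-free prediction error remains.
  have e : prediction P g μ i t ω = x P g i (t + 1) ω - predictionError i P p (t + 1) ω := by
    rw [prediction, h3, x_succ, predictionError_succ, mulVec_sub]
    abel
  have e' : y P g i (t + 1) ω - M.C i *ᵥ prediction P g μ i t ω =
      M.C i *ᵥ predictionError i P p (t + 1) ω + P.v i (t + 1) ω := by
    rw [e, y, mulVec_sub]
    abel
  rw [e', h2, h1, e]
  exact sub_sub_eq_add_sub _ _ _ |>.trans (add_sub_right_comm _ _ _)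

theorem IsFreeEstimate.covMatrix_error (hP : P.Admissible μ N S) (hp : IsFreeEstimate P μ N p)
    (g : M.AffineStrategy) {i : Fin n} {t : ℕ} (ht : t ≤ N)
    (hu : ∀ s ≤ t, IsUnit (Model.filterInnovationCov S i s)) :
    covMatrix μ (fun ω => x P g i t ω - xhatLoc P g μ i t ω) = Model.errorCov S i t := by
  rw [← (hp.filter hP ht hu).2, ← covMatrix_eq_moment
    ((hp.error_mem i ht).mono (hP.primSpace_le_centred _))]
  refine covMatrix_congr ?_
  filter_upwards [hp.xhatLoc_ae hP g i ht] with ω hω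
  rw [hω, sub_sub_cancel]

end Recursions

end MajorMinor

end

-- The main theorem.

open MeasureTheory MajorMinor in
theorem mainTheorem2 {n : ℕ} (M : Model n) (N : ℕ)
    (hQ : M.Q.PosSemidef) (hQT : M.QT.PosSemidef) (hR : M.R.PosDef)
    {Ω : Type*} [MeasurableSpace Ω] (μ : Measure Ω) [IsProbabilityMeasure μ]
    (P : Primitives M Ω) (S : M.Covariances) (hP : P.Admissible μ N S) :
    -- a best affine strategy exists
    (∃ g : M.AffineStrategy, IsOptimal P g μ N) ∧
    -- it is unique: any two best strategies produce the same controls almost surely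
    (∀ g g' : M.AffineStrategy, IsOptimal P g μ N → IsOptimal P g' μ N → ∀ t < N,
      (∀ᵐ ω ∂μ, u₀ P g t ω = u₀ P g' t ω) ∧
      ∀ i, ∀ᵐ ω ∂μ, u P g i t ω = u P g' i t ω) ∧
    -- it is characterized by its form
    (∀ g : M.AffineStrategy, IsOptimal P g μ N ↔ HasOptimalForm P g μ N) ∧
    -- under a best strategy the LLMS estimates are linear in the data, without constant terms
    (∀ g : M.AffineStrategy, IsOptimal P g μ N → ∀ t ≤ N,
      (∃ f : M.Info₀ t →ₗ[ℝ] (M.StateIdx → ℝ),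
        IsLLMSEstimator μ (info₀ P g t) (state P g t) f.toAffineMap) ∧
      ∀ i, ∃ f : M.Info i t →ₗ[ℝ] (M.StateIdx → ℝ),
        IsLLMSEstimator μ (info P g i t) (state P g t) f.toAffineMap) ∧
    -- the estimates, under an arbitrary affine strategy
    (∀ g : M.AffineStrategy,
      -- LLMS estimators exist
      (∀ t ≤ N,
        (∃ f, IsLLMSEstimator μ (info₀ P g t) (state P g t) f) ∧
        ∀ i, ∃ f, IsLLMSEstimator μ (info P g i t) (state P g t) f) ∧
      -- the major agent's LLMS estimate is its MMSE estimate
      (∀ t ≤ N, xhatCom P g μ t =ᵐ[μ] μ[state P g t | commonSigma P g t]) ∧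
      -- and is updated recursively
      (∀ᵐ ω ∂μ, xhatCom P g μ 0 ω = Sum.elim (x₀ P g 0 ω) 0) ∧
      (∀ t < N, ∀ᵐ ω ∂μ, xhatCom P g μ (t + 1) ω =
        M.A *ᵥ (Sum.elim (x₀ P g t ω) fun p => xhatComMinor P g μ p.1 t ω p.2)
        + M.B *ᵥ (Sum.elim (u₀ P g t ω) fun p => controlCom P g μ t ω (Sum.inr p))
        + Sum.elim (x₀ P g (t + 1) ω - M.A₀₀ *ᵥ (x₀ P g t ω) - M.B₀₀ *ᵥ (u₀ P g t ω)) 0) ∧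
      -- the minor agents' LLMS estimates follow the recursive least squares filter
      (∀ i,
        (IsUnit (Model.filterInnovationCov S i 0) → ∀ᵐ ω ∂μ,
          xhatLoc P g μ i 0 ω = Model.filterGain S i 0 *ᵥ (y P g i 0 ω)) ∧
        (∀ t < N, (∀ s ≤ t + 1, IsUnit (Model.filterInnovationCov S i s)) → ∀ᵐ ω ∂μ,
          xhatLoc P g μ i (t + 1) ω = prediction P g μ i t ω
            + Model.filterGain S i (t + 1) *ᵥ
                (y P g i (t + 1) ω - (M.C i) *ᵥ (prediction P g μ i t ω))) ∧
        (∀ t ≤ N, (∀ s ≤ t, IsUnit (Model.filterInnovationCov S i s)) →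
          covMatrix μ (fun ω => x P g i t ω - xhatLoc P g μ i t ω) = Model.errorCov S i t))) := by
  -- One free estimate is fixed before any strategy, so that the deviations of different strategies
  -- refer to the same `p`.
  obtain ⟨p, hp⟩ := hP.exists_isFreeEstimate
  have hopt := hP.isOptimal_iff hQ hQT hR
  refine ⟨?_, ?_, hopt, ?_, fun g => ?_⟩
  · obtain ⟨g, uc, ul, hd, h⟩ := exists_isCertaintyEquivalent (μ := μ) (N := N) hp
    exact ⟨g, (hopt g).2 ((hd.hasOptimalForm_iff hP hp).2 h)⟩
  · intro g g' hg hg' t ht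
    obtain ⟨uc, ul, hd⟩ := exists_isDecomposition P g
    obtain ⟨uc', ul', hd'⟩ := exists_isDecomposition P g'
    have h := (hd.hasOptimalForm_iff hP hp).1 ((hopt g).1 hg)
    have h' := (hd'.hasOptimalForm_iff hP hp).1 ((hopt g').1 hg')
    obtain ⟨hc, hl⟩ := h.ae_unique h' ht
    refine ⟨?_, fun i => ?_⟩
    · filter_upwards [hc] with ω e
      rw [hd.major, hd'.major, e]
    · filter_upwards [hc, hl i] with ω e e'
      rw [hd.minor, hd'.minor, e, e']
  · intro g hg t ht
    obtain ⟨uc, ul, hd⟩ := exists_isDecomposition P g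
    have h := (hd.hasOptimalForm_iff hP hp).1 ((hopt g).1 hg)
    obtain ⟨hs, hi₀, hi⟩ := hd.centred_data hP h ht
    exact ⟨exists_linear_isLLMSEstimator hi₀ hs (hd.commonState_mem_affOf t)
        (hd.normal_eq_common hP ht),
      fun i => exists_linear_isLLMSEstimator (hi i) hs (hd.minorEstimate_mem hp i t)
        (hd.normal_eq_minor hP hp i ht)⟩
  · obtain ⟨uc, ul, hd⟩ := exists_isDecomposition P g
    exact ⟨fun t ht => ⟨exists_isLLMSEstimator (hP.info₀_mem ht) (hd.state_mem hP ht)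
          (hd.commonState_mem_affOf t) (hd.normal_eq_common hP ht),
        fun i => exists_isLLMSEstimator (hP.info_mem i ht) (hd.state_mem hP ht)
          (hd.minorEstimate_mem hp i t) (hd.normal_eq_minor hP hp i ht)⟩,
      fun t ht => hd.xhatCom_ae_condExp hP ht, hd.xhatCom_zero hP, fun t ht => hd.xhatCom_succ hP ht,
      fun i => ⟨hp.xhatLoc_zero hP g, fun t ht hu => hp.xhatLoc_succ hP g ht hu,
        fun t ht hu => hp.covMatrix_error hP g ht hu⟩⟩
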